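/- A feedback vertex set (fvs) of a finite simple graph $G=(V,E)$ is a set $S\subseteq V$ such that $G[V\setminus S]$ is a forest; it is minimal if no proper subset of it is an fvs. Let $\mathrm{mmfvs}(G)$ be the maximum size of a minimal fvs of $G$. For $r\ge 1$, an $r$-approximate solution of Max Min FVS on $G$ is a minimal fvs $S$ of $G$ with $|S|\ge \mathrm{mmfvs}(G)/r$. Theorem. There is a single (deterministic) algorithm which, given an $n$-vertex graph $G$ and a rational number $r\ge 1$, outputs an $r$-approximate solution of Max Min FVS on $G$ in time $n^{O(n/r^{3/2})}$, where, as usual, the exponent is understood to be at least a constant. Precisely: there is an absolute constant $C$ such that for all $n$, all $n$-vertex graphs $G$ and all rational $r\ge 1$ the running time is at most $$\max(n,2)^{\,C\cdot\max(1,\;n/r^{3/2})}.$$ In particular it is at most $n^{C n/r^{3/2}}$ whenever $n\ge 2$ and $1\le r\le n^{2/3}$. Time is counted on a random access machine over the natural numbers in which each operation (constant, indirect read, indirect write, addition, truncated subtraction, test for zero) costs one unit; the input is the adjacency matrix of $G$ together with $n$ and the numerator and denominator of $r$. -/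

import Mathlib

/-! ### Feedback vertex sets -/

/-- `S` is a feedback vertex set of `G`: deleting `S` leaves a forest. -/
def IsFVS {V : Type*} (G : SimpleGraph V) (S : Finset V) : Prop :=
  (G.induce ((S : Set V)ᶜ)).IsAcyclic

/-- `S` is an inclusion-minimal feedback vertex set of `G`. -/
def IsMinimalFVS {V : Type*} (G : SimpleGraph V) (S : Finset V) : Prop :=
  Minimal (IsFVS G) S

open Classical in
/-- The largest size of a minimal feedback vertex set of the finite graph `G`. -/
noncomputable def mmfvs {V : Type*} [Fintype V] (G : SimpleGraph V) : ℕ :=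
  (Finset.univ.filter (fun S : Finset V => IsMinimalFVS G S)).sup Finset.card

/-- `S` is an `r`-approximate solution of Max Min FVS on `G`: a feasible solution (a minimal
feedback vertex set) whose size is at least `mmfvs G / r`. -/
def IsApproxSolution {V : Type*} [Fintype V] (G : SimpleGraph V) (r : ℝ) (S : Finset V) : Prop :=
  IsMinimalFVS G S ∧ (mmfvs G : ℝ) / r ≤ (S.card : ℝ)

/-! ### Random access machines with a step count

A program is a structured program over a memory of natural numbers.  The memory is organised in
arrays; array names are constants of the program, so a program uses only finitely many of them, and
cells are addressed indirectly by computed indices.  Every operation costs one unit.  The only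
arithmetic operations are addition and truncated subtraction (no multiplication), so the bit length
of a number grows by at most one per unit of time, and the model is polynomially equivalent to
Turing machines. -/

/-- Memory contents: `σ a i` is the number in cell `i` of array `a`. -/
abbrev RamMemory : Type := ℕ → ℕ → ℕ

/-- Expressions: constants, indirect reads, addition, truncated subtraction. -/
inductive RamExpr : Type
  | const (c : ℕ)
  | load (a : ℕ) (i : RamExpr)
  | add (e f : RamExpr)
  | sub (e f : RamExpr)

/-- The value of an expression. -/
def RamExpr.eval (σ : RamMemory) : RamExpr → ℕ
  | .const c => c
  | .load a i => σ a (i.eval σ)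
  | .add e f => e.eval σ + f.eval σ
  | .sub e f => e.eval σ - f.eval σ

/-- The time to evaluate an expression: one unit for every operation in it. -/
def RamExpr.cost : RamExpr → ℕ
  | .const _ => 1
  | .load _ i => i.cost + 1
  | .add e f => e.cost + f.cost + 1
  | .sub e f => e.cost + f.cost + 1

/-- Programs.  A condition holds when its value is nonzero. -/
inductive RamProgram : Type
  | skip
  | store (a : ℕ) (i e : RamExpr)
  | seq (P Q : RamProgram)
  | ite (e : RamExpr) (P Q : RamProgram)
  | while (e : RamExpr) (P : RamProgram)

/-- `RamRuns P σ t τ`: started on memory `σ`, the program `P` halts after exactly `t` units of time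
with memory `τ`.  (Programs are deterministic.) -/
inductive RamRuns : RamProgram → RamMemory → ℕ → RamMemory → Prop
  | skip (σ : RamMemory) : RamRuns .skip σ 1 σ
  | store (a : ℕ) (i e : RamExpr) (σ : RamMemory) :
      RamRuns (.store a i e) σ (i.cost + e.cost + 1)
        (Function.update σ a (Function.update (σ a) (i.eval σ) (e.eval σ)))
  | seq {P Q : RamProgram} {σ τ υ : RamMemory} {s t : ℕ}
      (hP : RamRuns P σ s τ) (hQ : RamRuns Q τ t υ) : RamRuns (.seq P Q) σ (s + t) υ
  | ite_true {e : RamExpr} {P Q : RamProgram} {σ τ : RamMemory} {t : ℕ}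
      (he : e.eval σ ≠ 0) (hP : RamRuns P σ t τ) : RamRuns (.ite e P Q) σ (e.cost + t + 1) τ
  | ite_false {e : RamExpr} {P Q : RamProgram} {σ τ : RamMemory} {t : ℕ}
      (he : e.eval σ = 0) (hQ : RamRuns Q σ t τ) : RamRuns (.ite e P Q) σ (e.cost + t + 1) τ
  | while_true {e : RamExpr} {P : RamProgram} {σ τ υ : RamMemory} {s t : ℕ}
      (he : e.eval σ ≠ 0) (hP : RamRuns P σ s τ) (hW : RamRuns (.while e P) τ t υ) :
      RamRuns (.while e P) σ (e.cost + s + t + 1) υ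
  | while_false {e : RamExpr} {P : RamProgram} {σ : RamMemory}
      (he : e.eval σ = 0) : RamRuns (.while e P) σ (e.cost + 1) σ

open Classical in
/-- The initial memory for a graph `G` on the vertices `0, …, n - 1` and a nonnegative rational `r`:
array `0` holds `n` and the numerator and denominator of `r`, array `1` holds the adjacency matrix
row by row, and all other cells are `0`. -/
noncomputable def ramInput {n : ℕ} (G : SimpleGraph (Fin n)) (r : ℚ) : RamMemory := fun a k =>
  if a = 0 then
    if k = 0 then n else if k = 1 then r.num.toNat else if k = 2 then r.den else 0
  else if a = 1 then
    if ∃ i j : Fin n, k = (i : ℕ) * n + (j : ℕ) ∧ G.Adj i j then 1 else 0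
  else 0

/-- The vertex set that a final memory represents: its characteristic vector is in array `2`. -/
def ramOutput (n : ℕ) (σ : RamMemory) : Finset (Fin n) :=
  Finset.univ.filter (fun v : Fin n => σ 2 (v : ℕ) ≠ 0)

/-! Minimal feedback vertex sets are the complements of maximal induced forests. The program fixes
one maximal forest `F`, then builds many others, and keeps the largest complement met; let `B` be
its size. What has to be shown is that `B` cannot be small unless every minimal feedback vertex set
is small.

Take a set `Q` that induces a forest. A vertex of `F` outside `Q` is heavy if it has at least two
neighbours in `Q`, and light otherwise; a light vertex with a neighbour in `Q` is a token. Each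
component of the light part that contains a token is coloured with 1 and 2, starting from one root
token and switching colour exactly when another token is entered. A monochromatic component then
contains exactly one token, hence sends exactly one edge to `Q`, so `Q` together with one colour
class is a forest and extends to a maximal forest. In that forest each heavy vertex and each
non-root token of the other colour joins two pieces that are already tied to `Q`, so acyclicity
admits at most `|Q|` of them; the others lie in the complement. Thus the heavy vertices and the
non-root tokens of one colour number at most `B + |Q|`, for either colour
(`CompleteColoring.card_le`).

Now let `T` be any maximal forest. A vertex of `F` outside `T` closes a cycle with `T`, and this
cycle must leave `F`; so the vertex has two arms that run inside `T ∩ F` and end outside `F`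
(`exists_arms`). Cut the complement of `F` into `q` parts. For a pair of parts, intersect their
union with `T` and enlarge the result, at most doubling it, to a set `Q` in which every other vertex
of `T ∩ F` has at most one neighbour (`exists_closure`). The vertices whose two arms end in this
pair are at most as many as the heavy vertices and the tokens sharing a light component with another
token (`card_armed_le`), hence at most `4 * (B + |Q|)`. Summing over the `q ^ 2` pairs bounds the
complement of `T` by `64 * q ^ 2 * B` (`SearchBound.card_le`).

The size of `Q` decides the running time. If the complement of `F` has more than `n / q ^ 2`
vertices, `F` alone is good enough; otherwise the parts have about `n / q ^ 3` vertices, and it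
suffices to try all `Q` of size `O(n / q ^ 3)`. With `q` a power of two of order `√r` this gives `n
^ O(n / r ^ (3/2))` sets, each handled in polynomial time. The machine program is verified with a
total-correctness calculus `Wp` that also bounds the time: it is polynomial in the largest number of
iterations of a loop. -/

namespace MaxMinFVS

open SimpleGraph

/-! ### Reachability and acyclicity inside vertex sets -/

section

variable {V : Type*} {G : SimpleGraph V}

/-- The graph `G` with only the edges inside `T` kept. -/
def within (G : SimpleGraph V) (T : Set V) : SimpleGraph V where
  Adj u v := G.Adj u v ∧ u ∈ T ∧ v ∈ T
  symm := ⟨fun _ _ h => ⟨h.1.symm, h.2.2, h.2.1⟩⟩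
  loopless := ⟨fun _ h => h.1.ne rfl⟩

/-- `T` induces a forest in `G`. -/
def Acyc (G : SimpleGraph V) (T : Set V) : Prop := (within G T).IsAcyclic

/-- Reachability along walks inside `T`. -/
def Reach (G : SimpleGraph V) (T : Set V) (a b : V) : Prop := (within G T).Reachable a b

theorem within_mono {T U : Set V} (h : T ⊆ U) : within G T ≤ within G U :=
  fun _ _ e => ⟨e.1, h e.2.1, h e.2.2⟩

theorem Acyc.mono {T U : Set V} (h : T ⊆ U) (hU : Acyc G U) : Acyc G T :=
  IsAcyclic.anti (within_mono h) hU

theorem Reach.mono {T U : Set V} (h : T ⊆ U) {a b : V} (hr : Reach G T a b) : Reach G U a b :=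
  Reachable.mono (within_mono h) hr

theorem Reach.refl {T : Set V} (a : V) : Reach G T a a := Reachable.refl a

theorem Reach.symm {T : Set V} {a b : V} (h : Reach G T a b) : Reach G T b a :=
  Reachable.symm h

theorem Reach.trans {T : Set V} {a b c : V} (h : Reach G T a b) (h' : Reach G T b c) :
    Reach G T a c := Reachable.trans h h'

theorem Reach.of_adj {T : Set V} {a b : V} (h : G.Adj a b) (ha : a ∈ T) (hb : b ∈ T) :
    Reach G T a b := Adj.reachable (G := within G T) ⟨h, ha, hb⟩

theorem Reach.head_induction {T : Set V} {b : V} {P : V → Prop} (h0 : P b)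
    (hs : ∀ a c, G.Adj a c → a ∈ T → c ∈ T → Reach G T c b → P c → P a) {a : V}
    (h : Reach G T a b) : P a := by
  obtain ⟨p⟩ := h
  induction p with
  | nil => exact h0
  | cons e p ih => exact hs _ _ e.1 e.2.1 e.2.2 ⟨p⟩ (ih h0 hs)

theorem Reach.mem_left {T : Set V} {a b : V} (h : Reach G T a b) (hab : a ≠ b) : a ∈ T := by
  refine Reach.head_induction (P := fun a => a ≠ b → a ∈ T) (by simp) ?_ h hab
  intro a c _ ha _ _ _ _
  exact ha

theorem Reach.mem_of_mem {T : Set V} {a b : V} (h : Reach G T a b) (hb : b ∈ T) : a ∈ T := by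
  by_cases hab : a = b
  · exact hab ▸ hb
  · exact h.mem_left hab

/-- A set that no edge inside `T` leaves is closed under reachability inside `T`. -/
theorem Reach.mem_closed {T C : Set V} (hC : ∀ u v, G.Adj u v → u ∈ C → u ∈ T → v ∈ T → v ∈ C)
    {a b : V} (h : Reach G T a b) (ha : a ∈ C) : b ∈ C := by
  refine Reach.head_induction (P := fun x => x ∈ C → b ∈ C) (fun h => h) ?_ h ha
  intro a c e h1 h2 _ ih ha
  exact ih (hC a c e ha h1 h2)

/-- `within` keeps the vertex type fixed while the set varies, unlike `induce`, in which `IsFVS` is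
phrased. The two agree because every vertex of a cycle lies on one of its edges, hence in `T`. -/
theorem acyc_iff_induce {T : Set V} : Acyc G T ↔ (G.induce T).IsAcyclic := by
  constructor
  · intro h
    exact IsAcyclic.comap (G' := within G T) ⟨Subtype.val, fun {a b} e => ⟨e, a.2, b.2⟩⟩
      Subtype.val_injective h
  · intro h v c hc
    have hT : ∀ x ∈ c.support, x ∈ T := by
      intro x hx
      rw [Walk.mem_support_iff_exists_mem_edges_of_not_nil hc.not_nil] at hx
      obtain ⟨e, he, hxe⟩ := hx
      have := c.edges_subset_edgeSet he
      induction e with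
      | h a b =>
        rcases Sym2.mem_iff.1 hxe with rfl | rfl
        · exact (this : (within G T).Adj _ _).2.1
        · exact (this : (within G T).Adj _ _).2.2
    have h' : ((within G T).induce T).IsAcyclic :=
      h.comap ⟨id, fun {a b} e => e.1⟩ Function.injective_id
    refine h' (c.induce T hT) ?_
    rw [← Walk.isCycle_map_iff_of_injective (f := (Embedding.induce T).toHom)
      (Embedding.induce (G := within G T) T).injective, Walk.map_induce]
    exact hc

theorem acyc_empty : Acyc G ∅ := by
  rw [acyc_iff_induce]
  exact IsAcyclic.of_subsingleton

theorem reach_of_walk_avoiding {T : Set V} {v : V} {x y : V} (p : (within G (insert v T)).Walk x y)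
    (hv : v ∉ p.support) : Reach G T x y := by
  induction p with
  | nil => exact Reach.refl _
  | @cons _ c _ e p ih =>
    simp only [Walk.support_cons, List.mem_cons, not_or] at hv
    have hc : v ≠ c := by
      rintro rfl
      exact hv.2 p.start_mem_support
    exact (Reach.of_adj e.1 (e.2.1.resolve_left (Ne.symm hv.1))
      (e.2.2.resolve_left (Ne.symm hc))).trans (ih hv.2)

theorem support_subset_of_walk {T : Set V} {x y : V} (p : (within G T).Walk x y) (hy : y ∈ T) :
    ∀ z ∈ p.support, z ∈ T := by
  induction p with
  | nil => simpa using hy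
  | cons e p ih =>
    intro z hz
    rcases List.mem_cons.1 hz with rfl | hz
    · exact e.2.1
    · exact ih hy z hz

/-- A vertex can be added to an induced forest iff its neighbours lie in distinct components. -/
theorem acyc_insert {T : Set V} {v : V} (hv : v ∉ T) :
    Acyc G (insert v T) ↔ Acyc G T ∧
      ∀ a ∈ T, ∀ b ∈ T, G.Adj v a → G.Adj v b → a ≠ b → ¬ Reach G T a b := by
  classical
  constructor
  · intro h
    refine ⟨h.mono (Set.subset_insert v T), ?_⟩
    rintro a ha b hb hva hvb hab hr
    obtain ⟨p⟩ := hr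
    have hps : v ∉ p.toPath.1.support := fun hm => hv (support_subset_of_walk _ hb _ hm)
    -- A path from `a` to `b` inside `T` and the path through `v` would be two different paths of a
    -- forest.
    let q := p.toPath.1.mapLe (within_mono (G := G) (Set.subset_insert v T))
    have hq : q.IsPath := p.toPath.2.mapLe _
    have hqs : v ∉ q.support := by simpa [q] using hps
    have eva : (within G (insert v T)).Adj a v :=
      ⟨hva.symm, Set.mem_insert_of_mem _ ha, Set.mem_insert _ _⟩
    have evb : (within G (insert v T)).Adj v b :=
      ⟨hvb, Set.mem_insert _ _, Set.mem_insert_of_mem _ hb⟩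
    have hp2 : (Walk.cons eva (Walk.cons evb Walk.nil)).IsPath := by
      simp [Walk.cons_isPath_iff, hab, eva.ne, evb.ne]
    have := congrArg Subtype.val ((h.subsingleton_path a b).elim ⟨q, hq⟩ ⟨_, hp2⟩)
    simp only at this
    rw [this] at hqs
    simp at hqs
  · rintro ⟨hT, hn⟩ u c hc
    by_cases hvc : v ∈ c.support
    -- Rotated to start at `v`, the cycle leaves along `v a` and returns along `b v`. These edges
    -- differ, and the part between them avoids `v`.
    · have hc' := hc.rotate hvc
      generalize c.rotate v hvc = d at hc'
      cases d with
      | nil => exact hc'.ne_nil rfl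
      | @cons _ a _ e p =>
        rw [Walk.cons_isCycle_iff] at hc'
        obtain ⟨hp, hep⟩ := hc'
        have hpr := hp.reverse
        have hedges : s(v, a) ∉ p.reverse.edges := by simpa using hep
        generalize p.reverse = r at hpr hedges
        cases r with
        | nil => exact e.ne rfl
        | @cons _ b _ e' q =>
          rw [Walk.cons_isPath_iff] at hpr
          have hab : a ≠ b := by
            rintro rfl
            simp at hedges
          exact hn a (e.2.2.resolve_left e.ne.symm) b (e'.2.2.resolve_left e'.ne.symm) e.1 e'.1 hab
            (reach_of_walk_avoiding q hpr.2).symm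
    · have hcT : ∀ e ∈ c.edges, e ∈ (within G T).edgeSet := by
        intro e he
        have h1 := c.edges_subset_edgeSet he
        induction e with
        | h x y =>
          have hx := c.fst_mem_support_of_mem_edges he
          have hy := c.snd_mem_support_of_mem_edges he
          have h1' : (within G (insert v T)).Adj x y := h1
          exact ⟨h1'.1, h1'.2.1.resolve_left fun h => hvc (h ▸ hx),
            h1'.2.2.resolve_left fun h => hvc (h ▸ hy)⟩
      exact hT (c.transfer _ hcT) (hc.transfer hcT)

theorem Acyc.not_reach {T U : Set V} {v a b : V} (h : Acyc G U) (hTU : insert v T ⊆ U)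
    (hv : v ∉ T) (ha : a ∈ T) (hb : b ∈ T) (hva : G.Adj v a) (hvb : G.Adj v b) (hab : a ≠ b) :
    ¬ Reach G T a b :=
  ((acyc_insert hv).1 (h.mono hTU)).2 a ha b hb hva hvb hab

/-- `x` is `v` or lies in a component of `T` that `v` is adjacent to. -/
def Touches (G : SimpleGraph V) (T : Set V) (v x : V) : Prop :=
  x = v ∨ ∃ y ∈ T, G.Adj y v ∧ Reach G T x y

theorem Touches.reach_insert {T : Set V} {v x : V} (h : Touches G T v x) :
    Reach G (insert v T) x v := by
  rcases h with rfl | ⟨y, hy, e, hr⟩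
  · exact Reach.refl x
  · exact (hr.mono (Set.subset_insert v T)).trans
      (Reach.of_adj e (Set.mem_insert_of_mem _ hy) (Set.mem_insert _ _))

/-- The new vertex merges exactly the components adjacent to it and changes nothing else. The
renaming of components in the program rests on this. -/
theorem reach_insert_iff {T : Set V} {v a b : V} (hv : v ∉ T) :
    Reach G (insert v T) a b ↔ Reach G T a b ∨ (Touches G T v a ∧ Touches G T v b) := by
  constructor
  · intro h
    refine Reach.head_induction (P := fun a => Reach G T a b ∨ (Touches G T v a ∧ Touches G T v b))
      (Or.inl (Reach.refl b)) ?_ h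
    intro a c e ha hc _ ih
    by_cases hav : a = v
    · refine Or.inr ⟨Or.inl hav, ?_⟩
      subst hav
      rcases ih with h | h
      · exact Or.inr ⟨c, hc.resolve_left e.ne.symm, e.symm, h.symm⟩
      · exact h.2
    have haT := ha.resolve_left hav
    by_cases hcv : c = v
    · subst hcv
      refine Or.inr ⟨Or.inr ⟨a, haT, e, Reach.refl a⟩, ?_⟩
      rcases ih with h | h
      · by_cases hcb : c = b
        · exact Or.inl hcb.symm
        · exact absurd (h.mem_left hcb) hv
      · exact h.2
    have r := Reach.of_adj e haT (hc.resolve_left hcv)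
    rcases ih with h | ⟨h | ⟨x, hx, hxv, h⟩, hb⟩
    · exact Or.inl (r.trans h)
    · exact absurd h hcv
    · exact Or.inr ⟨Or.inr ⟨x, hx, hxv, r.trans h⟩, hb⟩
  · rintro (h | ⟨ha, hb⟩)
    · exact h.mono (Set.subset_insert v T)
    · exact ha.reach_insert.trans hb.reach_insert.symm

end

/-! ### Counting and cycle arguments in induced forests -/

section

variable {V : Type*} {G : SimpleGraph V}

/-- If every vertex of `Z` joins two vertices of `T` that are connected to terminals in `B`, and
`T ∪ Z` induces a forest, then `Z` has at most as many vertices as `B`. -/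
theorem card_le_of_connectors [DecidableEq V] {T : Set V} {B Z : Finset V} (hdisj : ∀ z ∈ Z, z ∉ T)
    (hac : Acyc G (T ∪ Z))
    (hZ : ∀ z ∈ Z, ∃ a ∈ T, ∃ b ∈ T, a ≠ b ∧ G.Adj z a ∧ G.Adj z b ∧
      (∃ β ∈ B, Reach G T a β) ∧ ∃ β ∈ B, Reach G T b β) : Z.card ≤ B.card := by
  -- `R` represents the components of `T ∪ Z` that meet `B`. By acyclicity each new `z` merges two
  -- different ones, so one representative can be dropped for each vertex of `Z`.
  suffices h : ∃ R : Finset V, Z.card + R.card ≤ B.card ∧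
      ∀ β ∈ B, ∃ ρ ∈ R, Reach G (T ∪ Z) β ρ by
    obtain ⟨R, hR, -⟩ := h
    omega
  induction Z using Finset.induction_on with
  | empty => exact ⟨B, by simp, fun β hβ => ⟨β, hβ, Reach.refl β⟩⟩
  | insert z Z hz ih =>
    have hsub : T ∪ (Z : Set V) ⊆ T ∪ ((insert z Z : Finset V) : Set V) := by
      intro x hx
      rcases hx with hx | hx
      · exact Or.inl hx
      · exact Or.inr (by simpa using Or.inr hx)
    have heq : T ∪ ((insert z Z : Finset V) : Set V) = insert z (T ∪ (Z : Set V)) := by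
      ext x
      simp only [Finset.coe_insert, Set.mem_union, Set.mem_insert_iff]
      tauto
    obtain ⟨R, hR, hrep⟩ := ih (fun x hx => hdisj x (Finset.mem_insert_of_mem hx))
      (hac.mono hsub) (fun x hx => hZ x (Finset.mem_insert_of_mem hx))
    obtain ⟨a, ha, b, hb, hab, hza, hzb, ⟨β, hβ, hra⟩, β', hβ', hrb⟩ :=
      hZ z (Finset.mem_insert_self z Z)
    obtain ⟨ρ, hρ, hr⟩ := hrep β hβ
    obtain ⟨ρ', hρ', hr'⟩ := hrep β' hβ'
    have hzT : z ∉ T ∪ (Z : Set V) := by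
      rintro (h | h)
      · exact hdisj z (Finset.mem_insert_self z Z) h
      · exact hz h
    have hT : T ⊆ T ∪ (Z : Set V) := Set.subset_union_left
    have hnot := Acyc.not_reach (heq ▸ hac) subset_rfl hzT (hT ha) (hT hb) hza hzb hab
    have hne : ρ ≠ ρ' := by
      rintro rfl
      exact hnot ((hra.mono hT).trans (hr.trans (hr'.symm.trans (hrb.mono hT).symm)))
    refine ⟨R.erase ρ', ?_, ?_⟩
    · rw [Finset.card_insert_of_notMem hz, Finset.card_erase_of_mem hρ']
      have := Finset.card_pos.2 ⟨ρ', hρ'⟩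
      omega
    · intro γ hγ
      obtain ⟨σ, hσ, hs⟩ := hrep γ hγ
      by_cases hσρ : σ = ρ'
      · refine ⟨ρ, Finset.mem_erase.2 ⟨hne, hρ⟩, ?_⟩
        subst hσρ
        have hzm : z ∈ T ∪ ((insert z Z : Finset V) : Set V) := Or.inr (by simp)
        have e1 := Reach.of_adj hzb hzm (hsub (hT hb))
        have e2 := Reach.of_adj hza hzm (hsub (hT ha))
        exact (hs.mono hsub).trans ((hr'.symm.mono hsub).trans
          (((hrb.mono hT).symm.mono hsub).trans (e1.symm.trans (e2.trans
            (((hra.mono hT).mono hsub).trans (hr.mono hsub))))))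
      · exact ⟨σ, Finset.mem_erase.2 ⟨hσρ, hσ⟩, hs.mono hsub⟩

/-- Inside an induced forest `T`, a set `Q` can be enlarged by at most `|Q|` vertices of `F` to a set
such that every other vertex of `T ∩ F` has at most one neighbour in it. -/
theorem exists_closure [DecidableEq V] {T F : Set V} (hT : Acyc G T) (Q₀ : Finset V)
    (hQ₀ : ∀ q ∈ Q₀, q ∈ T) :
    ∃ Q : Finset V, Q₀ ⊆ Q ∧ (∀ q ∈ Q, q ∈ T) ∧ (∀ q ∈ Q, q ∉ Q₀ → q ∈ F) ∧
      Q.card ≤ 2 * Q₀.card ∧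
      ∀ t ∈ T, t ∈ F → t ∉ Q → ∀ a ∈ Q, ∀ b ∈ Q, G.Adj t a → G.Adj t b → a = b := by
  -- Vertices with two neighbours in `Q` are added one at a time; `m` bounds the number of
  -- components of `G[Q]`. Since `T` is a forest, the two neighbours lie in different components, so
  -- every addition lowers this number. It starts at most at `|Q₀|`.
  suffices h : ∀ m : ℕ, ∀ Q : Finset V, (∀ q ∈ Q, q ∈ T) →
      (∃ R : Finset V, R.card ≤ m ∧ ∀ q ∈ Q, ∃ ρ ∈ R, Reach G (Q : Set V) q ρ) →
      ∃ Q' : Finset V, Q ⊆ Q' ∧ (∀ q ∈ Q', q ∈ T) ∧ (∀ q ∈ Q', q ∉ Q → q ∈ F) ∧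
        Q'.card ≤ Q.card + m ∧
        ∀ t ∈ T, t ∈ F → t ∉ Q' → ∀ a ∈ Q', ∀ b ∈ Q', G.Adj t a → G.Adj t b → a = b by
    obtain ⟨Q, h1, h2, h3, h4, h5⟩ :=
      h Q₀.card Q₀ hQ₀ ⟨Q₀, le_rfl, fun q hq => ⟨q, hq, Reach.refl q⟩⟩
    exact ⟨Q, h1, h2, h3, by omega, h5⟩
  intro m
  induction m with
  | zero =>
    rintro Q hQ ⟨R, hR, hrep⟩
    refine ⟨Q, subset_rfl, hQ, fun q h h' => absurd h h', by simp, ?_⟩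
    intro t _ _ _ a ha
    obtain ⟨ρ, hρ, -⟩ := hrep a ha
    have := Finset.card_pos.2 ⟨ρ, hρ⟩
    omega
  | succ m ih =>
    rintro Q hQ ⟨R, hR, hrep⟩
    by_cases hcl : ∀ t ∈ T, t ∈ F → t ∉ Q → ∀ a ∈ Q, ∀ b ∈ Q, G.Adj t a → G.Adj t b → a = b
    · exact ⟨Q, subset_rfl, hQ, fun q h h' => absurd h h', by omega, hcl⟩
    push Not at hcl
    obtain ⟨t, htT, htF, htQ, a, ha, b, hb, hta, htb, hab⟩ := hcl
    have hsub : (Q : Set V) ⊆ ((insert t Q : Finset V) : Set V) := by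
      intro x hx
      simpa using Or.inr hx
    have hQ' : ∀ q ∈ insert t Q, q ∈ T := by
      intro q hq
      rcases Finset.mem_insert.1 hq with rfl | hq
      · exact htT
      · exact hQ q hq
    have hnot := Acyc.not_reach hT (T := (Q : Set V)) (v := t)
      (fun x hx => hQ' x (by simpa using hx)) htQ ha hb hta htb hab
    obtain ⟨ρ, hρ, hr⟩ := hrep a ha
    obtain ⟨ρ', hρ', hr'⟩ := hrep b hb
    have hne : ρ ≠ ρ' := by
      rintro rfl
      exact hnot (hr.trans hr'.symm)
    have htm : t ∈ ((insert t Q : Finset V) : Set V) := by simp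
    have e1 := Reach.of_adj htb htm (hsub hb)
    have e2 := Reach.of_adj hta htm (hsub ha)
    have key : ∀ q ∈ insert t Q, ∃ ρ ∈ R.erase ρ', Reach G ((insert t Q : Finset V) : Set V) q ρ := by
      intro q hq
      rcases Finset.mem_insert.1 hq with rfl | hq
      · exact ⟨ρ, Finset.mem_erase.2 ⟨hne, hρ⟩, e2.trans (hr.mono hsub)⟩
      · obtain ⟨σ, hσ, hs⟩ := hrep q hq
        by_cases hσρ : σ = ρ'
        · subst hσρ
          exact ⟨ρ, Finset.mem_erase.2 ⟨hne, hρ⟩, (hs.mono hsub).trans ((hr'.symm.mono hsub).trans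
            (e1.symm.trans (e2.trans (hr.mono hsub))))⟩
        · exact ⟨σ, Finset.mem_erase.2 ⟨hσρ, hσ⟩, hs.mono hsub⟩
    have hcard : (R.erase ρ').card ≤ m := by
      rw [Finset.card_erase_of_mem hρ']
      omega
    obtain ⟨Q', h1, h2, h3, h4, h5⟩ := ih (insert t Q) hQ' ⟨R.erase ρ', hcard, key⟩
    refine ⟨Q', (Finset.subset_insert t Q).trans h1, h2, ?_, ?_, h5⟩
    · intro q hq hqQ
      by_cases hqt : q = t
      · exact hqt ▸ htF
      · exact h3 q hq (by simp [hqt, hqQ])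
    · rw [Finset.card_insert_of_notMem htQ] at h4
      omega

/-- From `a`, a walk inside `T ∩ F` leads to a neighbour of `s` (or `a` is `s` itself). -/
def Arm (G : SimpleGraph V) (U : Set V) (a s : V) : Prop :=
  a = s ∨ (a ∈ U ∧ ∃ y, Reach G U a y ∧ G.Adj y s)

/-- Follow the walk from `a` up to its first vertex outside `F`; if there is none, the whole walk
stays in `T ∩ F`. -/
theorem arm_or_reach {T F : Set V} {a b : V} (h : Reach G T a b) (hb : b ∈ T) :
    (∃ s ∈ T, s ∉ F ∧ Arm G (T ∩ F) a s) ∨ Reach G (T ∩ F) a b := by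
  suffices h' : (∃ s ∈ T, s ∉ F ∧ Arm G (T ∩ F) a s) ∨ (a ∈ F ∧ Reach G (T ∩ F) a b) by
    exact h'.imp id And.right
  refine Reach.head_induction (P := fun a =>
    (∃ s ∈ T, s ∉ F ∧ Arm G (T ∩ F) a s) ∨ (a ∈ F ∧ Reach G (T ∩ F) a b)) ?_ ?_ h
  · by_cases hbF : b ∈ F
    · exact Or.inr ⟨hbF, Reach.refl b⟩
    · exact Or.inl ⟨b, hb, hbF, Or.inl rfl⟩
  · intro a c e ha hc _ ih
    by_cases haF : a ∈ F
    · by_cases hcF : c ∈ F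
      · have r := Reach.of_adj (T := T ∩ F) e ⟨ha, haF⟩ ⟨hc, hcF⟩
        rcases ih with ⟨s, hs, hsF, h | ⟨_, y, hy, hys⟩⟩ | ⟨_, h⟩
        · exact absurd hcF (h ▸ hsF)
        · exact Or.inl ⟨s, hs, hsF, Or.inr ⟨⟨ha, haF⟩, y, r.trans hy, hys⟩⟩
        · exact Or.inr ⟨haF, r.trans h⟩
      · exact Or.inl ⟨c, hc, hcF, Or.inr ⟨⟨ha, haF⟩, a, Reach.refl a, e⟩⟩
    · exact Or.inl ⟨a, ha, haF, Or.inl rfl⟩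

/-- A vertex of the forest `F` that closes a cycle with the forest `T` has two arms ending outside
`F`. -/
theorem exists_arms {T F : Set V} (hT : Acyc G T) (hF : Acyc G F) {x : V} (hxF : x ∈ F)
    (hxT : x ∉ T) (hx : ¬ Acyc G (insert x T)) :
    ∃ a ∈ T, ∃ b ∈ T, a ≠ b ∧ G.Adj x a ∧ G.Adj x b ∧
      (∃ s ∈ T, s ∉ F ∧ Arm G (T ∩ F) a s) ∧ ∃ s ∈ T, s ∉ F ∧ Arm G (T ∩ F) b s := by
  rw [acyc_insert hxT] at hx
  push Not at hx
  obtain ⟨a, ha, b, hb, hxa, hxb, hab, hr⟩ := hx hT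
  -- A connection inside `F` would close a cycle through `x` in the forest `F`.
  have hno : ¬ Reach G (T ∩ F) a b := by
    intro h
    refine hF.not_reach (T := T ∩ F) (v := x) ?_ (fun h => hxT h.1) (h.mem_left hab)
      (h.symm.mem_left hab.symm) hxa hxb hab h
    intro y hy
    rcases hy with rfl | hy
    · exact hxF
    · exact hy.2
  exact ⟨a, ha, b, hb, hab, hxa, hxb, (arm_or_reach hr hb).resolve_right hno,
    (arm_or_reach hr.symm ha).resolve_right fun h => hno h.symm⟩

/-- An arm ending in `Q` passes through `Q` or reaches a neighbour of `Q` before meeting `Q`. -/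
theorem Arm.truncate {U : Set V} {Q : Set V} {a s : V} (h : Arm G U a s) (hs : s ∈ Q) :
    a ∈ Q ∨ (a ∈ U \ Q ∧ ∃ τ ∈ U \ Q, Reach G (U \ Q) a τ ∧ ∃ q ∈ Q, G.Adj τ q) := by
  rcases h with rfl | ⟨haU, y, hr, hys⟩
  · exact Or.inl hs
  · have hyU : y ∈ U := hr.symm.mem_of_mem haU
    refine Reach.head_induction (P := fun a => a ∈ Q ∨
      (a ∈ U \ Q ∧ ∃ τ ∈ U \ Q, Reach G (U \ Q) a τ ∧ ∃ q ∈ Q, G.Adj τ q)) ?_ ?_ hr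
    · by_cases hyQ : y ∈ Q
      · exact Or.inl hyQ
      · exact Or.inr ⟨⟨hyU, hyQ⟩, y, ⟨hyU, hyQ⟩, Reach.refl y, s, hs, hys⟩
    · intro a c e ha hc _ ih
      by_cases haQ : a ∈ Q
      · exact Or.inl haQ
      refine Or.inr ⟨⟨ha, haQ⟩, ?_⟩
      rcases ih with h | ⟨hcU, τ, hτ, h, hq⟩
      · exact ⟨a, ⟨ha, haQ⟩, Reach.refl a, c, h, e⟩
      · exact ⟨τ, hτ, (Reach.of_adj (T := U \ Q) e ⟨ha, haQ⟩ hcU).trans h, hq⟩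

/-- The union of two induced forests is one if no component of the second has two edges to the
first. -/
theorem acyc_union [DecidableEq V] {A : Set V} (hA : Acyc G A) (B : Finset V) (hB : Acyc G (B : Set V))
    (hAB : ∀ b ∈ B, b ∉ A)
    (h1 : ∀ b ∈ B, ∀ b' ∈ B, Reach G (B : Set V) b b' → ∀ a ∈ A, ∀ a' ∈ A, G.Adj b a →
      G.Adj b' a' → b = b' ∧ a = a') : Acyc G (A ∪ B) := by
  induction B using Finset.induction_on with
  | empty => simpa using hA
  | insert v B hv ih =>
    have hsub : (B : Set V) ⊆ ((insert v B : Finset V) : Set V) := by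
      intro x hx
      simpa using Or.inr hx
    have heq : A ∪ ((insert v B : Finset V) : Set V) = insert v (A ∪ (B : Set V)) := by
      ext x
      simp only [Finset.coe_insert, Set.mem_union, Set.mem_insert_iff]
      tauto
    have hins : insert v (B : Set V) = ((insert v B : Finset V) : Set V) := by simp
    have hvm : v ∈ ((insert v B : Finset V) : Set V) := by simp
    have ih' := ih (hB.mono hsub) (fun b hb => hAB b (Finset.mem_insert_of_mem hb))
      (fun b hb b' hb' hr => h1 b (Finset.mem_insert_of_mem hb) b' (Finset.mem_insert_of_mem hb')
        (hr.mono hsub))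
    have hvAB : v ∉ A ∪ (B : Set V) := by
      rintro (h | h)
      · exact hAB v (Finset.mem_insert_self v B) h
      · exact hv h
    rw [heq, acyc_insert hvAB]
    refine ⟨ih', ?_⟩
    -- a neighbour of `v` in `B` whose component sends no edge to `A` is not reachable from others
    have key : ∀ x ∈ A ∪ (B : Set V), ∀ y ∈ B, G.Adj v x → G.Adj v y → x ≠ y →
        (∀ z, Reach G (B : Set V) y z → z ∈ B → ∀ a ∈ A, ¬ G.Adj z a) →
        ¬ Reach G (A ∪ (B : Set V)) y x := by
      intro x hx y hy hvx hvy hxy hcl hr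
      have hmem : x ∈ {z | z ∈ B ∧ Reach G (B : Set V) y z} := by
        refine hr.mem_closed ?_ ⟨hy, Reach.refl y⟩
        rintro u w e ⟨huB, hu⟩ _ hw
        rcases hw with hw | hw
        · exact absurd e (hcl u hu huB w hw)
        · exact ⟨hw, hu.trans (Reach.of_adj e huB hw)⟩
      exact hB.not_reach (T := (B : Set V)) hins.subset hv hy hmem.1 hvy hvx hxy.symm hmem.2
    have tov : ∀ y ∈ B, G.Adj v y → ∀ z, Reach G (B : Set V) y z →
        Reach G ((insert v B : Finset V) : Set V) z v := by
      intro y hy hvy z hz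
      exact (hz.symm.mono hsub).trans (Reach.of_adj hvy.symm (hsub hy) hvm)
    -- The component of `v` in `insert v B` sends at most one edge to `A`. So of two neighbours of
    -- `v`, at least one lies in `B` in a component of `B` without edges to `A`, and `key` applies
    -- to it, unless `h1` or the acyclicity of `B` is contradicted directly.
    intro x hx y hy hvx hvy hxy hr
    rcases hy with hyA | hyB
    · rcases hx with hxA | hxB
      · exact hxy (h1 v (Finset.mem_insert_self v B) v (Finset.mem_insert_self v B)
          (Reach.refl v) x hxA y hyA hvx hvy).2
      · refine key y (Or.inl hyA) x hxB hvy hvx hxy.symm ?_ hr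
        intro z hz hzB a ha e
        have := (h1 z (Finset.mem_insert_of_mem hzB) v (Finset.mem_insert_self v B)
          (tov x hxB hvx z hz) a ha y hyA e hvy).1
        exact hv (this ▸ hzB)
    · by_cases hcl : ∀ z, Reach G (B : Set V) y z → z ∈ B → ∀ a ∈ A, ¬ G.Adj z a
      · exact key x hx y hyB hvx hvy hxy hcl hr.symm
      push Not at hcl
      obtain ⟨z, hz, hzB, a, ha, hza⟩ := hcl
      rcases hx with hxA | hxB
      · have := (h1 z (Finset.mem_insert_of_mem hzB) v (Finset.mem_insert_self v B)
          (tov y hyB hvy z hz) a ha x hxA hza hvx).1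
        exact hv (this ▸ hzB)
      · refine key y (Or.inr hyB) x hxB hvy hvx hxy.symm ?_ hr
        intro w hw hwB a' ha' hwa'
        have := (h1 z (Finset.mem_insert_of_mem hzB) w (Finset.mem_insert_of_mem hwB)
          ((tov y hyB hvy z hz).trans (tov x hxB hvx w hw).symm) a ha a' ha' hza hwa').1
        subst this
        exact hB.not_reach (T := (B : Set V)) hins.subset hv hxB hyB hvx hvy hxy (hw.trans hz.symm)

end

/-! ### Two-colourings of a forest grown from tokens -/

section

variable {V : Type*} {G : SimpleGraph V}

/-- Partial colourings of the forest `F` with colours `1` and `2` (`0` means uncoloured), grown from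
token roots: a new component is started only when no edge of `F` leaves the coloured part, and a
vertex coloured from a neighbour gets the same colour, or the other one if it is a token. -/
inductive Coloring [DecidableEq V] (G : SimpleGraph V) (F : Set V) (tok : V → Prop) :
    (V → ℕ) → Set V → Prop
  | zero : Coloring G F tok (fun _ => 0) ∅
  | root {col : V → ℕ} {R : Set V} {t : V} (h : Coloring G F tok col R)
      (hcl : ∀ u v, G.Adj u v → col u ≠ 0 → v ∈ F → col v ≠ 0) (htF : t ∈ F) (ht : tok t)
      (h0 : col t = 0) : Coloring G F tok (Function.update col t 1) (insert t R)
  | grow_token {col : V → ℕ} {R : Set V} {u v : V} (h : Coloring G F tok col R) (hu : col u ≠ 0)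
      (e : G.Adj u v) (hvF : v ∈ F) (h0 : col v = 0) (hv : tok v) :
      Coloring G F tok (Function.update col v (3 - col u)) R
  | grow {col : V → ℕ} {R : Set V} {u v : V} (h : Coloring G F tok col R) (hu : col u ≠ 0)
      (e : G.Adj u v) (hvF : v ∈ F) (h0 : col v = 0) (hv : ¬ tok v) :
      Coloring G F tok (Function.update col v (col u)) R

/-- The properties of partial colourings that are preserved when they grow; `own v` is the token
from which `v` got its colour. -/
structure ColoringInv (G : SimpleGraph V) (F : Set V) (tok : V → Prop) (col : V → ℕ) (R : Set V)
    (own : V → V) : Prop where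
  le_two : ∀ v, col v ≤ 2
  mem : ∀ v, col v ≠ 0 → v ∈ F
  root_col : ∀ r ∈ R, col r ≠ 0
  own_tok : ∀ v, col v ≠ 0 → tok (own v)
  own_col : ∀ v, col v ≠ 0 → col (own v) = col v
  own_reach : ∀ v, col v ≠ 0 → Reach G {w | col w = col v} v (own v)
  own_self : ∀ v, col v ≠ 0 → tok v → own v = v
  own_adj : ∀ u v, col u ≠ 0 → G.Adj u v → col u = col v → own u = own v
  parent : ∀ v, col v ≠ 0 → tok v → v ∉ R → ∃ u, G.Adj v u ∧ col u = 3 - col v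
  connected : ∀ u w, col u ≠ 0 → col w ≠ 0 → Reach G F u w → Reach G {v | col v ≠ 0} u w
  root_unique : ∀ r ∈ R, ∀ r' ∈ R, Reach G F r r' → r = r'

theorem reach_class_update [DecidableEq V] {col : V → ℕ} {t : V} {c d : ℕ} (h0 : col t = 0)
    (hd : d ≠ 0) {a b : V}
    (h : Reach G {w | col w = d} a b) : Reach G {w | Function.update col t c w = d} a b := by
  refine h.mono ?_
  intro w hw
  have : w ≠ t := by
    rintro rfl
    exact hd (hw.symm.trans h0)
  simpa [Function.update_of_ne this] using hw

/-- The coloured part of a component of the forest is connected, so the new vertex has only one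
coloured neighbour `u`. Hence a non-token joins just the monochromatic component of `u`, and a
token, which gets the other colour, starts one of its own. -/
theorem ColoringInv.extend [DecidableEq V] {F : Set V} {tok : V → Prop} {col : V → ℕ} {R : Set V}
    {own : V → V} (hF : Acyc G F) (h : ColoringInv G F tok col R own) {u v : V} {c : ℕ}
    (hu : col u ≠ 0) (e : G.Adj u v) (hvF : v ∈ F) (h0 : col v = 0)
    (hc : (tok v ∧ c = 3 - col u) ∨ (¬ tok v ∧ c = col u)) :
    ∃ own', ColoringInv G F tok (Function.update col v c) R own' := by
  have hu2 := h.le_two u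
  have huv : u ≠ v := e.ne
  have hc0 : c ≠ 0 := by omega
  have hne : ∀ {w : V}, col w ≠ 0 → w ≠ v := fun hw hwv => hw (hwv ▸ h0)
  have huniq : ∀ w, col w ≠ 0 → G.Adj v w → w = u := by
    intro w hw evw
    by_contra hwu
    have r : Reach G F w u := (Reach.of_adj evw.symm (h.mem w hw) hvF).trans
      (Reach.of_adj e.symm hvF (h.mem u hu))
    refine hF.not_reach (T := {w | col w ≠ 0}) ?_ (by simpa using h0) hw hu evw e.symm hwu
      (h.connected w u hw hu r)
    intro x hx
    rcases hx with rfl | hx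
    · exact hvF
    · exact h.mem x hx
  have hmono : {w | col w ≠ 0} ⊆ {w | Function.update col v c w ≠ 0} := by
    intro w hw
    have : w ≠ v := hne hw
    simpa [Function.update_of_ne this] using hw
  have r1 : Reach G {w | Function.update col v c w ≠ 0} v u :=
    Reach.of_adj e.symm (by simpa using hc0) (hmono hu)
  have hconn : ∀ w, col w ≠ 0 → Reach G F v w →
      Reach G {w | Function.update col v c w ≠ 0} v w := by
    intro w hw r
    exact r1.trans ((h.connected u w hu hw
      ((Reach.of_adj e (h.mem u hu) hvF).trans r)).mono hmono)
  -- The condition `c = col u` says that `v` is not a token: it inherits the owner of `u`, while a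
  -- token owns itself.
  refine ⟨Function.update own v (if c = col u then own u else v), ?_, ?_, ?_, ?_, ?_, ?_, ?_, ?_,
    ?_, ?_, ?_⟩
  · intro w
    by_cases hw : w = v
    · subst hw
      simp only [Function.update_self]
      omega
    · simpa [Function.update_of_ne hw] using h.le_two w
  · intro w hw
    by_cases hwv : w = v
    · exact hwv ▸ hvF
    · exact h.mem w (by simpa [Function.update_of_ne hwv] using hw)
  · intro r hr
    have := h.root_col r hr
    simpa [Function.update_of_ne (hne this)] using this
  · intro w hw
    by_cases hwv : w = v
    · subst hwv
      simp only [Function.update_self]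
      split_ifs with hcu
      · exact h.own_tok u hu
      · exact (hc.resolve_right fun h => hcu h.2).1
    · simp only [Function.update_of_ne hwv] at hw ⊢
      exact h.own_tok w hw
  · intro w hw
    by_cases hwv : w = v
    · subst hwv
      simp only [Function.update_self]
      split_ifs with hcu
      · have := h.own_col u hu
        rw [Function.update_of_ne (hne (this ▸ hu)), this, hcu]
      · simp
    · simp only [Function.update_of_ne hwv] at hw ⊢
      have := h.own_col w hw
      rw [Function.update_of_ne (hne (this ▸ hw)), this]
  · intro w hw
    by_cases hwv : w = v
    · subst hwv
      simp only [Function.update_self]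
      split_ifs with hcu
      · refine Reach.trans (b := u) (Reach.of_adj e.symm (by simp) ?_) ?_
        · simp [Function.update_of_ne huv, hcu]
        · have := reach_class_update (c := c) h0 hu (h.own_reach u hu)
          rw [← hcu] at this
          exact this
      · exact Reach.refl w
    · simp only [Function.update_of_ne hwv] at hw ⊢
      exact reach_class_update h0 hw (h.own_reach w hw)
  · intro w hw htw
    by_cases hwv : w = v
    · subst hwv
      have : c ≠ col u := by
        rcases hc with ⟨-, hc⟩ | ⟨hn, -⟩
        · omega
        · exact absurd htw hn
      simp [this]
    · simp only [Function.update_of_ne hwv] at hw ⊢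
      exact h.own_self w hw htw
  · have main : ∀ x, x ≠ v → G.Adj v x → Function.update col v c v = Function.update col v c x →
        Function.update own v (if c = col u then own u else v) v =
        Function.update own v (if c = col u then own u else v) x := by
      intro x hxv ex hcx
      simp only [Function.update_self, Function.update_of_ne hxv] at hcx ⊢
      have := huniq x (hcx ▸ hc0) ex
      subst this
      simp [hcx]
    intro x y hx exy hxy
    by_cases hxv : x = v
    · subst hxv
      exact main y exy.ne.symm exy hxy
    · by_cases hyv : y = v
      · subst hyv
        exact (main x hxv exy.symm hxy.symm).symm
      · simp only [Function.update_of_ne hxv, Function.update_of_ne hyv] at hx hxy ⊢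
        exact h.own_adj x y hx exy hxy
  · intro w hw htw hwR
    by_cases hwv : w = v
    · subst hwv
      refine ⟨u, e.symm, ?_⟩
      rcases hc with ⟨-, hc⟩ | ⟨hn, -⟩
      · simp only [Function.update_self, Function.update_of_ne huv]
        omega
      · exact absurd htw hn
    · simp only [Function.update_of_ne hwv] at hw ⊢
      obtain ⟨x, ex, hx⟩ := h.parent w hw htw hwR
      have := h.le_two w
      have hxv : x ≠ v := hne (by omega)
      exact ⟨x, ex, by simpa [Function.update_of_ne hxv] using hx⟩
  · intro x y hx hy r
    by_cases hxv : x = v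
    · subst hxv
      by_cases hyv : y = x
      · exact hyv ▸ Reach.refl _
      · exact hconn y (by simpa [Function.update_of_ne hyv] using hy) r
    · by_cases hyv : y = v
      · subst hyv
        exact (hconn x (by simpa [Function.update_of_ne hxv] using hx) r.symm).symm
      · simp only [Function.update_of_ne hxv, Function.update_of_ne hyv] at hx hy
        exact (h.connected x y hx hy r).mono hmono
  · exact h.root_unique

/-- As no edge leaves the coloured part, the new root lies in a component that is still uncoloured.
This is why a component has only one root. -/
theorem ColoringInv.add_root [DecidableEq V] {F : Set V} {tok : V → Prop} {col : V → ℕ} {R : Set V}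
    {own : V → V} (h : ColoringInv G F tok col R own) {t : V}
    (hcl : ∀ u v, G.Adj u v → col u ≠ 0 → v ∈ F → col v ≠ 0) (htF : t ∈ F) (ht : tok t)
    (h0 : col t = 0) :
    ColoringInv G F tok (Function.update col t 1) (insert t R) (Function.update own t t) := by
  have hne : ∀ {w : V}, col w ≠ 0 → w ≠ t := fun hw hwv => hw (hwv ▸ h0)
  have hno : ∀ w, col w ≠ 0 → ¬ Reach G F w t := by
    intro w hw r
    have : t ∈ {v | col v ≠ 0} := r.mem_closed (fun u v e hu _ hv => hcl u v e hu hv) hw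
    exact this h0
  have hnadj : ∀ w, col w ≠ 0 → ¬ G.Adj w t := fun w hw e => hcl w t e hw htF h0
  refine ⟨?_, ?_, ?_, ?_, ?_, ?_, ?_, ?_, ?_, ?_, ?_⟩
  · intro w
    by_cases hw : w = t
    · simp [hw]
    · simpa [Function.update_of_ne hw] using h.le_two w
  · intro w hw
    by_cases hwv : w = t
    · exact hwv ▸ htF
    · exact h.mem w (by simpa [Function.update_of_ne hwv] using hw)
  · rintro r (rfl | hr)
    · simp
    · have := h.root_col r hr
      simpa [Function.update_of_ne (hne this)] using this
  · intro w hw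
    by_cases hwv : w = t
    · simpa [hwv] using ht
    · simp only [Function.update_of_ne hwv] at hw ⊢
      exact h.own_tok w hw
  · intro w hw
    by_cases hwv : w = t
    · simp [hwv]
    · simp only [Function.update_of_ne hwv] at hw ⊢
      have := h.own_col w hw
      rw [Function.update_of_ne (hne (this ▸ hw)), this]
  · intro w hw
    by_cases hwv : w = t
    · subst hwv
      simpa using Reach.refl w
    · simp only [Function.update_of_ne hwv] at hw ⊢
      exact reach_class_update h0 hw (h.own_reach w hw)
  · intro w hw htw
    by_cases hwv : w = t
    · simp [hwv]
    · simp only [Function.update_of_ne hwv] at hw ⊢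
      exact h.own_self w hw htw
  · intro x y hx exy hxy
    by_cases hxv : x = t
    · subst hxv
      rw [Function.update_self, Function.update_of_ne exy.ne.symm] at hxy
      exact absurd exy.symm (hnadj y (by omega))
    · by_cases hyv : y = t
      · subst hyv
        rw [Function.update_of_ne hxv] at hx
        exact absurd exy (hnadj x hx)
      · simp only [Function.update_of_ne hxv, Function.update_of_ne hyv] at hx hxy ⊢
        exact h.own_adj x y hx exy hxy
  · intro w hw htw hwR
    simp only [Set.mem_insert_iff, not_or] at hwR
    simp only [Function.update_of_ne hwR.1] at hw ⊢
    obtain ⟨x, ex, hx⟩ := h.parent w hw htw hwR.2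
    have := h.le_two w
    have hxv : x ≠ t := hne (by omega)
    exact ⟨x, ex, by simpa [Function.update_of_ne hxv] using hx⟩
  · intro x y hx hy r
    by_cases hxv : x = t
    · subst hxv
      by_cases hyv : y = x
      · exact hyv ▸ Reach.refl _
      · exact absurd r.symm (hno y (by simpa [Function.update_of_ne hyv] using hy))
    · by_cases hyv : y = t
      · subst hyv
        exact absurd r (hno x (by simpa [Function.update_of_ne hxv] using hx))
      · simp only [Function.update_of_ne hxv, Function.update_of_ne hyv] at hx hy
        refine (h.connected x y hx hy r).mono ?_
        intro w hw
        have : w ≠ t := hne hw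
        simpa [Function.update_of_ne this] using hw
  · rintro r (rfl | hr) r' (rfl | hr') hrr
    · rfl
    · exact absurd hrr.symm (hno r' (h.root_col r' hr'))
    · exact absurd hrr (hno r (h.root_col r hr))
    · exact h.root_unique r hr r' hr' hrr

theorem Coloring.inv [DecidableEq V] {F : Set V} {tok : V → Prop} (hF : Acyc G F) {col : V → ℕ}
    {R : Set V} (h : Coloring G F tok col R) : ∃ own, ColoringInv G F tok col R own := by
  induction h with
  | zero => exact ⟨id, by constructor <;> simp⟩
  | root _ hcl htF ht h0 ih =>
    obtain ⟨own, ih⟩ := ih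
    exact ⟨_, ih.add_root hcl htF ht h0⟩
  | grow_token _ hu e hvF h0 hv ih =>
    obtain ⟨own, ih⟩ := ih
    exact ih.extend hF hu e hvF h0 (Or.inl ⟨hv, rfl⟩)
  | grow _ hu e hvF h0 hv ih =>
    obtain ⟨own, ih⟩ := ih
    exact ih.extend hF hu e hvF h0 (Or.inr ⟨hv, rfl⟩)

theorem ColoringInv.own_eq_of_reach {F : Set V} {tok : V → Prop} {col : V → ℕ} {R : Set V}
    {own : V → V} (h : ColoringInv G F tok col R own) {c : ℕ} (hc : c ≠ 0) {a b : V}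
    (hr : Reach G {w | col w = c} a b) : own a = own b := by
  refine Reach.head_induction (P := fun a => own a = own b) rfl ?_ hr
  intro x y e hx hy _ ih
  rw [← ih]
  exact h.own_adj x y (by rw [hx]; exact hc) e (by rw [hx, hy])

end

/-! ### Heavy vertices, light vertices and the approximation guarantee -/

section

variable {V : Type*} {G : SimpleGraph V}

open Classical in
/-- The number of neighbours of `v` in `Q`. -/
noncomputable def wt (G : SimpleGraph V) (Q : Finset V) (v : V) : ℕ := (Q.filter (G.Adj v)).card

theorem wt_ne_zero {Q : Finset V} {v : V} : wt G Q v ≠ 0 ↔ ∃ q ∈ Q, G.Adj v q := by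
  classical
  simp [wt, Finset.filter_eq_empty_iff]

theorem wt_le_one {Q : Finset V} {v : V} :
    wt G Q v ≤ 1 ↔ ∀ a ∈ Q, ∀ b ∈ Q, G.Adj v a → G.Adj v b → a = b := by
  classical
  rw [wt, Finset.card_le_one]
  simp only [Finset.mem_filter]
  exact ⟨fun h a ha b hb hva hvb => h a ⟨ha, hva⟩ b ⟨hb, hvb⟩,
    fun h a ha b hb => h a ha.1 b hb.1 ha.2 hb.2⟩

theorem two_le_wt {Q : Finset V} {v : V} (h : 2 ≤ wt G Q v) :
    ∃ a ∈ Q, ∃ b ∈ Q, a ≠ b ∧ G.Adj v a ∧ G.Adj v b := by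
  by_contra! hn
  have : wt G Q v ≤ 1 := wt_le_one.2 fun a ha b hb hva hvb => by
    by_contra hab
    exact hn a ha b hb hab hva hvb
  omega

variable [DecidableEq V]

open Classical in
/-- The vertices of `F` outside `Q` with at most one neighbour in `Q`. -/
noncomputable def lightPart (G : SimpleGraph V) (F Q : Finset V) : Finset V :=
  F.filter fun v => v ∉ Q ∧ wt G Q v ≤ 1

open Classical in
/-- The vertices of `F` outside `Q` with at least two neighbours in `Q`. -/
noncomputable def heavyPart (G : SimpleGraph V) (F Q : Finset V) : Finset V :=
  F.filter fun v => v ∉ Q ∧ 2 ≤ wt G Q v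

open Classical in
/-- The vertices with a neighbour in `Q` that can be reached from another such vertex inside the
light part. -/
noncomputable def pairedTokens (G : SimpleGraph V) (F Q : Finset V) : Finset V :=
  (lightPart G F Q).filter fun v => wt G Q v ≠ 0 ∧
    ∃ τ ∈ lightPart G F Q, wt G Q τ ≠ 0 ∧ τ ≠ v ∧ Reach G (lightPart G F Q : Set V) v τ

theorem mem_lightPart {F Q : Finset V} {v : V} :
    v ∈ lightPart G F Q ↔ v ∈ F ∧ v ∉ Q ∧ wt G Q v ≤ 1 := by
  simp [lightPart]

theorem mem_heavyPart {F Q : Finset V} {v : V} :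
    v ∈ heavyPart G F Q ↔ v ∈ F ∧ v ∉ Q ∧ 2 ≤ wt G Q v := by
  simp [heavyPart]

theorem mem_pairedTokens {F Q : Finset V} {v : V} :
    v ∈ pairedTokens G F Q ↔ v ∈ lightPart G F Q ∧ wt G Q v ≠ 0 ∧
      ∃ τ ∈ lightPart G F Q, wt G Q τ ≠ 0 ∧ τ ≠ v ∧ Reach G (lightPart G F Q : Set V) v τ := by
  simp [pairedTokens]

/-- The number of vertices of `F` that close a cycle with `T` through arms ending in `Q ⊆ T`. -/
theorem card_armed_le {T : Set V} {F Q X : Finset V} (hF : Acyc G (F : Set V))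
    (hQT : ∀ q ∈ Q, q ∈ T)
    (hcl : ∀ t ∈ T, t ∈ F → t ∉ Q → ∀ a ∈ Q, ∀ b ∈ Q, G.Adj t a → G.Adj t b → a = b)
    (hX : ∀ x ∈ X, x ∈ F ∧ x ∉ T ∧ ∃ a ∈ T, ∃ b ∈ T, a ≠ b ∧ G.Adj x a ∧ G.Adj x b ∧
      (∃ s ∈ Q, Arm G (T ∩ (F : Set V)) a s) ∧ ∃ s ∈ Q, Arm G (T ∩ (F : Set V)) b s) :
    X.card ≤ (heavyPart G F Q).card + (pairedTokens G F Q).card := by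
  classical
  set L := lightPart G F Q with hL
  set U : Set V := (T ∩ (F : Set V)) \ (Q : Set V) with hU
  -- This is where the closure of `Q` is used: vertices of `T ∩ F` outside `Q` are light.
  have hUL : ∀ u ∈ U, u ∈ L := fun u hu =>
    mem_lightPart.2 ⟨hu.1.2, hu.2, wt_le_one.2 (hcl u hu.1.1 hu.1.2 hu.2)⟩
  have hLF : Acyc G (L : Set V) := hF.mono fun v hv => (mem_lightPart.1 hv).1
  have harm : ∀ a s, s ∈ Q → Arm G (T ∩ (F : Set V)) a s → a ∈ Q ∨
      (a ∈ U ∧ ∃ τ ∈ U, Reach G U a τ ∧ wt G Q τ ≠ 0) := by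
    intro a s hs h
    refine (h.truncate (Q := (Q : Set V)) hs).imp id ?_
    rintro ⟨ha, τ, hτ, hr, hq⟩
    exact ⟨ha, τ, hτ, hr, wt_ne_zero.2 hq⟩
  have hreachL : ∀ {x a τ}, x ∈ L → a ∈ U → G.Adj x a → Reach G U a τ →
      Reach G (L : Set V) x τ := fun hx ha e hr =>
    (Reach.of_adj e hx (hUL _ ha)).trans (hr.mono hUL)
  -- tokens in `X`
  have hXt : X.filter (fun x => x ∈ L ∧ wt G Q x ≠ 0) ⊆
      (pairedTokens G F Q).filter fun v => v ∉ U := by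
    intro x hx
    simp only [Finset.mem_filter] at hx ⊢
    obtain ⟨hxX, hxL, hxw⟩ := hx
    obtain ⟨hxF, hxT, a, ha, b, hb, hab, hxa, hxb, ⟨s, hs, hA⟩, s', hs', hA'⟩ := hX x hxX
    refine ⟨mem_pairedTokens.2 ⟨hxL, hxw, ?_⟩, fun h => hxT h.1.1⟩
    -- Having one neighbour in `Q`, the token `x` can have only one arm that enters `Q` at once. The
    -- other arm runs to a token in `U`, which differs from `x` because `x` is not in `T`.
    have hone : ∃ y ∈ U, G.Adj x y ∧ ∃ τ ∈ U, Reach G U y τ ∧ wt G Q τ ≠ 0 := by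
      rcases harm a s hs hA with h1 | h1
      · rcases harm b s' hs' hA' with h2 | h2
        · exact absurd (wt_le_one.1 (mem_lightPart.1 hxL).2.2 a h1 b h2 hxa hxb) hab
        · exact ⟨b, h2.1, hxb, h2.2⟩
      · exact ⟨a, h1.1, hxa, h1.2⟩
    obtain ⟨y, hy, hxy, τ, hτ, hr, hw⟩ := hone
    exact ⟨τ, hUL τ hτ, hw, fun h => hxT (h ▸ hτ.1.1), hreachL hxL hy hxy hr⟩
  -- other vertices of `X` in the light part
  have hXn : (X.filter fun x => x ∈ L ∧ wt G Q x = 0).card ≤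
      ((pairedTokens G F Q).filter fun v => v ∈ U).card := by
    refine card_le_of_connectors (G := G) (T := U) ?_ ?_ ?_
    · intro z hz
      simp only [Finset.mem_filter] at hz
      exact fun h => (hX z hz.1).2.1 h.1.1
    · refine hLF.mono ?_
      rintro x (hx | hx)
      · exact hUL x hx
      · simp only [Finset.coe_filter, Set.mem_ofPred_eq] at hx
        exact hx.2.1
    · intro z hz
      simp only [Finset.mem_filter] at hz
      obtain ⟨hzX, hzL, hzw⟩ := hz
      obtain ⟨hzF, hzT, a, ha, b, hb, hab, hza, hzb, ⟨s, hs, hA⟩, s', hs', hA'⟩ := hX z hzX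
      have hnQ : ∀ y, G.Adj z y → y ∉ Q := fun y e hy => wt_ne_zero.2 ⟨y, hy, e⟩ hzw
      obtain ⟨haU, τ, hτ, hr, hw⟩ := (harm a s hs hA).resolve_left (hnQ a hza)
      obtain ⟨hbU, τ', hτ', hr', hw'⟩ := (harm b s' hs' hA').resolve_left (hnQ b hzb)
      -- The arms end at different tokens, as otherwise they would close a cycle in the light part.
      -- Joined through `z`, these tokens are paired; they serve as the terminals for
      -- `card_le_of_connectors`.
      have hne : τ ≠ τ' := by
        rintro rfl
        refine hLF.not_reach (T := U) (v := z) ?_ (fun h => hzT h.1.1) haU hbU hza hzb hab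
          (hr.trans hr'.symm)
        intro y hy
        rcases hy with rfl | hy
        · exact hzL
        · exact hUL y hy
      have r1 := hreachL hzL haU hza hr
      have r2 := hreachL hzL hbU hzb hr'
      refine ⟨a, haU, b, hbU, hab, hza, hzb, ⟨τ, ?_, hr⟩, τ', ?_, hr'⟩
      · exact Finset.mem_filter.2 ⟨mem_pairedTokens.2 ⟨hUL τ hτ, hw, τ', hUL τ' hτ', hw', hne.symm,
          r1.symm.trans r2⟩, hτ⟩
      · exact Finset.mem_filter.2 ⟨mem_pairedTokens.2 ⟨hUL τ' hτ', hw', τ, hUL τ hτ, hw, hne,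
          r2.symm.trans r1⟩, hτ'⟩
  have hcover : X ⊆ heavyPart G F Q ∪ (X.filter (fun x => x ∈ L ∧ wt G Q x ≠ 0) ∪
      X.filter fun x => x ∈ L ∧ wt G Q x = 0) := by
    intro x hx
    obtain ⟨hxF, hxT, -⟩ := hX x hx
    have hxQ : x ∉ Q := fun h => hxT (hQT x h)
    simp only [Finset.mem_union, Finset.mem_filter, mem_heavyPart, hL, mem_lightPart]
    by_cases h2 : 2 ≤ wt G Q x
    · exact Or.inl ⟨hxF, hxQ, h2⟩
    · have : wt G Q x ≤ 1 := by omega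
      by_cases h0 : wt G Q x = 0
      · exact Or.inr (Or.inr ⟨hx, ⟨hxF, hxQ, this⟩, h0⟩)
      · exact Or.inr (Or.inl ⟨hx, ⟨hxF, hxQ, this⟩, h0⟩)
  have h1 := Finset.card_le_card hcover
  have h2 := Finset.card_union_le (heavyPart G F Q)
    (X.filter (fun x => x ∈ L ∧ wt G Q x ≠ 0) ∪ X.filter fun x => x ∈ L ∧ wt G Q x = 0)
  have h3 := Finset.card_union_le (X.filter fun x => x ∈ L ∧ wt G Q x ≠ 0)
    (X.filter fun x => x ∈ L ∧ wt G Q x = 0)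
  have h4 := Finset.card_le_card hXt
  have h5 := Finset.card_filter_add_card_filter_not (s := pairedTokens G F Q) (fun v => v ∈ U)
  omega

/-- A colouring of the light part that cannot be grown any more and reaches every token. -/
structure CompleteColoring (G : SimpleGraph V) (F Q : Finset V) (col : V → ℕ) (R : Set V) :
    Prop where
  coloring : Coloring G (lightPart G F Q : Set V) (fun v => wt G Q v ≠ 0) col R
  token_col : ∀ v ∈ lightPart G F Q, wt G Q v ≠ 0 → col v ≠ 0

/-- A token is its own owner, and owners are constant on monochromatic components. So each such
component has a single token and a single edge to `Q`, which is what `acyc_union` needs. -/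
theorem CompleteColoring.acyc {F Q : Finset V} {col : V → ℕ} {R : Set V}
    (h : CompleteColoring G F Q col R) (hF : Acyc G (F : Set V)) (hQ : Acyc G (Q : Set V)) {c : ℕ}
    (hc : c ≠ 0) : Acyc G ((Q : Set V) ∪ {v | col v = c}) := by
  classical
  have hLF : Acyc G (lightPart G F Q : Set V) := hF.mono fun v hv => (mem_lightPart.1 hv).1
  obtain ⟨own, inv⟩ := h.coloring.inv hLF
  have hmem : ∀ v, col v = c → v ∈ lightPart G F Q := fun v hv => inv.mem v (hv ▸ hc)
  have hset : {v | col v = c} = (((lightPart G F Q).filter fun v => col v = c : Finset V) : Set V) := by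
    ext v
    simp only [Set.mem_ofPred_eq, Finset.coe_filter]
    exact ⟨fun hv => ⟨hmem v hv, hv⟩, fun hv => hv.2⟩
  rw [hset]
  refine acyc_union hQ _ (hLF.mono ?_) ?_ ?_
  · intro v hv
    exact (Finset.mem_filter.1 hv).1
  · intro b hb
    exact (mem_lightPart.1 (Finset.mem_filter.1 hb).1).2.1
  · intro b hb b' hb' hr a ha a' ha' hba hba'
    rw [← hset] at hr
    have hb2 := (Finset.mem_filter.1 hb).2
    have hb2' := (Finset.mem_filter.1 hb').2
    have e1 := inv.own_self b (hb2 ▸ hc) (wt_ne_zero.2 ⟨a, ha, hba⟩)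
    have e2 := inv.own_self b' (hb2' ▸ hc) (wt_ne_zero.2 ⟨a', ha', hba'⟩)
    have e3 := inv.own_eq_of_reach hc hr
    have e4 : b = b' := by rw [← e1, e3, e2]
    subst e4
    exact ⟨rfl, wt_le_one.1 (mem_lightPart.1 (Finset.mem_filter.1 hb).1).2.2 a ha a' ha' hba hba'⟩

open Classical in
/-- The non-root tokens of colour `c`. -/
noncomputable def freeTokens (G : SimpleGraph V) (F Q : Finset V) (col : V → ℕ) (R : Set V) (c : ℕ) :
    Finset V :=
  (lightPart G F Q).filter fun v => wt G Q v ≠ 0 ∧ v ∉ R ∧ col v = c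

theorem mem_freeTokens {F Q : Finset V} {col : V → ℕ} {R : Set V} {c : ℕ} {v : V} :
    v ∈ freeTokens G F Q col R c ↔ v ∈ lightPart G F Q ∧ wt G Q v ≠ 0 ∧ v ∉ R ∧ col v = c := by
  simp [freeTokens]

/-- Heavy vertices and non-root tokens of the other colour either lie outside `T` or are connectors
inside the forest `T`, of which there are at most `|Q|`. A heavy vertex joins two vertices of `Q`; a
token joins its neighbour in `Q` to its parent, whose owner is adjacent to `Q`. -/
theorem CompleteColoring.card_le {F Q : Finset V} {col : V → ℕ} {R : Set V}
    (h : CompleteColoring G F Q col R) (hF : Acyc G (F : Set V)) {c : ℕ} (hc : c = 1 ∨ c = 2)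
    {U T : Finset V} (hFU : F ⊆ U) (hT : Acyc G (T : Set V))
    (hTQ : Q ⊆ T) (hTc : ∀ v, col v = c → v ∈ T) :
    (heavyPart G F Q).card + (freeTokens G F Q col R (3 - c)).card ≤ (U \ T).card + Q.card := by
  classical
  have hLF : Acyc G (lightPart G F Q : Set V) := hF.mono fun v hv => (mem_lightPart.1 hv).1
  obtain ⟨own, inv⟩ := h.coloring.inv hLF
  set Z := heavyPart G F Q ∪ freeTokens G F Q col R (3 - c) with hZdef
  have hZcard : Z.card = (heavyPart G F Q).card + (freeTokens G F Q col R (3 - c)).card := by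
    refine Finset.card_union_of_disjoint (Finset.disjoint_left.2 ?_)
    intro x hx hx'
    have := (mem_heavyPart.1 hx).2.2
    have := (mem_lightPart.1 (mem_freeTokens.1 hx').1).2.2
    omega
  have hc0 : c ≠ 0 := by omega
  have hsub : (Q : Set V) ∪ {v | col v = c} ⊆ (T : Set V) := by
    rintro v (hv | hv)
    · exact hTQ hv
    · exact hTc v hv
  have h1 : (Z ∩ T).card ≤ Q.card := by
    refine card_le_of_connectors (G := G) (T := (Q : Set V) ∪ {v | col v = c}) ?_ ?_ ?_
    · intro z hz hz'
      rcases Finset.mem_union.1 (Finset.mem_inter.1 hz).1 with hz | hz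
      · have h2 := mem_heavyPart.1 hz
        rcases hz' with hz' | hz'
        · exact h2.2.1 hz'
        · have hz' : col z = c := hz'
          have := (mem_lightPart.1 (inv.mem z (hz' ▸ hc0))).2.2
          omega
      · have h2 := mem_freeTokens.1 hz
        rcases hz' with hz' | hz'
        · exact (mem_lightPart.1 h2.1).2.1 hz'
        · have hz' : col z = c := hz'
          omega
    · refine hT.mono (Set.union_subset hsub ?_)
      intro x hx
      exact (Finset.mem_inter.1 hx).2
    · intro z hz
      rcases Finset.mem_union.1 (Finset.mem_inter.1 hz).1 with hz | hz
      · obtain ⟨a, ha, b, hb, hab, hza, hzb⟩ := two_le_wt (mem_heavyPart.1 hz).2.2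
        exact ⟨a, Or.inl ha, b, Or.inl hb, hab, hza, hzb, ⟨a, ha, Reach.refl a⟩, b, hb,
          Reach.refl b⟩
      · obtain ⟨hzL, hzw, hzR, hzc⟩ := mem_freeTokens.1 hz
        obtain ⟨q, hq, hzq⟩ := wt_ne_zero.1 hzw
        obtain ⟨u, ezu, hu⟩ := inv.parent z (by omega) hzw hzR
        have huc : col u = c := by omega
        have hu0 : col u ≠ 0 := huc ▸ hc0
        obtain ⟨q', hq', e'⟩ := wt_ne_zero.1 (inv.own_tok u hu0)
        have hr := inv.own_reach u hu0
        rw [huc] at hr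
        -- The parent `u` has colour `c`, so the way from it to its owner and on to `Q` stays in `Q`
        -- and the class `c`.
        have hown : own u ∈ (Q : Set V) ∪ {v | col v = c} := Or.inr ((inv.own_col u hu0).trans huc)
        refine ⟨q, Or.inl hq, u, Or.inr huc, ?_, hzq, ezu, ⟨q, hq, Reach.refl q⟩, q', hq',
          (hr.mono Set.subset_union_right).trans (Reach.of_adj e' hown (Or.inl hq'))⟩
        rintro rfl
        exact (mem_lightPart.1 (inv.mem q hu0)).2.1 hq
  have h2 : (Z \ T).card ≤ (U \ T).card := by
    refine Finset.card_le_card (Finset.sdiff_subset_sdiff ?_ subset_rfl)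
    intro z hz
    rcases Finset.mem_union.1 hz with hz | hz
    · exact hFU (mem_heavyPart.1 hz).1
    · exact hFU (mem_lightPart.1 (mem_freeTokens.1 hz).1).1
  have h3 := Finset.card_sdiff_add_card_inter Z T
  omega

/-- A light component has at most one root. Mapping each paired root to another token of its
component is therefore injective into the non-root tokens, and the paired tokens that are not roots
are counted once more. -/
theorem CompleteColoring.card_paired_le {F Q : Finset V} {col : V → ℕ} {R : Set V}
    (h : CompleteColoring G F Q col R) (hF : Acyc G (F : Set V)) :
    (pairedTokens G F Q).card ≤
      2 * ((freeTokens G F Q col R 1).card + (freeTokens G F Q col R 2).card) := by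
  classical
  have hLF : Acyc G (lightPart G F Q : Set V) := hF.mono fun v hv => (mem_lightPart.1 hv).1
  obtain ⟨own, inv⟩ := h.coloring.inv hLF
  set N := freeTokens G F Q col R 1 ∪ freeTokens G F Q col R 2 with hN
  have hmemN : ∀ v ∈ lightPart G F Q, wt G Q v ≠ 0 → v ∉ R → v ∈ N := by
    intro v hv hw hR
    have h1 := h.token_col v hv hw
    have h2 := inv.le_two v
    rw [hN, Finset.mem_union, mem_freeTokens, mem_freeTokens]
    by_cases hc : col v = 1
    · exact Or.inl ⟨hv, hw, hR, hc⟩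
    · exact Or.inr ⟨hv, hw, hR, by omega⟩
  have hNc : N.card ≤ (freeTokens G F Q col R 1).card + (freeTokens G F Q col R 2).card :=
    Finset.card_union_le _ _
  have h1 : ((pairedTokens G F Q).filter fun v => v ∉ R).card ≤ N.card := by
    refine Finset.card_le_card ?_
    intro v hv
    obtain ⟨hv, hR⟩ := Finset.mem_filter.1 hv
    obtain ⟨hvL, hw, -⟩ := mem_pairedTokens.1 hv
    exact hmemN v hvL hw hR
  have h2 : ((pairedTokens G F Q).filter fun v => v ∈ R).card ≤ N.card := by
    have hex : ∀ v : V, ∃ τ : V, v ∈ (pairedTokens G F Q).filter (fun v => v ∈ R) →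
        τ ∈ lightPart G F Q ∧ wt G Q τ ≠ 0 ∧ τ ≠ v ∧
          Reach G (lightPart G F Q : Set V) v τ := by
      intro v
      by_cases hv : v ∈ (pairedTokens G F Q).filter (fun v => v ∈ R)
      · obtain ⟨-, -, τ, h1, h2, h3, h4⟩ := mem_pairedTokens.1 (Finset.mem_filter.1 hv).1
        exact ⟨τ, fun _ => ⟨h1, h2, h3, h4⟩⟩
      · exact ⟨v, fun h => absurd h hv⟩
    choose f hf using hex
    refine Finset.card_le_card_of_injOn f ?_ ?_
    · intro v hv
      obtain ⟨h1, h2, h3, h4⟩ := hf v hv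
      refine hmemN _ h1 h2 fun hR => h3 ?_
      exact (inv.root_unique v (Finset.mem_filter.1 hv).2 _ hR h4).symm
    · intro v hv w hw hvw
      have r1 := (hf v hv).2.2.2
      have r2 := (hf w hw).2.2.2
      rw [← hvw] at r2
      exact inv.root_unique v (Finset.mem_filter.1 hv).2 w (Finset.mem_filter.1 hw).2
        (r1.trans r2.symm)
  have h3 := Finset.card_filter_add_card_filter_not (s := pairedTokens G F Q) (fun v => v ∈ R)
  omega

/-- What the search over the sets `Q` of at most `K` vertices of `U` guarantees: for each `Q` and
each colour class, it has met a solution avoiding the class and `Q`, of size at most `B`. -/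
def SearchBound (G : SimpleGraph V) (U F : Finset V) (K B : ℕ) : Prop :=
  ∀ Q ⊆ U, Q.Nonempty → Q.card ≤ K → Acyc G (Q : Set V) →
    ∃ col R, CompleteColoring G F Q col R ∧
    ∀ c, c = 1 ∨ c = 2 → ∃ T : Finset V, Acyc G (T : Set V) ∧ Q ⊆ T ∧ (∀ v, col v = c → v ∈ T) ∧
      (U \ T).card ≤ B

/-- Apply the counting to the closure `Q` of `P ∩ T`, which has at most `2 * P.card ≤ K` vertices
and so was met by the search. The two colours bound heavy vertices plus paired tokens by `4 * (B +
Q.card)`. -/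
theorem SearchBound.card_armed_le {U F P X : Finset V} {K B : ℕ} (hB : SearchBound G U F K B)
    (hFU : F ⊆ U) (hF : Acyc G (F : Set V)) {T : Finset V} (hTU : T ⊆ U) (hT : Acyc G (T : Set V))
    (hP : 2 * P.card ≤ K)
    (hX : ∀ x ∈ X, x ∈ F ∧ x ∉ T ∧ ∃ a ∈ T, ∃ b ∈ T, a ≠ b ∧ G.Adj x a ∧ G.Adj x b ∧
      (∃ s ∈ P, s ∈ T ∧ Arm G ((T : Set V) ∩ (F : Set V)) a s) ∧
      ∃ s ∈ P, s ∈ T ∧ Arm G ((T : Set V) ∩ (F : Set V)) b s) :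
    X.card ≤ 4 * B + 8 * P.card := by
  obtain ⟨Q, h1, h2, -, h4, h5⟩ := exists_closure (F := (F : Set V)) hT (P.filter fun s => s ∈ T)
    (fun q hq => (Finset.mem_filter.1 hq).2)
  have hcard : (P.filter fun s => s ∈ T).card ≤ P.card := Finset.card_filter_le _ _
  rcases X.eq_empty_or_nonempty with rfl | ⟨x, hx⟩
  · simp
  have hQne : Q.Nonempty := by
    obtain ⟨-, -, a, -, b, -, -, -, -, ⟨s, hs, hsT, -⟩, -⟩ := hX x hx
    exact ⟨s, h1 (Finset.mem_filter.2 ⟨hs, hsT⟩)⟩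
  obtain ⟨col, R, hcol, hc⟩ := hB Q (fun q hq => hTU (h2 q hq)) hQne (by omega)
    (hT.mono fun q hq => h2 q hq)
  have hb : X.card ≤ (heavyPart G F Q).card + (pairedTokens G F Q).card := by
    refine MaxMinFVS.card_armed_le (T := (T : Set V)) hF h2 h5 ?_
    intro x hx
    obtain ⟨hxF, hxT, a, ha, b, hb, hab, hxa, hxb, ⟨s, hs, hsT, hA⟩, s', hs', hsT', hA'⟩ := hX x hx
    exact ⟨hxF, hxT, a, ha, b, hb, hab, hxa, hxb, ⟨s, h1 (Finset.mem_filter.2 ⟨hs, hsT⟩), hA⟩,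
      s', h1 (Finset.mem_filter.2 ⟨hs', hsT'⟩), hA'⟩
  obtain ⟨T1, a1, a2, a3, a4⟩ := hc 1 (Or.inl rfl)
  obtain ⟨T2, b1, b2, b3, b4⟩ := hc 2 (Or.inr rfl)
  have e1 := hcol.card_le hF (Or.inl rfl) hFU a1 a2 a3
  have e2 := hcol.card_le hF (Or.inr rfl) hFU b1 b2 b3
  have e3 := hcol.card_paired_le hF
  simp only [show 3 - 1 = 2 from rfl, show 3 - 2 = 1 from rfl] at e1 e2
  omega

/-- A finite set can be cut into `q` parts of at most `k` elements if it has at most `k * q`. -/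
theorem exists_parts (S : Finset V) {k q : ℕ} (h : S.card ≤ k * q) :
    ∃ f : V → ℕ, (∀ s ∈ S, f s < q) ∧ ∀ i, (S.filter fun s => f s = i).card ≤ k := by
  classical
  rcases Nat.eq_zero_or_pos k with rfl | hk
  · have : S = ∅ := by simpa using h
    subst this
    exact ⟨fun _ => 0, by simp, by simp⟩
  obtain ⟨e⟩ : Nonempty (S ≃ Fin S.card) := ⟨S.equivFin⟩
  let g : V → ℕ := fun s => if hs : s ∈ S then e ⟨s, hs⟩ else 0
  have hg : ∀ s (hs : s ∈ S), g s = e ⟨s, hs⟩ := fun s hs => by simp [g, hs]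
  refine ⟨fun s => g s / k, ?_, ?_⟩
  · intro s hs
    rw [Nat.div_lt_iff_lt_mul hk, hg s hs]
    exact lt_of_lt_of_le (e ⟨s, hs⟩).2 (by rwa [mul_comm] at h)
  · intro i
    refine (Finset.card_le_card_of_injOn (t := Finset.range k) (fun s => g s % k) ?_ ?_).trans
      (Finset.card_range k).le
    · intro s _
      simpa using Nat.mod_lt _ hk
    · intro s hs t ht hst
      simp only [Finset.coe_filter, Set.mem_ofPred_eq] at hs ht
      have h1 : g s = g t := by
        rw [← Nat.div_add_mod (g s) k, ← Nat.div_add_mod (g t) k, hs.2, ht.2]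
        simp only at hst
        rw [hst]
      rw [hg s hs.1, hg t ht.1] at h1
      have := e.injective (Fin.ext h1)
      exact congrArg Subtype.val this

/-- The approximation guarantee: if the search covers all sets of at most `4 * k` vertices and
`k * q ^ 3` is at least the number of vertices, then no minimal feedback vertex set is larger than
`64 * q ^ 2 * B`. -/
theorem SearchBound.card_le {U F : Finset V} {k q B : ℕ} (hB : SearchBound G U F (4 * k) B)
    (hFU : F ⊆ U) (hF : Acyc G (F : Set V)) (hFB : (U \ F).card ≤ B) (hq : 1 ≤ q)
    (hk : U.card ≤ k * q ^ 3) {T : Finset V} (hTU : T ⊆ U) (hT : Acyc G (T : Set V))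
    (hmax : ∀ x ∈ U, x ∉ T → ¬ Acyc G (insert x (T : Set V))) :
    (U \ T).card ≤ 64 * q ^ 2 * B := by
  classical
  have hTle : (U \ T).card ≤ U.card := Finset.card_le_card Finset.sdiff_subset
  -- If the complement of `F` is this large, `F` itself is a good enough solution.
  by_cases hbig : U.card < (U \ F).card * q ^ 2
  · calc (U \ T).card ≤ (U \ F).card * q ^ 2 := by omega
      _ ≤ B * q ^ 2 := Nat.mul_le_mul_right _ hFB
      _ ≤ 64 * q ^ 2 * B := by nlinarith [Nat.zero_le (B * q ^ 2)]
  push Not at hbig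
  set s := (U \ F).card with hs
  -- the size of the parts
  set k₁ := (s + q - 1) / q with hk₁
  have hk1a : s ≤ k₁ * q := by
    have := Nat.div_add_mod (s + q - 1) q
    have := Nat.mod_lt (s + q - 1) hq
    rw [hk₁, mul_comm]
    omega
  have hk1b : k₁ * q ≤ s + q - 1 := Nat.div_mul_le_self _ _
  have hk1c : k₁ ≤ k := by
    have h1 : s * q ^ 2 ≤ (k * q) * q ^ 2 := by
      calc s * q ^ 2 ≤ U.card := hbig
        _ ≤ k * q ^ 3 := hk
        _ = (k * q) * q ^ 2 := by ring
    have h2 : s ≤ k * q := Nat.le_of_mul_le_mul_right h1 (by positivity)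
    have h3 : k₁ * q < (k + 1) * q := by
      have : (k + 1) * q = k * q + q := by ring
      omega
    have := Nat.lt_of_mul_lt_mul_right h3
    omega
  obtain ⟨f, hf, hfc⟩ := exists_parts (U \ F) hk1a
  -- The two arms of a vertex may end in different parts, so pairs of parts are needed. A pair has
  -- at most `2 * k₁` vertices and its closure at most `4 * k₁`, whence the search up to `4 * k`.
  let P : ℕ × ℕ → Finset V := fun p =>
    (U \ F).filter (fun s => f s = p.1) ∪ (U \ F).filter fun s => f s = p.2
  have hPc : ∀ p, (P p).card ≤ 2 * k₁ := by
    intro p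
    have := Finset.card_union_le ((U \ F).filter fun s => f s = p.1)
      ((U \ F).filter fun s => f s = p.2)
    have := hfc p.1
    have := hfc p.2
    simp only [P]
    omega
  let good : ℕ × ℕ → V → Prop := fun p x => x ∉ T ∧ ∃ a ∈ T, ∃ b ∈ T, a ≠ b ∧ G.Adj x a ∧
    G.Adj x b ∧ (∃ s ∈ P p, s ∈ T ∧ Arm G ((T : Set V) ∩ (F : Set V)) a s) ∧
      ∃ s ∈ P p, s ∈ T ∧ Arm G ((T : Set V) ∩ (F : Set V)) b s
  have hcover : F \ T ⊆ (Finset.range q ×ˢ Finset.range q).biUnion fun p => F.filter (good p) := by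
    intro x hx
    obtain ⟨hxF, hxT⟩ := Finset.mem_sdiff.1 hx
    obtain ⟨a, ha, b, hb, hab, hxa, hxb, ⟨s, hsT, hsF, hA⟩, s', hsT', hsF', hA'⟩ :=
      exists_arms hT hF hxF hxT (hmax x (hFU hxF) hxT)
    have m1 : s ∈ U \ F := Finset.mem_sdiff.2 ⟨hTU hsT, hsF⟩
    have m2 : s' ∈ U \ F := Finset.mem_sdiff.2 ⟨hTU hsT', hsF'⟩
    refine Finset.mem_biUnion.2 ⟨(f s, f s'), ?_, ?_⟩
    · simp [hf s m1, hf s' m2]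
    · refine Finset.mem_filter.2 ⟨hxF, hxT, a, ha, b, hb, hab, hxa, hxb, ⟨s, ?_, hsT, hA⟩, s', ?_,
        hsT', hA'⟩
      · exact Finset.mem_union_left _ (Finset.mem_filter.2 ⟨m1, rfl⟩)
      · exact Finset.mem_union_right _ (Finset.mem_filter.2 ⟨m2, rfl⟩)
  have hpair : ∀ p ∈ Finset.range q ×ˢ Finset.range q,
      (F.filter (good p)).card ≤ 4 * B + 16 * k₁ := by
    intro p _
    have h1 : (F.filter (good p)).card ≤ 4 * B + 8 * (P p).card := by
      refine hB.card_armed_le hFU hF hTU hT (by have := hPc p; omega) ?_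
      intro x hx
      obtain ⟨hxF, hg⟩ := Finset.mem_filter.1 hx
      exact ⟨hxF, hg⟩
    have := hPc p
    omega
  have hFT : (F \ T).card ≤ q * q * (4 * B + 16 * k₁) := by
    refine (Finset.card_le_card hcover).trans ?_
    refine (Finset.card_biUnion_le_card_mul _ _ _ hpair).trans ?_
    simp
  have hUT : (U \ T).card ≤ (F \ T).card + s := by
    have : U \ T ⊆ (F \ T) ∪ (U \ F) := by
      intro x hx
      obtain ⟨hxU, hxT⟩ := Finset.mem_sdiff.1 hx
      by_cases hxF : x ∈ F
      · exact Finset.mem_union_left _ (Finset.mem_sdiff.2 ⟨hxF, hxT⟩)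
      · exact Finset.mem_union_right _ (Finset.mem_sdiff.2 ⟨hxU, hxF⟩)
    exact (Finset.card_le_card this).trans (Finset.card_union_le _ _)
  -- Rounding up to `k₁` costs a term in `q * q` without the factor `B`, so `B ≥ 1` is needed; when
  -- `s = 0`, `F` is everything and nothing lies outside `T`.
  rcases Nat.eq_zero_or_pos s with h0 | hpos
  · have hFT0 : F \ T = ∅ := by
      rw [Finset.eq_empty_iff_forall_notMem]
      intro x hx
      obtain ⟨hxF, hxT⟩ := Finset.mem_sdiff.1 hx
      refine hmax x (hFU hxF) hxT (hF.mono ?_)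
      have hUF : U ⊆ F := Finset.sdiff_eq_empty_iff_subset.1 (Finset.card_eq_zero.1 (hs ▸ h0))
      intro y hy
      rcases hy with rfl | hy
      · exact hxF
      · exact hUF (hTU hy)
    rw [hFT0, Finset.card_empty] at hUT
    omega
  · have hB1 : 1 ≤ B := le_trans hpos hFB
    have h1 : q * q * (4 * B + 16 * k₁) ≤ 4 * (q * q * B) + 16 * (q * (B + q)) := by
      have : q * (q * k₁) ≤ q * (B + q) := Nat.mul_le_mul_left _ (by rw [mul_comm]; omega)
      nlinarith
    have h2 : q * B ≤ q * q * B := by nlinarith [Nat.zero_le (q * B)]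
    have h3 : q * q ≤ q * q * B := Nat.le_mul_of_pos_right _ hB1
    have h4 : B ≤ q * q * B := Nat.le_mul_of_pos_left _ (by positivity)
    nlinarith

end

/-! ### A program logic with time bounds -/

/-- Memory with cell `i` of array `a` set to `v`. -/
def upd (σ : RamMemory) (a i v : ℕ) : RamMemory :=
  Function.update σ a (Function.update (σ a) i v)

theorem upd_apply (σ : RamMemory) (a i v b j : ℕ) :
    upd σ a i v b j = if b = a ∧ j = i then v else σ b j := by
  unfold upd
  by_cases hb : b = a
  · subst hb
    by_cases hj : j = i
    · subst hj
      simp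
    · simp [hj]
  · simp [hb]

@[simp] theorem upd_self (σ : RamMemory) (a i v : ℕ) : upd σ a i v a i = v := by
  simp [upd_apply]

theorem upd_ne {a b : ℕ} (h : b ≠ a) (σ : RamMemory) (i v : ℕ) : upd σ a i v b = σ b := by
  simp [upd, h]

theorem upd_same {i j : ℕ} (h : j ≠ i) (σ : RamMemory) (a v : ℕ) :
    upd σ a i v a j = σ a j := by
  simp [upd_apply, h]

/-- The arrays outside `W` are the same in `τ` as in `σ`. -/
def Frame (W : List ℕ) (σ τ : RamMemory) : Prop := ∀ a, a ∉ W → τ a = σ a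

theorem Frame.refl (W : List ℕ) (σ : RamMemory) : Frame W σ σ := fun _ _ => rfl

theorem Frame.upd {W : List ℕ} {σ τ : RamMemory} (h : Frame W σ τ) {a : ℕ} (ha : a ∈ W) (i v : ℕ) :
    Frame W σ (upd τ a i v) := by
  intro b hb
  have hne : b ≠ a := by
    rintro rfl
    exact hb ha
  rw [upd_ne hne, h b hb]

theorem Frame.trans {W W' : List ℕ} {σ τ υ : RamMemory} (h : Frame W σ τ) (h' : Frame W' τ υ)
    (hs : W' ⊆ W) : Frame W σ υ :=
  fun a ha => (h' a fun h => ha (hs h)).trans (h a ha)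

theorem Frame.mono {W W' : List ℕ} {σ τ : RamMemory} (h : Frame W' σ τ) (hs : W' ⊆ W) :
    Frame W σ τ := fun a ha => h a fun h => ha (hs h)

/-- A time bound for runs in which no loop is iterated more than `N` times in a row. -/
def timeBound (N : ℕ) : RamProgram → ℕ
  | .skip => 1
  | .store _ i e => i.cost + e.cost + 1
  | .seq P Q => timeBound N P + timeBound N Q
  | .ite e P Q => e.cost + timeBound N P + timeBound N Q + 1
  | .while e P => (N + 1) * (e.cost + timeBound N P + 1)

/-- The program is fixed, so its loops contribute a fixed number of factors `N + 1`. All dependence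
on the input is hidden in `N`. -/
theorem timeBound_poly (P : RamProgram) : ∃ A d : ℕ, ∀ N, timeBound N P ≤ A * (N + 1) ^ d := by
  have key : ∀ (A B d e N : ℕ),
      A * (N + 1) ^ d + B * (N + 1) ^ e ≤ (A + B) * (N + 1) ^ (d + e) := by
    intro A B d e N
    have h1 : (N + 1) ^ d ≤ (N + 1) ^ (d + e) := Nat.pow_le_pow_right (by omega) (by omega)
    have h2 : (N + 1) ^ e ≤ (N + 1) ^ (d + e) := Nat.pow_le_pow_right (by omega) (by omega)
    rw [add_mul]
    exact Nat.add_le_add (Nat.mul_le_mul_left _ h1) (Nat.mul_le_mul_left _ h2)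
  have one : ∀ d N : ℕ, 1 ≤ (N + 1) ^ d := fun d N => Nat.one_le_pow _ _ (by omega)
  induction P with
  | skip => exact ⟨1, 0, fun N => by simp [timeBound]⟩
  | store a i e => exact ⟨i.cost + e.cost + 1, 0, fun N => by simp [timeBound]⟩
  | seq P Q ihP ihQ =>
    obtain ⟨A, d, hA⟩ := ihP
    obtain ⟨B, e, hB⟩ := ihQ
    exact ⟨A + B, d + e, fun N => (Nat.add_le_add (hA N) (hB N)).trans (key A B d e N)⟩
  | ite c P Q ihP ihQ =>
    obtain ⟨A, d, hA⟩ := ihP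
    obtain ⟨B, e, hB⟩ := ihQ
    refine ⟨A + B + (c.cost + 1), d + e, fun N => ?_⟩
    have h1 := (Nat.add_le_add (hA N) (hB N)).trans (key A B d e N)
    have h2 := Nat.mul_le_mul_left (c.cost + 1) (one (d + e) N)
    rw [add_mul (A + B)]
    simp only [timeBound]
    omega
  | _ =>
    rename_i c P ihP
    obtain ⟨A, d, hA⟩ := ihP
    refine ⟨A + (c.cost + 1), d + 1, fun N => ?_⟩
    have h2 := Nat.mul_le_mul_left (c.cost + 1) (one d N)
    have h1 : c.cost + timeBound N P + 1 ≤ (A + (c.cost + 1)) * (N + 1) ^ d := by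
      rw [add_mul]
      have := hA N
      omega
    calc (N + 1) * (c.cost + timeBound N P + 1)
        ≤ (N + 1) * ((A + (c.cost + 1)) * (N + 1) ^ d) := Nat.mul_le_mul_left _ h1
      _ = (A + (c.cost + 1)) * (N + 1) ^ (d + 1) := by ring

/-- Started on `σ`, the program halts within its time bound on a memory satisfying `Φ`. -/
def Wp (N : ℕ) (P : RamProgram) (σ : RamMemory) (Φ : RamMemory → Prop) : Prop :=
  ∃ t τ, RamRuns P σ t τ ∧ t ≤ timeBound N P ∧ Φ τ

theorem Wp.mono {N : ℕ} {P : RamProgram} {σ : RamMemory} {Φ Ψ : RamMemory → Prop}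
    (h : Wp N P σ Φ) (hi : ∀ τ, Φ τ → Ψ τ) : Wp N P σ Ψ := by
  obtain ⟨t, τ, hr, ht, hτ⟩ := h
  exact ⟨t, τ, hr, ht, hi τ hτ⟩

theorem Wp.skip {N : ℕ} {σ : RamMemory} {Φ : RamMemory → Prop} (h : Φ σ) : Wp N .skip σ Φ :=
  ⟨1, σ, .skip σ, le_rfl, h⟩

theorem Wp.store {N : ℕ} {σ : RamMemory} {Φ : RamMemory → Prop} {a : ℕ} {i e : RamExpr}
    (h : Φ (upd σ a (i.eval σ) (e.eval σ))) : Wp N (.store a i e) σ Φ :=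
  ⟨_, _, .store a i e σ, le_rfl, h⟩

theorem Wp.seq {N : ℕ} {σ : RamMemory} {Φ : RamMemory → Prop} {P Q : RamProgram}
    (h : Wp N P σ fun τ => Wp N Q τ Φ) : Wp N (.seq P Q) σ Φ := by
  obtain ⟨t, τ, hr, ht, s, υ, hr', hs, hυ⟩ := h
  exact ⟨t + s, υ, .seq hr hr', Nat.add_le_add ht hs, hυ⟩

theorem Wp.ite {N : ℕ} {σ : RamMemory} {Φ : RamMemory → Prop} {e : RamExpr} {P Q : RamProgram}
    (h1 : e.eval σ ≠ 0 → Wp N P σ Φ) (h2 : e.eval σ = 0 → Wp N Q σ Φ) :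
    Wp N (.ite e P Q) σ Φ := by
  by_cases h : e.eval σ = 0
  · obtain ⟨t, τ, hr, ht, hτ⟩ := h2 h
    exact ⟨_, τ, .ite_false h hr, by simp only [timeBound]; omega, hτ⟩
  · obtain ⟨t, τ, hr, ht, hτ⟩ := h1 h
    exact ⟨_, τ, .ite_true h hr, by simp only [timeBound]; omega, hτ⟩

/-- The invariant is indexed by the number of completed iterations, so requiring `i < N` before each
further one gives termination and the time bound together. -/
theorem Wp.loop {N : ℕ} {σ : RamMemory} {Φ : RamMemory → Prop} {e : RamExpr} {P : RamProgram}
    (I : ℕ → RamMemory → Prop) (h0 : I 0 σ)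
    (hs : ∀ i τ, I i τ → e.eval τ ≠ 0 → i < N ∧ Wp N P τ (I (i + 1)))
    (he : ∀ i τ, I i τ → e.eval τ = 0 → Φ τ) : Wp N (.while e P) σ Φ := by
  suffices h : ∀ m i τ, i + m = N → I i τ → ∃ t υ, RamRuns (.while e P) τ t υ ∧
      t ≤ (m + 1) * (e.cost + timeBound N P + 1) ∧ Φ υ from h N 0 σ (by omega) h0
  intro m
  induction m with
  | zero =>
    intro i τ hi hI
    by_cases h : e.eval τ = 0
    · exact ⟨_, τ, .while_false h, by omega, he i τ hI h⟩
    · have := (hs i τ hI h).1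
      omega
  | succ m ih =>
    intro i τ hi hI
    by_cases h : e.eval τ = 0
    · refine ⟨_, τ, .while_false h, ?_, he i τ hI h⟩
      have := Nat.zero_le ((m + 1) * (e.cost + timeBound N P + 1))
      rw [add_mul (m + 1)]
      omega
    · obtain ⟨t, υ, hr, ht, hυ⟩ := (hs i τ hI h).2
      obtain ⟨s, ω, hr', ht', hω⟩ := ih (i + 1) υ (by omega) hυ
      refine ⟨_, ω, .while_true h hr hr', ?_, hω⟩
      rw [add_mul (m + 1)]
      omega

/-- The scalar kept in cell `0` of array `a`. -/
abbrev sc (a : ℕ) : RamExpr := .load a (.const 0)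

/-- The loop `for x = 0, …, b - 1`. -/
def forLoop (x b : ℕ) (body : RamProgram) : RamProgram :=
  .seq (.store x (.const 0) (.const 0))
    (.while (.sub (sc b) (sc x)) (.seq body (.store x (.const 0) (.add (sc x) (.const 1)))))

/-- The invariant is required after the counter has been advanced, so that it may speak of the whole
memory, counter included. The body must preserve the counter and the bound. -/
theorem Wp.forLoop {N : ℕ} {σ : RamMemory} {Φ : RamMemory → Prop} {x b : ℕ} {body : RamProgram}
    {m : ℕ} (hm : σ b 0 = m) (hN : m ≤ N) (hxb : b ≠ x) (I : ℕ → RamMemory → Prop)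
    (h0 : I 0 (upd σ x 0 0))
    (hs : ∀ i < m, ∀ τ, I i τ → τ x 0 = i → τ b 0 = m →
      Wp N body τ fun υ => υ x 0 = i ∧ υ b 0 = m ∧ I (i + 1) (upd υ x 0 (i + 1)))
    (he : ∀ τ, I m τ → Φ τ) : Wp N (forLoop x b body) σ Φ := by
  refine Wp.seq (Wp.store (Wp.loop
    (fun i τ => i ≤ m ∧ τ x 0 = i ∧ τ b 0 = m ∧ I i τ) ?_ ?_ ?_))
  · refine ⟨by omega, by simp [RamExpr.eval], ?_, h0⟩
    rw [upd_ne hxb]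
    exact hm
  · rintro i τ ⟨_, hx, hb, hI⟩ hne
    simp only [RamExpr.eval, hx, hb] at hne
    have hi : i < m := by omega
    refine ⟨by omega, Wp.seq ((hs i hi τ hI hx hb).mono ?_)⟩
    rintro υ ⟨h1, h2, h3⟩
    refine Wp.store ?_
    simp only [RamExpr.eval, h1]
    refine ⟨hi, by simp, ?_, h3⟩
    rw [upd_ne hxb, h2]
  · rintro i τ ⟨hi, hx, hb, hI⟩ h0
    simp only [RamExpr.eval, hx, hb] at h0
    have : i = m := by omega
    exact he τ (this ▸ hI)

/-- `A[u] := e` for `u = 0, …, n - 1`, where `u` is kept in `x`. -/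
def tabulate (A x : ℕ) (e : RamExpr) : RamProgram := forLoop x 0 (.store A (sc x) e)

theorem Wp.tabulate {N n : ℕ} {σ : RamMemory} {A x : ℕ} {e : RamExpr} (hn : σ 0 0 = n) (hN : n ≤ N)
    (hA : A ≠ 0) (hx : x ≠ 0) (hxA : x ≠ A) (f : ℕ → ℕ)
    (hf : ∀ u < n, ∀ τ, Frame [A, x] σ τ → τ x 0 = u → e.eval τ = f u) :
    Wp N (tabulate A x e) σ fun τ => Frame [A, x] σ τ ∧ ∀ u < n, τ A u = f u := by
  refine Wp.forLoop hn hN hx.symm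
    (fun i τ => Frame [A, x] σ τ ∧ ∀ u < i, τ A u = f u) ?_ ?_ ?_
  · exact ⟨(Frame.refl _ σ).upd (by simp) _ _, by simp⟩
  · rintro i hi τ ⟨hF, hT⟩ hxi h0
    refine Wp.store ?_
    have he := hf i hi τ hF hxi
    refine ⟨?_, ?_, ?_, ?_⟩
    · rw [upd_ne hxA, hxi]
    · rw [upd_ne hA.symm, h0]
    · exact (hF.upd (by simp) _ _).upd (by simp) _ _
    · intro u hu
      rw [upd_ne hxA.symm]
      simp only [RamExpr.eval, hxi, he, upd_apply, true_and]
      split_ifs with h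
      · rw [h]
      · exact hT u (by omega)
  · exact fun τ h => h

/-- `s := s + e` for `u = 0, …, b - 1`, where `u` is kept in `x`. -/
def accumulate (s x b : ℕ) (e : RamExpr) : RamProgram :=
  forLoop x b (.store s (.const 0) (.add (sc s) e))

theorem Wp.accumulate {N n : ℕ} {σ : RamMemory} {s x b : ℕ} {e : RamExpr} (hn : σ b 0 = n)
    (hN : n ≤ N) (hs : s ≠ b) (hx : x ≠ b) (hxs : x ≠ s) (f : ℕ → ℕ)
    (hf : ∀ u < n, ∀ τ, Frame [s, x] σ τ → τ x 0 = u → e.eval τ = f u) :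
    Wp N (accumulate s x b e) σ fun τ => Frame [s, x] σ τ ∧
      τ s 0 = σ s 0 + ∑ u ∈ Finset.range n, f u := by
  refine Wp.forLoop hn hN hx.symm
    (fun i τ => Frame [s, x] σ τ ∧ τ s 0 = σ s 0 + ∑ u ∈ Finset.range i, f u) ?_ ?_ ?_
  · exact ⟨(Frame.refl _ σ).upd (by simp) _ _, by simp [upd_ne hxs.symm]⟩
  · rintro i hi τ ⟨hF, hT⟩ hxi h0
    refine Wp.store ?_
    have he := hf i hi τ hF hxi
    refine ⟨?_, ?_, ?_, ?_⟩
    · rw [upd_ne hxs, hxi]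
    · rw [upd_ne hs.symm, h0]
    · exact (hF.upd (by simp) _ _).upd (by simp) _ _
    · rw [upd_ne hxs.symm]
      simp only [RamExpr.eval, he, upd_self, Finset.sum_range_succ, hT]
      omega
  · exact fun τ h => h

/-! ### Greedy construction of maximal forests -/

/-- The set of the cells below `n` that are not zero. -/
def supp (n : ℕ) (f : ℕ → ℕ) : Finset ℕ := (Finset.range n).filter fun u => f u ≠ 0

theorem mem_supp {n : ℕ} {f : ℕ → ℕ} {u : ℕ} : u ∈ supp n f ↔ u < n ∧ f u ≠ 0 := by
  simp [supp]

theorem supp_subset (n : ℕ) (f : ℕ → ℕ) : supp n f ⊆ Finset.range n := Finset.filter_subset _ _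

theorem supp_upd {n : ℕ} {σ : RamMemory} {a i v : ℕ} (hi : i < n) (hv : v ≠ 0) :
    supp n (upd σ a i v a) = insert i (supp n (σ a)) := by
  ext u
  simp only [mem_supp, Finset.mem_insert, upd_apply, true_and]
  by_cases h : u = i
  · simp [h, hi, hv]
  · simp [h]

open Classical in
/-- The part of the memory that holds the input and is not changed by the search. -/
structure Ctx (n : ℕ) (G : SimpleGraph ℕ) (σ : RamMemory) : Prop where
  size : σ 0 0 = n
  adj : ∀ u < n, ∀ v < n, σ 1 (u * n + v) = if G.Adj u v then 1 else 0
  row : ∀ u < n, σ 3 u = u * n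
  ones : ∀ u < n, σ 4 u = 1

/-- Arrays `0`, `1`, `3`, `4` are read-only once prepared, and `2` is the output. From `5` on:
forest, component names and marks in `5` to `7`; `F`, `Q`, weights, light part, colours and current
class in `8` to `13`; scalars from `21`. -/
theorem Ctx.frame {n : ℕ} {G : SimpleGraph ℕ} {σ τ : RamMemory} {W : List ℕ} (h : Ctx n G σ)
    (hF : Frame W σ τ) (hW : ∀ a ∈ W, a = 2 ∨ 5 ≤ a) : Ctx n G τ := by
  have e : ∀ a, a ≠ 2 ∧ a < 5 → τ a = σ a := fun a ha => hF a fun h => by have := hW a h; omega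
  exact ⟨by rw [e 0 (by omega)]; exact h.size, by rw [e 1 (by omega)]; exact h.adj,
    by rw [e 3 (by omega)]; exact h.row, by rw [e 4 (by omega)]; exact h.ones⟩

/-- The adjacency of the vertices kept in `x` and `y`. -/
def adjE (x y : ℕ) : RamExpr := .load 1 (.add (.load 3 (sc x)) (sc y))

open Classical in
theorem Ctx.adjE_eval {n : ℕ} {G : SimpleGraph ℕ} {σ : RamMemory} (h : Ctx n G σ) {x y u v : ℕ}
    (hx : σ x 0 = u) (hy : σ y 0 = v) (hu : u < n) (hv : v < n) :
    (adjE x y).eval σ = if G.Adj u v then 1 else 0 := by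
  simp only [adjE, RamExpr.eval, hx, hy, h.row u hu, h.adj u hu v hv]

/-- Array `5` holds an induced forest and array `6` names its components by vertices in them. -/
structure Lab (n : ℕ) (G : SimpleGraph ℕ) (σ : RamMemory) : Prop where
  acyc : Acyc G (supp n (σ 5) : Set ℕ)
  mem : ∀ u ∈ supp n (σ 5), σ 6 u ∈ supp n (σ 5)
  iff : ∀ u ∈ supp n (σ 5), ∀ w ∈ supp n (σ 5),
    (σ 6 u = σ 6 w ↔ Reach G (supp n (σ 5) : Set ℕ) u w)
  le_one : ∀ u < n, σ 5 u ≤ 1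

/-- Marks the components adjacent to the vertex in `31`; `25` is set if one is met twice. -/
def scanNeighbours : RamProgram :=
  .seq (tabulate 7 30 (.const 0)) <| .seq (.store 25 (.const 0) (.const 0)) <|
  forLoop 30 0 <| .ite (adjE 31 30)
    (.ite (.load 5 (sc 30))
      (.ite (.load 7 (.load 6 (sc 30))) (.store 25 (.const 0) (.const 1))
        (.store 7 (.load 6 (sc 30)) (.const 1)))
      .skip)
    .skip

/-- Gives the name of the vertex in `31` to all marked components. -/
def relabel : RamProgram :=
  forLoop 30 0 <| .ite (.load 5 (sc 30))
    (.ite (.load 7 (.load 6 (sc 30))) (.store 6 (sc 30) (sc 31)) .skip) .skip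

/-- Adds the vertex in `31` to the forest if no cycle arises. -/
def addVertex : RamProgram :=
  .seq scanNeighbours <| .ite (sc 25) .skip <| .seq relabel <|
    .seq (.store 5 (sc 31) (.const 1)) (.store 6 (sc 31) (sc 31))

/-- A marked name is met again exactly when two neighbours in the forest lie in one component, and
by `acyc_insert` that is the only obstacle to adding the vertex. -/
theorem wp_scanNeighbours {N n : ℕ} {G : SimpleGraph ℕ} {σ : RamMemory} {v : ℕ} (hN : n ≤ N)
    (hC : Ctx n G σ) (hL : Lab n G σ) (hv : v < n) (hv' : σ 31 0 = v) :
    Wp N scanNeighbours σ fun τ => Frame [7, 25, 30] σ τ ∧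
      (∀ l < n, τ 7 l ≠ 0 ↔ ∃ u ∈ supp n (σ 5), G.Adj v u ∧ σ 6 u = l) ∧
      (τ 25 0 = 0 ↔ ∀ u ∈ supp n (σ 5), ∀ w ∈ supp n (σ 5), G.Adj v u → G.Adj v w → u ≠ w →
        σ 6 u ≠ σ 6 w) := by
  classical
  refine Wp.seq ((Wp.tabulate hC.size hN (by omega) (by omega) (by omega) (fun _ => 0)
    (fun u _ τ _ _ => rfl)).mono ?_)
  rintro τ₁ ⟨hF₁, h7⟩
  refine Wp.seq (Wp.store ?_)
  simp only [RamExpr.eval]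
  have hF₂ : Frame [7, 25, 30] σ (upd τ₁ 25 0 0) := (hF₁.mono (by simp)).upd (by simp) _ _
  set τ₂ := upd τ₁ 25 0 0 with hτ₂
  have h72 : ∀ u < n, τ₂ 7 u = 0 := fun u hu => by rw [hτ₂, upd_ne (by omega)]; exact h7 u hu
  have h25 : τ₂ 25 0 = 0 := by simp [hτ₂]
  refine Wp.forLoop (m := n) (by rw [hF₂ 0 (by simp)]; exact hC.size) hN (by omega)
    (fun i τ => Frame [7, 25, 30] σ τ ∧
      (∀ l < n, τ 7 l ≠ 0 ↔ ∃ u < i, u ∈ supp n (σ 5) ∧ G.Adj v u ∧ σ 6 u = l) ∧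
      (τ 25 0 = 0 ↔ ∀ u < i, ∀ w < i, u ∈ supp n (σ 5) → w ∈ supp n (σ 5) → G.Adj v u →
        G.Adj v w → u ≠ w → σ 6 u ≠ σ 6 w)) ?_ ?_ ?_
  · refine ⟨hF₂.upd (by simp) _ _, ?_, ?_⟩
    · intro l hl
      rw [upd_ne (by omega), h72 l hl]
      simp
    · rw [upd_ne (by omega), h25]
      simp
  · rintro i hi τ ⟨hF, hm, hb⟩ hxi h0
    have hCτ := hC.frame hF (by simp)
    have h31 : τ 31 0 = v := by rw [hF 31 (by simp), hv']
    have h5 : τ 5 = σ 5 := hF 5 (by simp)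
    have h6 : τ 6 = σ 6 := hF 6 (by simp)
    have hadj := hCτ.adjE_eval h31 hxi hv hi
    -- nothing to do unless `i` is a neighbour in the forest
    have hskip : ¬ (i ∈ supp n (σ 5) ∧ G.Adj v i) → Wp N .skip τ fun υ => υ 30 0 = i ∧ υ 0 0 = n ∧
        Frame [7, 25, 30] σ (upd υ 30 0 (i + 1)) ∧
        (∀ l < n, upd υ 30 0 (i + 1) 7 l ≠ 0 ↔
          ∃ u < i + 1, u ∈ supp n (σ 5) ∧ G.Adj v u ∧ σ 6 u = l) ∧
        (upd υ 30 0 (i + 1) 25 0 = 0 ↔ ∀ u < i + 1, ∀ w < i + 1, u ∈ supp n (σ 5) →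
          w ∈ supp n (σ 5) → G.Adj v u → G.Adj v w → u ≠ w → σ 6 u ≠ σ 6 w) := by
      intro hno
      refine Wp.skip ⟨hxi, h0, hF.upd (by simp) _ _, ?_, ?_⟩
      · intro l hl
        rw [upd_ne (by omega), hm l hl]
        constructor
        · rintro ⟨u, hu, h⟩
          exact ⟨u, by omega, h⟩
        · rintro ⟨u, hu, h1, h2, h3⟩
          have : u ≠ i := by
            rintro rfl
            exact hno ⟨h1, h2⟩
          exact ⟨u, by omega, h1, h2, h3⟩
      · rw [upd_ne (by omega), hb]
        constructor
        · intro h u hu w hw h1 h2 h3 h4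
          have : u ≠ i := by
            rintro rfl
            exact hno ⟨h1, h3⟩
          have : w ≠ i := by
            rintro rfl
            exact hno ⟨h2, h4⟩
          exact h u (by omega) w (by omega) h1 h2 h3 h4
        · intro h u hu w hw
          exact h u (by omega) w (by omega)
    refine Wp.ite ?_ ?_
    · intro hne
      have hvi : G.Adj v i := by
        by_contra hno
        rw [hadj, if_neg hno] at hne
        exact hne rfl
      refine Wp.ite ?_ ?_
      · intro hne5
        have hiT : i ∈ supp n (σ 5) := by
          rw [mem_supp]
          refine ⟨hi, ?_⟩
          simpa [RamExpr.eval, hxi, h5] using hne5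
        have hln : σ 6 i < n := (mem_supp.1 (hL.mem i hiT)).1
        refine Wp.ite ?_ ?_
        · intro hmark
          simp only [RamExpr.eval, hxi, h6] at hmark
          obtain ⟨u, hu, huT, hvu, hul⟩ := (hm _ hln).1 hmark
          refine Wp.store ⟨?_, ?_, (hF.upd (by simp) _ _).upd (by simp) _ _, ?_, ?_⟩
          · rw [upd_ne (by omega), hxi]
          · rw [upd_ne (by omega), h0]
          · intro l hl
            rw [upd_ne (by omega), upd_ne (by omega), hm l hl]
            constructor
            · rintro ⟨w, hw, h⟩
              exact ⟨w, by omega, h⟩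
            · rintro ⟨w, hw, h1, h2, h3⟩
              by_cases hwi : w = i
              · subst hwi
                exact ⟨u, hu, huT, hvu, hul.trans h3⟩
              · exact ⟨w, by omega, h1, h2, h3⟩
          · rw [upd_ne (by omega)]
            simp only [RamExpr.eval, upd_self]
            refine ⟨fun h => absurd h (by omega), fun h => absurd hul ?_⟩
            exact h u (by omega) i (by omega) huT hiT hvu hvi (by omega)
        · intro hmark
          simp only [RamExpr.eval, hxi, h6] at hmark
          have hnew : ∀ u < i, u ∈ supp n (σ 5) → G.Adj v u → σ 6 u ≠ σ 6 i := by
            intro u hu h1 h2 h3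
            exact (hm _ hln).2 ⟨u, hu, h1, h2, h3⟩ hmark
          refine Wp.store ⟨?_, ?_, (hF.upd (by simp) _ _).upd (by simp) _ _, ?_, ?_⟩
          · rw [upd_ne (by omega), hxi]
          · rw [upd_ne (by omega), h0]
          · intro l hl
            rw [upd_ne (by omega)]
            simp only [RamExpr.eval, hxi, h6, upd_apply, true_and]
            split_ifs with hli
            · refine ⟨fun _ => ⟨i, by omega, hiT, hvi, hli.symm⟩, fun _ => by omega⟩
            · rw [hm l hl]
              constructor
              · rintro ⟨w, hw, h⟩
                exact ⟨w, by omega, h⟩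
              · rintro ⟨w, hw, h1, h2, h3⟩
                have : w ≠ i := by
                  rintro rfl
                  exact hli h3.symm
                exact ⟨w, by omega, h1, h2, h3⟩
          · rw [upd_ne (by omega), upd_ne (by omega), hb]
            constructor
            · intro h u hu w hw h1 h2 h3 h4 huw
              by_cases hui : u = i
              · subst hui
                exact (hnew w (by omega) h2 h4).symm
              · by_cases hwi : w = i
                · subst hwi
                  exact hnew u (by omega) h1 h3
                · exact h u (by omega) w (by omega) h1 h2 h3 h4 huw
            · intro h u hu w hw
              exact h u (by omega) w (by omega)
      · intro he5
        refine hskip ?_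
        rintro ⟨h, -⟩
        refine (mem_supp.1 h).2 ?_
        simpa [RamExpr.eval, hxi, h5] using he5
    · intro he
      refine hskip ?_
      rintro ⟨-, h⟩
      rw [hadj, if_pos h] at he
      omega
  · rintro τ ⟨hF, hm, hb⟩
    have hlt : ∀ u ∈ supp n (σ 5), u < n := fun u hu => (mem_supp.1 hu).1
    refine ⟨hF, ?_, ?_⟩
    · intro l hl
      rw [hm l hl]
      exact ⟨fun ⟨u, _, h1, h2⟩ => ⟨u, h1, h2⟩, fun ⟨u, h1, h2⟩ => ⟨u, hlt u h1, h1, h2⟩⟩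
    · rw [hb]
      exact ⟨fun h u hu w hw => h u (hlt u hu) w (hlt w hw) hu hw,
        fun h u _ w _ hu hw => h u hu w hw⟩

theorem wp_relabel {N n : ℕ} {σ : RamMemory} {v : ℕ} (hN : n ≤ N)
    (hC : σ 0 0 = n) (hv' : σ 31 0 = v) :
    Wp N relabel σ fun τ => Frame [6, 30] σ τ ∧
      ∀ u < n, τ 6 u = if σ 5 u ≠ 0 ∧ σ 7 (σ 6 u) ≠ 0 then v else σ 6 u := by
  refine Wp.forLoop hC hN (by omega) (fun i τ => Frame [6, 30] σ τ ∧
      ∀ u, τ 6 u = if u < i ∧ σ 5 u ≠ 0 ∧ σ 7 (σ 6 u) ≠ 0 then v else σ 6 u) ?_ ?_ ?_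
  · refine ⟨(Frame.refl _ σ).upd (by simp) _ _, ?_⟩
    intro u
    rw [upd_ne (by omega)]
    simp
  · rintro i hi τ ⟨hF, h6⟩ hxi h0
    have h5 : τ 5 = σ 5 := hF 5 (by simp)
    have h7 : τ 7 = σ 7 := hF 7 (by simp)
    have h6i : τ 6 i = σ 6 i := by rw [h6 i]; simp
    have hskip : ¬ (σ 5 i ≠ 0 ∧ σ 7 (σ 6 i) ≠ 0) → Wp N .skip τ fun υ => υ 30 0 = i ∧ υ 0 0 = n ∧
        Frame [6, 30] σ (upd υ 30 0 (i + 1)) ∧ ∀ u, upd υ 30 0 (i + 1) 6 u =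
          if u < i + 1 ∧ σ 5 u ≠ 0 ∧ σ 7 (σ 6 u) ≠ 0 then v else σ 6 u := by
      intro hno
      refine Wp.skip ⟨hxi, h0, hF.upd (by simp) _ _, ?_⟩
      intro u
      rw [upd_ne (by omega), h6 u]
      by_cases hui : u = i
      · subst hui
        simp [hno]
      · have : u < i ↔ u < i + 1 := by omega
        simp only [this]
    refine Wp.ite (fun h1 => Wp.ite (fun h2 => Wp.store ?_) (fun h2 => hskip ?_))
      (fun h1 => hskip ?_)
    · simp only [RamExpr.eval, hxi, h5, h7, h6i] at h1 h2
      have h31 : τ 31 0 = v := by rw [hF 31 (by simp), hv']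
      simp only [RamExpr.eval, hxi, h31]
      refine ⟨?_, ?_, (hF.upd (by simp) _ _).upd (by simp) _ _, ?_⟩
      · rw [upd_ne (by omega), hxi]
      · rw [upd_ne (by omega), h0]
      · intro u
        rw [upd_ne (by omega)]
        by_cases hui : u = i
        · subst hui
          simp [h1, h2]
        · rw [upd_same hui, h6 u]
          have : u < i ↔ u < i + 1 := by omega
          simp only [this]
    · simp only [RamExpr.eval, hxi, h7, h6i] at h2
      exact fun h => h.2 h2
    · simp only [RamExpr.eval, hxi, h5] at h1
      exact fun h => h.1 h1
  · rintro τ ⟨hF, h6⟩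
    refine ⟨hF, fun u hu => ?_⟩
    rw [h6 u]
    simp [hu]

/-- The flag decides acyclicity by `acyc_insert`; giving all marked components the name of the new
vertex realises `reach_insert_iff`. -/
theorem wp_addVertex {N n : ℕ} {G : SimpleGraph ℕ} {σ : RamMemory} {v : ℕ} (hN : n ≤ N)
    (hC : Ctx n G σ) (hL : Lab n G σ) (hv : v < n) (hv' : σ 31 0 = v) (hvT : v ∉ supp n (σ 5)) :
    Wp N addVertex σ fun τ => Frame [5, 6, 7, 25, 30] σ τ ∧ Lab n G τ ∧
      ((supp n (τ 5) = insert v (supp n (σ 5))) ∨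
        (supp n (τ 5) = supp n (σ 5) ∧ ¬ Acyc G (insert v (supp n (σ 5) : Set ℕ)))) := by
  classical
  refine Wp.seq ((wp_scanNeighbours hN hC hL hv hv').mono ?_)
  rintro τ₁ ⟨hF₁, hm, hb⟩
  have h51 : τ₁ 5 = σ 5 := hF₁ 5 (by simp)
  have h61 : τ₁ 6 = σ 6 := hF₁ 6 (by simp)
  refine Wp.ite ?_ ?_
  · intro hbad
    have hbad : τ₁ 25 0 ≠ 0 := hbad
    refine Wp.skip ⟨hF₁.mono (by simp), ?_, Or.inr ⟨by rw [h51], ?_⟩⟩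
    · refine ⟨?_, ?_, ?_, ?_⟩
      · rw [h51]; exact hL.acyc
      · rw [h51, h61]; exact hL.mem
      · rw [h51, h61]; exact hL.iff
      · rw [h51]; exact hL.le_one
    · rw [acyc_insert hvT]
      rintro ⟨-, h⟩
      refine hbad (hb.2 ?_)
      intro u hu w hw e1 e2 huw heq
      exact h u hu w hw e1 e2 huw ((hL.iff u hu w hw).1 heq)
  · intro hgood
    have hgood := hb.1 hgood
    have hC₁ := hC.frame hF₁ (by simp)
    have h311 : τ₁ 31 0 = v := by rw [hF₁ 31 (by simp), hv']
    refine Wp.seq ((wp_relabel hN hC₁.size h311).mono ?_)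
    rintro τ₂ ⟨hF₂, h6⟩
    have h312 : τ₂ 31 0 = v := by rw [hF₂ 31 (by simp), h311]
    refine Wp.seq (Wp.store (Wp.store ?_))
    simp only [RamExpr.eval, h312]
    rw [upd_ne (show (31 : ℕ) ≠ 5 by omega), h312]
    set τ := upd (upd τ₂ 5 v 1) 6 v v with hτ
    have h52 : τ₂ 5 = σ 5 := (hF₂ 5 (by simp)).trans h51
    have hT : supp n (τ 5) = insert v (supp n (σ 5)) := by
      rw [hτ, upd_ne (by omega), supp_upd hv (by omega), h52]
    have hTc : (supp n (τ 5) : Set ℕ) = insert v (supp n (σ 5) : Set ℕ) := by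
      rw [hT]; simp
    have hlab : ∀ u ∈ supp n (σ 5),
        τ 6 u = if Touches G (supp n (σ 5) : Set ℕ) v u then v else σ 6 u := by
      intro u hu
      have huv : u ≠ v := fun h => hvT (h ▸ hu)
      have hun := mem_supp.1 hu
      rw [hτ, upd_same huv, upd_ne (by omega), h6 u hun.1, h51, h61]
      have : (σ 5 u ≠ 0 ∧ τ₁ 7 (σ 6 u) ≠ 0) ↔ Touches G (supp n (σ 5) : Set ℕ) v u := by
        rw [hm _ (mem_supp.1 (hL.mem u hu)).1]
        constructor
        · rintro ⟨-, y, hy, e, hyu⟩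
          exact Or.inr ⟨y, hy, e.symm, (hL.iff u hu y hy).1 hyu.symm⟩
        · rintro (h | ⟨y, hy, e, hr⟩)
          · exact absurd h huv
          · exact ⟨hun.2, y, hy, e.symm, ((hL.iff u hu y hy).2 hr).symm⟩
      simp only [this]
    have hlabv : τ 6 v = v := by simp [hτ]
    have hac : Acyc G (supp n (τ 5) : Set ℕ) := by
      rw [hTc, acyc_insert hvT]
      exact ⟨hL.acyc, fun u hu w hw e1 e2 huw hr =>
        hgood u hu w hw e1 e2 huw ((hL.iff u hu w hw).2 hr)⟩
    -- Old names are vertices of the old forest, so `v` is a fresh name.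
    have hne : ∀ u ∈ supp n (σ 5), σ 6 u ≠ v := fun u hu h => hvT (h ▸ hL.mem u hu)
    have htrans : ∀ u w, Touches G (supp n (σ 5) : Set ℕ) v u → u ∈ supp n (σ 5) →
        Reach G (supp n (σ 5) : Set ℕ) u w → Touches G (supp n (σ 5) : Set ℕ) v w := by
      rintro u w (h | ⟨y, hy, e, hr⟩) hu hr'
      · exact absurd (h ▸ hu) hvT
      · exact Or.inr ⟨y, hy, e, hr'.symm.trans hr⟩
    refine ⟨?_, ⟨hac, ?_, ?_, ?_⟩, Or.inl hT⟩
    · refine ((hF₁.mono ?_).trans hF₂ ?_).upd (by simp) _ _ |>.upd (by simp) _ _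
      · simp
      · simp
    · intro u hu
      rw [hT] at hu ⊢
      rcases Finset.mem_insert.1 hu with rfl | hu
      · rw [hlabv]
        exact Finset.mem_insert_self _ _
      · rw [hlab u hu]
        split_ifs
        · exact Finset.mem_insert_self _ _
        · exact Finset.mem_insert_of_mem (hL.mem u hu)
    · have hall : ∀ u ∈ supp n (τ 5),
          τ 6 u = if Touches G (supp n (σ 5) : Set ℕ) v u then v else σ 6 u := by
        intro u hu
        rw [hT] at hu
        rcases Finset.mem_insert.1 hu with rfl | hu
        · have : Touches G (supp n (σ 5) : Set ℕ) u u := Or.inl rfl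
          rw [hlabv, if_pos this]
        · exact hlab u hu
      have hin : ∀ u ∈ supp n (τ 5), ¬ Touches G (supp n (σ 5) : Set ℕ) v u →
          u ∈ supp n (σ 5) := by
        intro u hu hn
        rw [hT] at hu
        rcases Finset.mem_insert.1 hu with rfl | hu
        · exact absurd (Or.inl rfl) hn
        · exact hu
      intro u hu w hw
      rw [hall u hu, hall w hw, hTc, reach_insert_iff hvT]
      by_cases h1 : Touches G (supp n (σ 5) : Set ℕ) v u
      · by_cases h2 : Touches G (supp n (σ 5) : Set ℕ) v w
        · simp [h1, h2]
        · have hw' := hin w hw h2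
          simp only [h1, h2, if_true, if_false, and_false, or_false]
          refine ⟨fun h => absurd h.symm (hne w hw'), fun h => ?_⟩
          by_cases huv : u = v
          · subst huv
            by_cases huw : u = w
            · exact absurd (huw ▸ hw') hvT
            · exact absurd (h.mem_left huw) hvT
          · have hu' : u ∈ supp n (σ 5) := by
              rw [hT] at hu
              exact (Finset.mem_insert.1 hu).resolve_left huv
            exact absurd (htrans u w h1 hu' h) h2
      · have hu' := hin u hu h1
        by_cases h2 : Touches G (supp n (σ 5) : Set ℕ) v w
        · simp only [h1, h2, if_true, if_false, and_true, or_false]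
          refine ⟨fun h => absurd h (hne u hu'), fun h => ?_⟩
          by_cases hwv : w = v
          · subst hwv
            exact absurd (h.symm.mem_of_mem hu') hvT
          · have hw' : w ∈ supp n (σ 5) := by
              rw [hT] at hw
              exact (Finset.mem_insert.1 hw).resolve_left hwv
            exact absurd (htrans w u h2 hw' h.symm) h1
        · have hw' := hin w hw h2
          simp only [h1, h2, if_false, and_false, or_false]
          exact hL.iff u hu' w hw'
    · intro u hu
      rw [hτ, upd_ne (by omega), upd_apply, h52]
      split_ifs
      · exact le_rfl
      · exact hL.le_one u hu

/-- Adds the vertices with a nonzero entry in array `A` one by one, as long as no cycle arises. -/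
def greedyPass (A : ℕ) : RamProgram :=
  forLoop 31 0 <| .ite (.load A (sc 31)) (.ite (.load 5 (sc 31)) .skip addVertex) .skip

/-- One pass suffices: the forest only grows, so a vertex once rejected still closes a cycle at the
end. -/
theorem wp_greedyPass {N n : ℕ} {G : SimpleGraph ℕ} {σ : RamMemory} {A : ℕ} (hN : n ≤ N)
    (hA : A ∉ [5, 6, 7, 25, 30, 31]) (hC : Ctx n G σ) (hL : Lab n G σ) :
    Wp N (greedyPass A) σ fun τ => Frame [5, 6, 7, 25, 30, 31] σ τ ∧ Lab n G τ ∧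
      supp n (σ 5) ⊆ supp n (τ 5) ∧ supp n (τ 5) ⊆ supp n (σ 5) ∪ supp n (σ A) ∧
      ∀ v ∈ supp n (σ A), v ∉ supp n (τ 5) → ¬ Acyc G (insert v (supp n (τ 5) : Set ℕ)) := by
  refine Wp.forLoop hC.size hN (by omega) (fun i τ => Frame [5, 6, 7, 25, 30, 31] σ τ ∧ Lab n G τ ∧
      supp n (σ 5) ⊆ supp n (τ 5) ∧ supp n (τ 5) ⊆ supp n (σ 5) ∪ supp n (σ A) ∧
      ∀ v ∈ supp n (σ A), v < i → v ∉ supp n (τ 5) →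
        ¬ Acyc G (insert v (supp n (τ 5) : Set ℕ))) ?_ ?_ ?_
  · have h5 : upd σ 31 0 0 5 = σ 5 := upd_ne (by omega) _ _ _
    have h6 : upd σ 31 0 0 6 = σ 6 := upd_ne (by omega) _ _ _
    refine ⟨(Frame.refl _ σ).upd (by simp) _ _, ⟨?_, ?_, ?_, ?_⟩, ?_, ?_, ?_⟩
    · rw [h5]; exact hL.acyc
    · rw [h5, h6]; exact hL.mem
    · rw [h5, h6]; exact hL.iff
    · rw [h5]; exact hL.le_one
    · rw [h5]
    · rw [h5]; exact Finset.subset_union_left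
    · intro v _ h
      omega
  · rintro i hi τ ⟨hF, hLτ, hs1, hs2, hmax⟩ hxi h0
    have hA' : τ A = σ A := hF A hA
    have fin : ∀ υ, Frame [5, 6, 7, 25, 30] τ υ → Lab n G υ → supp n (τ 5) ⊆ supp n (υ 5) →
        supp n (υ 5) ⊆ supp n (σ 5) ∪ supp n (σ A) →
        (i ∈ supp n (σ A) → i ∉ supp n (υ 5) → ¬ Acyc G (insert i (supp n (υ 5) : Set ℕ))) →
        υ 31 0 = i ∧ υ 0 0 = n ∧ Frame [5, 6, 7, 25, 30, 31] σ (upd υ 31 0 (i + 1)) ∧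
        Lab n G (upd υ 31 0 (i + 1)) ∧ supp n (σ 5) ⊆ supp n (upd υ 31 0 (i + 1) 5) ∧
        supp n (upd υ 31 0 (i + 1) 5) ⊆ supp n (σ 5) ∪ supp n (σ A) ∧
        ∀ v ∈ supp n (σ A), v < i + 1 → v ∉ supp n (upd υ 31 0 (i + 1) 5) →
          ¬ Acyc G (insert v (supp n (upd υ 31 0 (i + 1) 5) : Set ℕ)) := by
      intro υ hFυ hLυ h1 h2 h3
      have h5 : upd υ 31 0 (i + 1) 5 = υ 5 := upd_ne (by omega) _ _ _
      have h6 : upd υ 31 0 (i + 1) 6 = υ 6 := upd_ne (by omega) _ _ _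
      refine ⟨by rw [hFυ 31 (by simp), hxi], by rw [hFυ 0 (by simp), h0],
        (hF.trans hFυ (by simp)).upd (by simp) _ _, ⟨?_, ?_, ?_, ?_⟩, ?_, ?_, ?_⟩
      · rw [h5]; exact hLυ.acyc
      · rw [h5, h6]; exact hLυ.mem
      · rw [h5, h6]; exact hLυ.iff
      · rw [h5]; exact hLυ.le_one
      · rw [h5]; exact hs1.trans h1
      · rw [h5]; exact h2
      · rw [h5]
        intro v hv hvi hvn hac
        by_cases h : v = i
        · subst h
          exact h3 hv hvn hac
        · exact hmax v hv (by omega) (fun h => hvn (h1 h))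
            (hac.mono (Set.insert_subset_insert h1))
    refine Wp.ite (fun hAi => Wp.ite (fun h5i => Wp.skip ?_) fun h5i => ?_) fun hAi => Wp.skip ?_
    · simp only [RamExpr.eval, hxi] at h5i
      exact fin τ (Frame.refl _ τ) hLτ subset_rfl hs2 fun _ h => absurd (mem_supp.2 ⟨hi, h5i⟩) h
    · simp only [RamExpr.eval, hxi, hA'] at h5i hAi
      have hiT : i ∉ supp n (τ 5) := fun h => (mem_supp.1 h).2 h5i
      refine (wp_addVertex hN (hC.frame hF (by simp)) hLτ hi hxi hiT).mono ?_
      rintro υ ⟨hFυ, hLυ, h | ⟨h, hno⟩⟩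
      · refine fin υ hFυ hLυ (by rw [h]; exact Finset.subset_insert _ _) ?_ ?_
        · rw [h]
          intro x hx
          rcases Finset.mem_insert.1 hx with rfl | hx
          · exact Finset.mem_union_right _ (mem_supp.2 ⟨hi, hAi⟩)
          · exact hs2 hx
        · intro _ hn
          rw [h] at hn
          exact absurd (Finset.mem_insert_self _ _) hn
      · exact fin υ hFυ hLυ (by rw [h]) (by rw [h]; exact hs2) (by rw [h]; exact fun _ _ => hno)
    · simp only [RamExpr.eval, hxi, hA'] at hAi
      exact fin τ (Frame.refl _ τ) hLτ subset_rfl hs2 fun h => absurd hAi (mem_supp.1 h).2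
  · rintro τ ⟨hF, hLτ, hs1, hs2, hmax⟩
    exact ⟨hF, hLτ, hs1, hs2, fun v hv => hmax v hv (mem_supp.1 hv).1⟩

/-- `T` is a maximal induced forest of `G` on the vertices below `n`. -/
structure MaxForest (n : ℕ) (G : SimpleGraph ℕ) (T : Finset ℕ) : Prop where
  subset : T ⊆ Finset.range n
  acyc : Acyc G (T : Set ℕ)
  maximal : ∀ v < n, v ∉ T → ¬ Acyc G (insert v (T : Set ℕ))

/-- Array `2` holds the complement of a maximal forest, and `23` its size. -/
def Recorded (n : ℕ) (G : SimpleGraph ℕ) (σ : RamMemory) : Prop :=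
  σ 23 0 = (supp n (σ 2)).card ∧ MaxForest n G (Finset.range n \ supp n (σ 2))

/-- Empties the forest. -/
def clearForest : RamProgram := tabulate 5 30 (.const 0)

theorem lab_of_zero {n : ℕ} {G : SimpleGraph ℕ} {σ : RamMemory} (h : ∀ u < n, σ 5 u = 0) :
    Lab n G σ ∧ supp n (σ 5) = ∅ := by
  have h0 : supp n (σ 5) = ∅ := by
    rw [Finset.eq_empty_iff_forall_notMem]
    intro u hu
    exact (mem_supp.1 hu).2 (h u (mem_supp.1 hu).1)
  refine ⟨⟨?_, ?_, ?_, ?_⟩, h0⟩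
  · rw [h0, Finset.coe_empty]
    exact acyc_empty
  · simp [h0]
  · simp [h0]
  · intro u hu
    rw [h u hu]
    omega

theorem wp_clearForest {N n : ℕ} {G : SimpleGraph ℕ} {σ : RamMemory} (hN : n ≤ N)
    (hC : Ctx n G σ) :
    Wp N clearForest σ fun τ => Frame [5, 30] σ τ ∧ Lab n G τ ∧ supp n (τ 5) = ∅ :=
  (Wp.tabulate hC.size hN (by omega) (by omega) (by omega) (fun _ => 0)
    (fun _ _ _ _ _ => rfl)).mono fun _ h => ⟨h.1, lab_of_zero h.2⟩

/-- Compares the complement of the forest with the best solution so far. -/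
def record : RamProgram :=
  .seq (.store 24 (.const 0) (.const 0)) <|
  .seq (accumulate 24 30 0 (.sub (.const 1) (.load 5 (sc 30)))) <|
  .ite (.sub (.add (sc 24) (.const 1)) (sc 23))
    (.seq (tabulate 2 30 (.sub (.const 1) (.load 5 (sc 30)))) (.store 23 (.const 0) (sc 24))) .skip

/-- The alternative `σ 23 0 = 0` covers the first call, when nothing has been recorded. -/
theorem wp_record {N n : ℕ} {G : SimpleGraph ℕ} {σ : RamMemory} (hN : n ≤ N)
    (hC : Ctx n G σ) (hL : Lab n G σ) (hT : MaxForest n G (supp n (σ 5)))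
    (hR : σ 23 0 = 0 ∨ Recorded n G σ) :
    Wp N record σ fun τ => Frame [2, 23, 24, 30] σ τ ∧ Recorded n G τ ∧
      σ 23 0 ≤ τ 23 0 ∧ (Finset.range n \ supp n (σ 5)).card ≤ τ 23 0 := by
  refine Wp.seq (Wp.store ?_)
  simp only [RamExpr.eval]
  set σ₁ := upd σ 24 0 0 with hσ₁
  have hF₁ : Frame [2, 23, 24, 30] σ σ₁ := (Frame.refl _ σ).upd (by simp) _ _
  have heval : ∀ τ : RamMemory, τ 5 = σ 5 → ∀ u, τ 30 0 = u →
      (RamExpr.sub (.const 1) (.load 5 (sc 30))).eval τ = 1 - σ 5 u := by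
    intro τ h u hu
    simp [RamExpr.eval, h, hu]
  have h51 : σ₁ 5 = σ 5 := hF₁ 5 (by simp)
  have h01 : σ₁ 0 0 = n := by rw [hF₁ 0 (by simp), hC.size]
  refine Wp.seq ((Wp.accumulate h01 hN (by omega) (by omega) (by omega) (fun u => 1 - σ 5 u)
    (fun u _ τ hF hu => heval τ (by rw [hF 5 (by simp), h51]) u hu)).mono ?_)
  rintro τ ⟨hFτ, hsum⟩
  have hF₂ : Frame [2, 23, 24, 30] σ τ := hF₁.trans hFτ (by simp)
  have hcompl : ∀ f : ℕ → ℕ, (∀ u < n, f u = 1 - σ 5 u) →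
      supp n f = Finset.range n \ supp n (σ 5) := by
    intro f hf
    ext u
    simp only [mem_supp, Finset.mem_sdiff, Finset.mem_range]
    constructor
    · rintro ⟨hu, h⟩
      rw [hf u hu] at h
      exact ⟨hu, fun h' => by omega⟩
    · rintro ⟨hu, h⟩
      refine ⟨hu, ?_⟩
      rw [hf u hu]
      have : σ 5 u = 0 := by
        by_contra h'
        exact h ⟨hu, h'⟩
      omega
  have hcard : τ 24 0 = (Finset.range n \ supp n (σ 5)).card := by
    rw [hsum, ← hcompl (fun u => 1 - σ 5 u) (fun _ _ => rfl), supp, Finset.card_filter]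
    simp only [hσ₁, upd_self, zero_add]
    refine Finset.sum_congr rfl fun u hu => ?_
    have := hL.le_one u (Finset.mem_range.1 hu)
    split_ifs <;> omega
  have h23 : τ 23 0 = σ 23 0 := by
    rw [hFτ 23 (by simp), hσ₁, upd_ne (by omega)]
  refine Wp.ite ?_ ?_
  · intro hc
    simp only [RamExpr.eval, h23] at hc
    have h0τ : τ 0 0 = n := by rw [hFτ 0 (by simp), h01]
    refine Wp.seq ((Wp.tabulate h0τ hN (by omega) (by omega) (by omega) (fun u => 1 - σ 5 u)
      (fun u _ υ hF hu => heval υ (by rw [hF 5 (by simp), hF₂ 5 (by simp)]) u hu)).mono ?_)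
    rintro υ ⟨hFυ, h2⟩
    refine Wp.store ?_
    have h24 : υ 24 0 = τ 24 0 := by rw [hFυ 24 (by simp)]
    simp only [RamExpr.eval, h24]
    have hsupp := hcompl (υ 2) h2
    refine ⟨(hF₂.trans hFυ (by simp)).upd (by simp) _ _, ?_, ?_, ?_⟩
    · unfold Recorded
      rw [upd_self, upd_ne (show (2 : ℕ) ≠ 23 by omega), hsupp, hcard,
        Finset.sdiff_sdiff_eq_self hT.subset]
      exact ⟨rfl, hT⟩
    · rw [upd_self]
      omega
    · rw [upd_self, hcard]
  · intro hc
    simp only [RamExpr.eval, h23] at hc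
    refine Wp.skip ⟨hF₂, ?_, h23.ge, by omega⟩
    -- The comparison is not strict: a solution is replaced by one of equal size. Hence the first
    -- solution is stored even if it is empty, and nothing is stored only when the old size is
    -- positive.
    have hrec := hR.resolve_left (by omega)
    have h2 : τ 2 = σ 2 := by rw [hFτ 2 (by simp), hσ₁, upd_ne (by omega)]
    unfold Recorded
    rw [h23, h2]
    exact hrec

/-- Builds a maximal forest, trying first the vertices in `9`, then those in `13`, and records it. -/
def tryClass : RamProgram :=
  .seq clearForest <| .seq (greedyPass 9) <| .seq (greedyPass 13) <| .seq (greedyPass 4) record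

theorem supp_ones {n : ℕ} {f : ℕ → ℕ} (h : ∀ u < n, f u = 1) : supp n f = Finset.range n := by
  ext u
  simp only [mem_supp, Finset.mem_range]
  exact ⟨fun h' => h'.1, fun hu => ⟨hu, by rw [h u hu]; omega⟩⟩

/-- A greedy pass adds everything if the result would be a forest. -/
theorem union_subset_of_acyc {G : SimpleGraph ℕ} {S A T : Finset ℕ} (hS : S ⊆ T) (hT : T ⊆ S ∪ A)
    (hm : ∀ v ∈ A, v ∉ T → ¬ Acyc G (insert v (T : Set ℕ))) (hac : Acyc G (S ∪ A : Set ℕ)) :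
    T = S ∪ A := by
  refine Finset.Subset.antisymm hT (Finset.union_subset hS ?_)
  intro v hv
  by_contra hvT
  refine hm v hv hvT (hac.mono ?_)
  intro x hx
  rcases hx with rfl | hx
  · exact Or.inr hv
  · simpa using hT hx

/-- Array `4` contains only ones, so the last pass tries every vertex and makes the forest maximal.
-/
theorem wp_fillAndRecord {N n : ℕ} {G : SimpleGraph ℕ} {σ : RamMemory} (hN : n ≤ N)
    (hC : Ctx n G σ) (hL : Lab n G σ) (hR : σ 23 0 = 0 ∨ Recorded n G σ) :
    Wp N (.seq (greedyPass 4) record) σ fun τ =>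
      Frame [2, 5, 6, 7, 23, 24, 25, 30, 31] σ τ ∧ Recorded n G τ ∧ σ 23 0 ≤ τ 23 0 ∧
      Lab n G τ ∧ MaxForest n G (supp n (τ 5)) ∧ supp n (σ 5) ⊆ supp n (τ 5) ∧
      (Finset.range n \ supp n (τ 5)).card ≤ τ 23 0 := by
  refine Wp.seq ((wp_greedyPass hN (by simp) hC hL).mono ?_)
  rintro τ ⟨hF, hLτ, h1, h2, h3⟩
  rw [supp_ones hC.ones] at h2 h3
  have hM : MaxForest n G (supp n (τ 5)) :=
    ⟨supp_subset _ _, hLτ.acyc, fun v hv => h3 v (Finset.mem_range.2 hv)⟩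
  have e23 : τ 23 = σ 23 := hF 23 (by simp)
  have e2 : τ 2 = σ 2 := hF 2 (by simp)
  refine (wp_record hN (hC.frame hF (by simp)) hLτ hM ?_).mono ?_
  · unfold Recorded
    rw [e23, e2]
    exact hR
  · rintro υ ⟨hFυ, hRυ, h4, h5⟩
    have e5 : υ 5 = τ 5 := hFυ 5 (by simp)
    have e6 : υ 6 = τ 6 := hFυ 6 (by simp)
    refine ⟨(hF.mono (by simp)).trans hFυ (by simp), hRυ, by rw [← e23]; exact h4,
      ⟨?_, ?_, ?_, ?_⟩, ?_, ?_, ?_⟩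
    · rw [e5]; exact hLτ.acyc
    · rw [e5, e6]; exact hLτ.mem
    · rw [e5, e6]; exact hLτ.iff
    · rw [e5]; exact hLτ.le_one
    · rw [e5]; exact hM
    · rw [e5]; exact h1
    · rw [e5]; exact h5

/-- No test of acyclicity is needed beforehand. Greedy passes yield a valid solution in any case,
and if `Q` with the class is a forest, they accept all of it. -/
theorem wp_tryClass {N n : ℕ} {G : SimpleGraph ℕ} {σ : RamMemory} (hN : n ≤ N)
    (hC : Ctx n G σ) (hR : Recorded n G σ) :
    Wp N tryClass σ fun τ =>
      Frame [2, 5, 6, 7, 23, 24, 25, 30, 31] σ τ ∧ Recorded n G τ ∧ σ 23 0 ≤ τ 23 0 ∧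
      (Acyc G ((supp n (σ 9) : Set ℕ) ∪ (supp n (σ 13) : Set ℕ)) →
        ∃ T : Finset ℕ, Acyc G (T : Set ℕ) ∧ supp n (σ 9) ⊆ T ∧ supp n (σ 13) ⊆ T ∧
          (Finset.range n \ T).card ≤ τ 23 0) := by
  refine Wp.seq ((wp_clearForest hN hC).mono ?_)
  rintro τ₁ ⟨hF₁, hL₁, h₁⟩
  refine Wp.seq ((wp_greedyPass hN (by simp) (hC.frame hF₁ (by simp)) hL₁).mono ?_)
  rintro τ₂ ⟨hF₂', hL₂, a₁, a₂, a₃⟩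
  have hF₂ : Frame [2, 5, 6, 7, 23, 24, 25, 30, 31] σ τ₂ :=
    (hF₁.mono (by simp)).trans hF₂' (by simp)
  refine Wp.seq ((wp_greedyPass hN (by simp) (hC.frame hF₂ (by simp)) hL₂).mono ?_)
  rintro τ₃ ⟨hF₃', hL₃, b₁, b₂, b₃⟩
  have hF₃ : Frame [5, 6, 7, 25, 30, 31] σ τ₃ :=
    ((hF₁.mono (by simp)).trans hF₂' (by simp)).trans hF₃' (by simp)
  have e23 : τ₃ 23 = σ 23 := hF₃ 23 (by simp)
  have e2 : τ₃ 2 = σ 2 := hF₃ 2 (by simp)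
  have hR₃ : Recorded n G τ₃ := by
    unfold Recorded
    rw [e23, e2]
    exact hR
  refine (wp_fillAndRecord hN (hC.frame hF₃ (by simp)) hL₃ (Or.inr hR₃)).mono ?_
  rintro υ ⟨hFυ, hRυ, c₁, hLυ, hM, c₂, c₃⟩
  refine ⟨(hF₃.mono (by simp)).trans hFυ (by simp), hRυ, by rw [← e23]; exact c₁, fun hac => ?_⟩
  rw [hF₁ 9 (by simp)] at a₂ a₃
  rw [h₁] at a₁ a₂
  have e := union_subset_of_acyc a₁ a₂ a₃ (hac.mono (by simp))
  rw [Finset.empty_union] at e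
  rw [hF₂ 13 (by simp)] at b₂ b₃
  rw [e] at b₁ b₂
  have e' := union_subset_of_acyc b₁ b₂ b₃ hac
  rw [e'] at c₂
  exact ⟨_, hM.acyc, Finset.subset_union_left.trans c₂, Finset.subset_union_right.trans c₂, c₃⟩

/-! ### Weights, light part and colouring on the machine -/

/-- Counts for every vertex its neighbours in the set kept in `9`. -/
def computeWeights : RamProgram :=
  forLoop 36 0 <| .seq (.store 26 (.const 0) (.const 0)) <|
    .seq (accumulate 26 30 0 (.sub (.add (adjE 36 30) (.load 9 (sc 30))) (.const 1)))
      (.store 10 (sc 36) (sc 26))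

theorem wp_computeWeights {N n : ℕ} {G : SimpleGraph ℕ} {σ : RamMemory} (hN : n ≤ N)
    (hC : Ctx n G σ) (h9 : ∀ u < n, σ 9 u ≤ 1) :
    Wp N computeWeights σ fun τ => Frame [10, 26, 30, 36] σ τ ∧
      ∀ u < n, τ 10 u = wt G (supp n (σ 9)) u := by
  classical
  refine Wp.forLoop hC.size hN (by omega) (fun i τ => Frame [10, 26, 30, 36] σ τ ∧
      ∀ u < i, τ 10 u = wt G (supp n (σ 9)) u) ?_ ?_ ?_
  · exact ⟨(Frame.refl _ σ).upd (by simp) _ _, fun u hu => by omega⟩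
  · rintro i hi τ ⟨hF, hw⟩ hxi h0
    refine Wp.seq (Wp.store ?_)
    simp only [RamExpr.eval]
    have hF₁ : Frame [10, 26, 30, 36] σ (upd τ 26 0 0) := hF.upd (by simp) _ _
    set τ₁ := upd τ 26 0 0 with hτ₁
    have hx₁ : τ₁ 36 0 = i := by rw [hτ₁, upd_ne (by omega), hxi]
    have h₁0 : τ₁ 0 0 = n := by rw [hτ₁, upd_ne (by omega), h0]
    -- For values `0` and `1`, the truncated difference `a + b - 1` is the conjunction.
    refine Wp.seq ((Wp.accumulate h₁0 hN (by omega) (by omega) (by omega)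
      (fun v => if G.Adj i v ∧ σ 9 v ≠ 0 then 1 else 0) ?_).mono ?_)
    · intro v hv υ hFυ hυ
      have hF₂ : Frame [10, 26, 30, 36] σ υ := hF₁.trans hFυ (by simp)
      have e := (hC.frame hF₂ (by simp)).adjE_eval (show υ 36 0 = i by
        rw [hFυ 36 (by simp), hx₁]) hυ hi hv
      simp only [RamExpr.eval, e, hυ, hF₂ 9 (by simp)]
      have := h9 v hv
      by_cases h1 : G.Adj i v
      · by_cases h2 : σ 9 v = 0
        · simp [h1, h2]
        · have : σ 9 v = 1 := by omega
          simp [h1, this]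
      · simp only [h1, if_false, false_and]
        omega
    · rintro υ ⟨hFυ, hsum⟩
      have hF₂ : Frame [10, 26, 30, 36] σ υ := hF₁.trans hFυ (by simp)
      have hxυ : υ 36 0 = i := by rw [hFυ 36 (by simp), hx₁]
      refine Wp.store ?_
      simp only [RamExpr.eval, hxυ]
      refine ⟨?_, ?_, (hF₂.upd (by simp) _ _).upd (by simp) _ _, ?_⟩
      · rw [upd_ne (by omega), hxυ]
      · rw [upd_ne (by omega), hFυ 0 (by simp), h₁0]
      · intro u hu
        rw [upd_ne (by omega)]
        by_cases hui : u = i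
        · subst hui
          rw [upd_self, hsum, hτ₁, upd_self, zero_add, ← Finset.card_filter, wt]
          congr 1
          ext w
          simp only [Finset.mem_filter, Finset.mem_range, mem_supp]
          tauto
        · rw [upd_same hui, hFυ 10 (by simp), hτ₁, upd_ne (by omega), hw u (by omega)]
  · exact fun τ h => h

/-- Computes the light part of the forest in `8` with respect to the set in `9`. -/
def computeLight : RamProgram :=
  tabulate 11 30 (.sub (.sub (.load 8 (sc 30)) (.load 9 (sc 30)))
    (.sub (.load 10 (sc 30)) (.const 1)))

/-- As the entries of `8` are at most one, the truncated difference is nonzero only if nothing is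
subtracted, that is, outside `Q` and with weight at most one. -/
theorem wp_computeLight {N n : ℕ} {G : SimpleGraph ℕ} {σ : RamMemory} (hN : n ≤ N)
    (hC : Ctx n G σ) (h9 : ∀ u < n, σ 9 u ≤ 1) (h8 : ∀ u < n, σ 8 u ≤ 1)
    (h10 : ∀ u < n, σ 10 u = wt G (supp n (σ 9)) u) :
    Wp N computeLight σ fun τ => Frame [11, 30] σ τ ∧
      supp n (τ 11) = lightPart G (supp n (σ 8)) (supp n (σ 9)) := by
  refine (Wp.tabulate hC.size hN (by omega) (by omega) (by omega)
    (fun u => σ 8 u - σ 9 u - (σ 10 u - 1)) ?_).mono ?_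
  · intro u hu τ hF hτ
    simp [RamExpr.eval, hτ, hF 8 (by simp), hF 9 (by simp), hF 10 (by simp)]
  · rintro τ ⟨hF, h⟩
    refine ⟨hF, ?_⟩
    ext u
    simp only [mem_supp, mem_lightPart]
    by_cases hu : u < n
    · rw [h u hu, ← h10 u hu]
      have := h8 u hu
      have := h9 u hu
      simp only [hu, true_and]
      omega
    · simp [hu]

/-- The context of the colouring: array `10` tells the tokens, array `11` the vertices to colour. -/
structure ColCtx (n : ℕ) (G : SimpleGraph ℕ) (L : Finset ℕ) (tok : ℕ → Prop) (σ : RamMemory) :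
    Prop where
  ctx : Ctx n G σ
  light : supp n (σ 11) = L
  tok : ∀ u < n, (σ 10 u ≠ 0 ↔ tok u)

theorem ColCtx.frame {n : ℕ} {G : SimpleGraph ℕ} {L : Finset ℕ} {tok : ℕ → Prop} {σ τ : RamMemory}
    {W : List ℕ} (h : ColCtx n G L tok σ) (hF : Frame W σ τ) (hW : ∀ a ∈ W, 12 ≤ a) :
    ColCtx n G L tok τ := by
  have e : ∀ a, a < 12 → τ a = σ a := fun a ha => hF a fun h => by have := hW a h; omega
  refine ⟨h.ctx.frame hF fun a ha => ?_, ?_, ?_⟩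
  · have := hW a ha
    omega
  · rw [e 11 (by omega)]; exact h.light
  · rw [e 10 (by omega)]; exact h.tok

/-- Array `12` holds a partial colouring. -/
def Coloured (n : ℕ) (G : SimpleGraph ℕ) (L : Finset ℕ) (tok : ℕ → Prop) (σ : RamMemory) : Prop :=
  ∃ col R, Coloring G (L : Set ℕ) tok col R ∧ ∀ u < n, σ 12 u = col u

/-- No edge leads from `C` to a vertex of `L` outside `C`. -/
def ClosedIn (G : SimpleGraph ℕ) (L C : Finset ℕ) : Prop :=
  ∀ u ∈ C, ∀ v ∈ L, G.Adj u v → v ∈ C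

/-- Colours the vertex in `39` from the vertex in `38` if possible. -/
def colourEdge : RamProgram :=
  .ite (adjE 38 39)
    (.ite (.load 12 (sc 38))
      (.ite (.load 11 (sc 39))
        (.ite (.load 12 (sc 39)) .skip
          (.ite (.load 10 (sc 39))
            (.store 12 (sc 39) (.sub (.const 3) (.load 12 (sc 38))))
            (.store 12 (sc 39) (.load 12 (sc 38))))) .skip) .skip) .skip

/-- Unlike `Coloring.inv`, this needs no forest, so the colouring program can be analysed without
that hypothesis. -/
theorem Coloring.mem {V : Type*} [DecidableEq V] {G : SimpleGraph V} {F : Set V} {tok : V → Prop}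
    {col : V → ℕ} {R : Set V} (h : Coloring G F tok col R) : ∀ v, col v ≠ 0 → v ∈ F := by
  induction h with
  | zero => simp
  | root _ _ htF _ _ ih =>
    intro v hv
    rw [Function.update_apply] at hv
    split_ifs at hv with h
    · rw [h]
      exact htF
    · exact ih v hv
  | grow_token _ _ _ hvF _ _ ih =>
    intro v hv
    rw [Function.update_apply] at hv
    split_ifs at hv with h
    · rw [h]
      exact hvF
    · exact ih v hv
  | grow _ _ _ hvF _ _ ih =>
    intro v hv
    rw [Function.update_apply] at hv
    split_ifs at hv with h
    · rw [h]
      exact hvF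
    · exact ih v hv

theorem Coloring.le_two {V : Type*} [DecidableEq V] {G : SimpleGraph V} {F : Set V} {tok : V → Prop}
    {col : V → ℕ} {R : Set V} (h : Coloring G F tok col R) : ∀ v, col v ≤ 2 := by
  induction h with
  | zero => simp
  | root _ _ _ _ _ ih =>
    intro v
    rw [Function.update_apply]
    split_ifs
    · omega
    · exact ih v
  | grow_token _ _ _ _ _ _ ih =>
    intro v
    rw [Function.update_apply]
    split_ifs
    · omega
    · exact ih v
  | grow _ _ _ _ _ _ ih =>
    intro v
    rw [Function.update_apply]
    split_ifs
    · exact ih _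
    · exact ih v

/-- The last clause says that only a part that is not yet closed can grow; it drives the progress
argument for `propagate`. -/
theorem wp_colourEdge {N n : ℕ} {G : SimpleGraph ℕ} {L : Finset ℕ} {tok : ℕ → Prop}
    {σ : RamMemory} {u v : ℕ} (hC : ColCtx n G L tok σ) (hK : Coloured n G L tok σ) (hu : u < n)
    (hv : v < n) (hu' : σ 38 0 = u) (hv' : σ 39 0 = v) :
    Wp N colourEdge σ fun τ => Frame [12] σ τ ∧ Coloured n G L tok τ ∧
      supp n (σ 12) ⊆ supp n (τ 12) ∧
      (u ∈ supp n (σ 12) → v ∈ L → G.Adj u v → v ∈ supp n (τ 12)) ∧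
      (ClosedIn G L (supp n (σ 12)) → supp n (τ 12) = supp n (σ 12)) := by
  classical
  have e := hC.ctx.adjE_eval hu' hv' hu hv
  have hmem : ∀ w < n, (σ 12 w ≠ 0 ↔ w ∈ supp n (σ 12)) := fun w hw => by simp [mem_supp, hw]
  have hL : σ 11 v ≠ 0 ↔ v ∈ L := by
    rw [← hC.light]
    simp [mem_supp, hv]
  have hskip : (u ∈ supp n (σ 12) → v ∈ L → G.Adj u v → v ∈ supp n (σ 12)) →
      Wp N .skip σ fun τ => Frame [12] σ τ ∧ Coloured n G L tok τ ∧
      supp n (σ 12) ⊆ supp n (τ 12) ∧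
      (u ∈ supp n (σ 12) → v ∈ L → G.Adj u v → v ∈ supp n (τ 12)) ∧
      (ClosedIn G L (supp n (σ 12)) → supp n (τ 12) = supp n (σ 12)) :=
    fun h => Wp.skip ⟨Frame.refl _ _, hK, subset_rfl, h, fun _ => rfl⟩
  refine Wp.ite (fun h1 => ?_) (fun h1 => hskip fun _ _ h => ?_)
  swap
  · rw [e, if_pos h] at h1
    omega
  have huv : G.Adj u v := by
    by_contra h
    rw [e, if_neg h] at h1
    exact h1 rfl
  refine Wp.ite (fun h2 => ?_) (fun h2 => hskip fun h _ _ => ?_)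
  swap
  · simp only [RamExpr.eval, hu'] at h2
    exact absurd h2 ((hmem u hu).2 h)
  refine Wp.ite (fun h3 => ?_) (fun h3 => hskip fun _ h _ => ?_)
  swap
  · simp only [RamExpr.eval, hv'] at h3
    exact absurd h3 (hL.2 h)
  refine Wp.ite (fun h4 => hskip fun _ _ _ => ?_) (fun h4 => ?_)
  · simp only [RamExpr.eval, hv'] at h4
    exact (hmem v hv).1 h4
  simp only [RamExpr.eval, hu', hv'] at h2 h3 h4
  obtain ⟨col, R, hcol, hagree⟩ := hK
  have hcu : col u ≠ 0 := hagree u hu ▸ h2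
  have hcv : col v = 0 := hagree v hv ▸ h4
  have hvL := hL.1 h3
  have fin : ∀ c, c ≠ 0 → Coloring G (L : Set ℕ) tok (Function.update col v c) R →
      Frame [12] σ (upd σ 12 v c) ∧ Coloured n G L tok (upd σ 12 v c) ∧
      supp n (σ 12) ⊆ supp n (upd σ 12 v c 12) ∧
      (u ∈ supp n (σ 12) → v ∈ L → G.Adj u v → v ∈ supp n (upd σ 12 v c 12)) ∧
      (ClosedIn G L (supp n (σ 12)) → supp n (upd σ 12 v c 12) = supp n (σ 12)) := by
    intro c hc hcol'
    rw [supp_upd hv hc]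
    refine ⟨(Frame.refl _ _).upd (by simp) _ _, ⟨_, R, hcol', ?_⟩, Finset.subset_insert _ _,
      fun _ _ _ => Finset.mem_insert_self _ _, fun hcl => ?_⟩
    · intro w hw
      simp only [upd_apply, true_and, Function.update_apply]
      split_ifs
      · rfl
      · exact hagree w hw
    · exact absurd h4 ((hmem v hv).2 (hcl u ((hmem u hu).1 h2) v hvL huv))
  refine Wp.ite (fun h5 => Wp.store ?_) (fun h5 => Wp.store ?_)
  · simp only [RamExpr.eval, hv'] at h5
    simp only [RamExpr.eval, hu', hv', hagree u hu]
    have := hcol.le_two u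
    exact fin _ (by omega) (hcol.grow_token hcu huv hvL hcv ((hC.tok v hv).1 h5))
  · simp only [RamExpr.eval, hv'] at h5
    simp only [RamExpr.eval, hu', hv', hagree u hu]
    exact fin _ hcu (hcol.grow hcu huv hvL hcv fun h => (hC.tok v hv).2 h h5)

/-- Tries to colour along each pair of vertices once. -/
def colourRound : RamProgram := forLoop 38 0 (forLoop 39 0 colourEdge)

/-- What a part of a colouring round achieves. -/
structure RoundInv (n : ℕ) (G : SimpleGraph ℕ) (L : Finset ℕ) (tok : ℕ → Prop) (σ τ : RamMemory)
    (P : ℕ → ℕ → Prop) : Prop where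
  frame : Frame [12, 38, 39] σ τ
  coloured : Coloured n G L tok τ
  mono : supp n (σ 12) ⊆ supp n (τ 12)
  edge : ∀ u v, P u v → u ∈ supp n (σ 12) → v ∈ L → G.Adj u v → v ∈ supp n (τ 12)
  closed : ClosedIn G L (supp n (σ 12)) → supp n (τ 12) = supp n (σ 12)

theorem RoundInv.upd {n : ℕ} {G : SimpleGraph ℕ} {L : Finset ℕ} {tok : ℕ → Prop} {σ τ : RamMemory}
    {P : ℕ → ℕ → Prop} (h : RoundInv n G L tok σ τ P) {a : ℕ} (ha : a = 38 ∨ a = 39) (i v : ℕ) :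
    RoundInv n G L tok σ (upd τ a i v) P := by
  have e : MaxMinFVS.upd τ a i v 12 = τ 12 := upd_ne (by omega) _ _ _
  refine ⟨h.frame.upd (by rcases ha with rfl | rfl <;> simp) _ _, ?_, ?_, ?_, ?_⟩
  · unfold Coloured
    rw [e]
    exact h.coloured
  · rw [e]; exact h.mono
  · rw [e]; exact h.edge
  · rw [e]; exact h.closed

theorem wp_colourRound {N n : ℕ} {G : SimpleGraph ℕ} {L : Finset ℕ} {tok : ℕ → Prop}
    {σ : RamMemory} (hN : n ≤ N) (hC : ColCtx n G L tok σ) (hK : Coloured n G L tok σ) :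
    Wp N colourRound σ fun τ => RoundInv n G L tok σ τ fun u v => u < n ∧ v < n := by
  refine Wp.forLoop hC.ctx.size hN (by omega)
    (fun i τ => RoundInv n G L tok σ τ fun u v => u < i ∧ v < n) ?_ ?_ ?_
  · exact RoundInv.upd ⟨Frame.refl _ _, hK, subset_rfl, fun u v h => by omega, fun _ => rfl⟩
      (by omega) _ _
  · intro i hi τ hI hxi h0
    refine Wp.forLoop h0 hN (by omega)
      (fun j τ => (RoundInv n G L tok σ τ fun u v => (u < i ∧ v < n) ∨ (u = i ∧ v < j)) ∧
        τ 38 0 = i) ?_ ?_ ?_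
    · refine ⟨RoundInv.upd ⟨hI.frame, hI.coloured, hI.mono, fun u v h => ?_, hI.closed⟩
        (by omega) _ _, ?_⟩
      · rcases h with h | h
        · exact hI.edge u v h
        · omega
      · rw [upd_ne (by omega), hxi]
    · rintro j hj τ' ⟨hJ, hxi'⟩ hxj h0'
      refine (wp_colourEdge (hC.frame hJ.frame (by simp)) hJ.coloured hi hj hxi' hxj).mono ?_
      rintro υ ⟨hF, hcol, hm, he, hc⟩
      refine ⟨?_, ?_, RoundInv.upd ⟨hJ.frame.trans hF (by simp), hcol, hJ.mono.trans hm, ?_, ?_⟩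
        (by omega) _ _, ?_⟩
      · rw [hF 39 (by simp), hxj]
      · rw [hF 0 (by simp), h0']
      · intro u v hP hu hv e
        by_cases h : u = i ∧ v = j
        · obtain ⟨rfl, rfl⟩ := h
          exact he (hJ.mono hu) hv e
        · exact hm (hJ.edge u v (by omega) hu hv e)
      · intro hcl
        have h1 := hJ.closed hcl
        rw [← h1] at hcl ⊢
        exact hc hcl
      · rw [upd_ne (by omega), hF 38 (by simp), hxi']
    · rintro τ' ⟨hJ, hxi'⟩
      refine ⟨hxi', ?_, RoundInv.upd ⟨hJ.frame, hJ.coloured, hJ.mono, fun u v h => ?_, hJ.closed⟩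
        (by omega) _ _⟩
      · rw [hJ.frame 0 (by simp)]
        exact hC.ctx.size
      · exact hJ.edge u v (by omega)
  · exact fun τ h => h

/-- Repeats the colouring round until no edge leaves the coloured part. -/
def propagate : RamProgram := forLoop 37 0 colourRound

/-- A round that colours nothing new shows that the coloured part is closed, and any other round
enlarges it. Starting from a nonempty part, `n` rounds without closure would colour more than `n`
vertices. -/
theorem wp_propagate {N n : ℕ} {G : SimpleGraph ℕ} {L : Finset ℕ} {tok : ℕ → Prop}
    {σ : RamMemory} (hN : n ≤ N) (hC : ColCtx n G L tok σ) (hK : Coloured n G L tok σ)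
    (hne : (supp n (σ 12)).Nonempty) :
    Wp N propagate σ fun τ => Frame [12, 37, 38, 39] σ τ ∧ Coloured n G L tok τ ∧
      supp n (σ 12) ⊆ supp n (τ 12) ∧ ClosedIn G L (supp n (τ 12)) := by
  refine Wp.forLoop hC.ctx.size hN (by omega)
    (fun i τ => Frame [12, 37, 38, 39] σ τ ∧ Coloured n G L tok τ ∧
      supp n (σ 12) ⊆ supp n (τ 12) ∧
      (ClosedIn G L (supp n (τ 12)) ∨ i + 1 ≤ (supp n (τ 12)).card)) ?_ ?_ ?_
  · have e : upd σ 37 0 0 12 = σ 12 := upd_ne (by omega) _ _ _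
    unfold Coloured
    rw [e]
    exact ⟨(Frame.refl _ _).upd (by simp) _ _, hK, subset_rfl,
      Or.inr (by have := Finset.card_pos.2 hne; omega)⟩
  · rintro i hi τ ⟨hF, hcol, hm, hcl⟩ hxi h0
    refine (wp_colourRound hN (hC.frame hF (by simp)) hcol).mono ?_
    intro υ hυ
    have e : upd υ 37 0 (i + 1) 12 = υ 12 := upd_ne (by omega) _ _ _
    refine ⟨?_, ?_, (hF.trans hυ.frame (by simp)).upd (by simp) _ _, ?_⟩
    · rw [hυ.frame 37 (by simp), hxi]
    · rw [hυ.frame 0 (by simp), h0]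
    · unfold Coloured
      rw [e]
      refine ⟨hυ.coloured, hm.trans hυ.mono, ?_⟩
      by_cases heq : supp n (υ 12) = supp n (τ 12)
      · left
        intro u hu v hv euv
        have hvn : v < n := by
          rw [← hC.light] at hv
          exact (mem_supp.1 hv).1
        exact hυ.edge u v ⟨(mem_supp.1 hu).1, hvn⟩ (heq ▸ hu) hv euv
      · have hncl := fun h => heq (hυ.closed h)
        have h1 := hcl.resolve_left hncl
        have h2 := Finset.card_lt_card (Finset.ssubset_iff_subset_ne.2 ⟨hυ.mono, Ne.symm heq⟩)
        exact Or.inr (by omega)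
  · rintro τ ⟨hF, hcol, hm, hcl⟩
    refine ⟨hF, hcol, hm, hcl.resolve_right fun h => ?_⟩
    have := Finset.card_le_card (supp_subset n (τ 12))
    rw [Finset.card_range] at this
    omega

/-- Colours all components of the light part that contain a token. -/
def colourAll : RamProgram :=
  .seq (tabulate 12 30 (.const 0)) <|
  forLoop 36 0 <| .ite (.load 11 (sc 36)) (.ite (.load 10 (sc 36)) (.ite (.load 12 (sc 36)) .skip
    (.seq (.store 12 (sc 36) (.const 1)) propagate)) .skip) .skip

/-- Between two roots the coloured part is closed, which is the condition for starting a new root in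
`Coloring.root`. -/
theorem wp_colourAll {N n : ℕ} {G : SimpleGraph ℕ} {L : Finset ℕ} {tok : ℕ → Prop}
    {σ : RamMemory} (hN : n ≤ N) (hC : ColCtx n G L tok σ) :
    Wp N colourAll σ fun τ => Frame [12, 30, 36, 37, 38, 39] σ τ ∧ Coloured n G L tok τ ∧
      ∀ t ∈ L, tok t → t ∈ supp n (τ 12) := by
  have hLn : ∀ t ∈ L, t < n := by
    intro t ht
    rw [← hC.light] at ht
    exact (mem_supp.1 ht).1
  refine Wp.seq ((Wp.tabulate hC.ctx.size hN (by omega) (by omega) (by omega) (fun _ => 0)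
    (fun _ _ _ _ _ => rfl)).mono ?_)
  rintro τ₁ ⟨hF₁, h12⟩
  have hC₁ := hC.frame hF₁ (by simp)
  refine Wp.forLoop hC₁.ctx.size hN (by omega)
    (fun i τ => Frame [12, 30, 36, 37, 38, 39] σ τ ∧ Coloured n G L tok τ ∧
      ClosedIn G L (supp n (τ 12)) ∧ ∀ t ∈ L, t < i → tok t → t ∈ supp n (τ 12)) ?_ ?_ ?_
  · have e : upd τ₁ 36 0 0 12 = τ₁ 12 := upd_ne (by omega) _ _ _
    unfold Coloured
    rw [e]
    refine ⟨(hF₁.mono (by simp)).upd (by simp) _ _, ⟨_, _, Coloring.zero, h12⟩, ?_, ?_⟩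
    · intro u hu
      exact absurd (h12 u (mem_supp.1 hu).1) (mem_supp.1 hu).2
    · intro t _ h
      omega
  · rintro i hi τ ⟨hF, hcol, hcl, ht⟩ hxi h0
    have hCτ := hC.frame hF (by simp)
    have fin : ∀ υ, Frame [12, 37, 38, 39] τ υ → Coloured n G L tok υ →
        ClosedIn G L (supp n (υ 12)) → supp n (τ 12) ⊆ supp n (υ 12) →
        (i ∈ L → tok i → i ∈ supp n (υ 12)) →
        υ 36 0 = i ∧ υ 0 0 = n ∧ Frame [12, 30, 36, 37, 38, 39] σ (upd υ 36 0 (i + 1)) ∧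
        Coloured n G L tok (upd υ 36 0 (i + 1)) ∧
        ClosedIn G L (supp n (upd υ 36 0 (i + 1) 12)) ∧
        ∀ t ∈ L, t < i + 1 → tok t → t ∈ supp n (upd υ 36 0 (i + 1) 12) := by
      intro υ hFυ a1 a2 a3 a4
      have e : upd υ 36 0 (i + 1) 12 = υ 12 := upd_ne (by omega) _ _ _
      unfold Coloured
      rw [e]
      refine ⟨?_, ?_, (hF.trans hFυ (by simp)).upd (by simp) _ _, a1, a2, ?_⟩
      · rw [hFυ 36 (by simp), hxi]
      · rw [hFυ 0 (by simp), h0]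
      · intro t htL hti htt
        by_cases h : t = i
        · subst h
          exact a4 htL htt
        · exact a3 (ht t htL (by omega) htt)
    have hL : τ 11 i ≠ 0 ↔ i ∈ L := by
      rw [← hCτ.light]
      simp [mem_supp, hi]
    have hskip := fin τ (Frame.refl _ _) hcol hcl subset_rfl
    refine Wp.ite (fun h1 => Wp.ite (fun h2 => Wp.ite (fun h3 => Wp.skip (hskip fun _ _ => ?_))
      (fun h3 => Wp.seq (Wp.store ?_))) (fun h2 => Wp.skip (hskip fun _ h => ?_)))
      (fun h1 => Wp.skip (hskip fun h => ?_))
    · simp only [RamExpr.eval, hxi] at h3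
      exact mem_supp.2 ⟨hi, h3⟩
    · simp only [RamExpr.eval, hxi] at h1 h2 h3
      simp only [RamExpr.eval, hxi]
      have hFu : Frame [12, 37, 38, 39] τ (upd τ 12 i 1) := (Frame.refl _ _).upd (by simp) _ _
      have hsu : supp n (upd τ 12 i 1 12) = insert i (supp n (τ 12)) := supp_upd hi (by omega)
      obtain ⟨col, R, hc, hagree⟩ := hcol
      have hroot : Coloured n G L tok (upd τ 12 i 1) := by
        refine ⟨_, _, hc.root ?_ (hL.1 h1) ((hCτ.tok i hi).1 h2) (hagree i hi ▸ h3), ?_⟩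
        · intro u v e hu hv
          have hun := hLn u (hc.mem u hu)
          rw [← hagree v (hLn v hv)]
          rw [← hagree u hun] at hu
          exact (mem_supp.1 (hcl u (mem_supp.2 ⟨hun, hu⟩) v hv e)).2
        · intro w hw
          simp only [upd_apply, true_and, Function.update_apply]
          split_ifs
          · rfl
          · exact hagree w hw
      refine (wp_propagate hN (hCτ.frame hFu (by simp)) hroot ?_).mono ?_
      · rw [hsu]
        exact ⟨i, Finset.mem_insert_self _ _⟩
      · rintro υ ⟨hFυ, b1, b2, b3⟩
        rw [hsu] at b2
        exact fin υ (hFu.trans hFυ (by simp)) b1 b3 ((Finset.subset_insert _ _).trans b2)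
          fun _ _ => b2 (Finset.mem_insert_self _ _)
    · simp only [RamExpr.eval, hxi] at h2
      exact absurd h2 ((hCτ.tok i hi).2 h)
    · simp only [RamExpr.eval, hxi] at h1
      exact absurd h1 (hL.2 h)
  · rintro τ ⟨hF, hcol, -, ht⟩
    exact ⟨hF, hcol, fun t htL => ht t htL (hLn t htL)⟩

/-! ### Enumeration of the sets `Q` and the search -/

/-- Writes into `9` the set of the last `k` base `n` digits of the number in `32`. -/
def decode : RamProgram :=
  .seq (tabulate 9 30 (.const 0)) <| .seq (.store 33 (.const 0) (sc 32)) <|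
  forLoop 35 21 <| .seq (.store 34 (.const 0) (.const 0)) <|
    .seq (.while (.sub (.add (sc 33) (.const 1)) (sc 0))
      (.seq (.store 33 (.const 0) (.sub (sc 33) (sc 0)))
        (.store 34 (.const 0) (.add (sc 34) (.const 1))))) <|
    .seq (.store 9 (sc 33) (.const 1)) (.store 33 (.const 0) (sc 34))

/-- The number in `33` is replaced by its remainder modulo `n`, the quotient is put into `34`. -/
theorem wp_divMod {N n x : ℕ} {σ : RamMemory} (hn : 0 < n) (h0 : σ 0 0 = n) (hx : σ 33 0 = x)
    (hxN : x ≤ N) (h34 : σ 34 0 = 0) :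
    Wp N (.while (.sub (.add (sc 33) (.const 1)) (sc 0))
      (.seq (.store 33 (.const 0) (.sub (sc 33) (sc 0)))
        (.store 34 (.const 0) (.add (sc 34) (.const 1))))) σ fun τ =>
      Frame [33, 34] σ τ ∧ τ 33 0 = x % n ∧ τ 34 0 = x / n := by
  refine Wp.loop (fun i τ => Frame [33, 34] σ τ ∧ τ 34 0 = i ∧ τ 33 0 + i * n = x)
    ⟨Frame.refl _ _, h34, by omega⟩ ?_ ?_
  · rintro i τ ⟨hF, h1, h2⟩ hc
    have h0τ : τ 0 0 = n := by rw [hF 0 (by simp), h0]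
    simp only [RamExpr.eval, h0τ] at hc
    have hi : i ≤ i * n := Nat.le_mul_of_pos_right _ hn
    refine ⟨by omega, Wp.seq (Wp.store (Wp.store ?_))⟩
    refine ⟨(hF.upd (by simp) _ _).upd (by simp) _ _, ?_, ?_⟩
    · simp [RamExpr.eval, upd_apply, h1]
    · rw [upd_ne (by omega)]
      simp only [RamExpr.eval, upd_self, h0τ]
      rw [add_mul]
      omega
  · rintro i τ ⟨hF, h1, h2⟩ hc
    have h0τ : τ 0 0 = n := by rw [hF 0 (by simp), h0]
    simp only [RamExpr.eval, h0τ] at hc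
    have hlt : τ 33 0 < n := by omega
    refine ⟨hF, ?_, ?_⟩
    · rw [← h2, Nat.add_mul_mod_self_right, Nat.mod_eq_of_lt hlt]
    · rw [← h2, Nat.add_mul_div_right _ _ hn, Nat.div_eq_of_lt hlt, h1, zero_add]

/-- Digits are split off by repeated subtraction, as the machine has no division; for `n = 0` this
would not halt, hence `hkn`. Repeated digits encode smaller sets. -/
theorem wp_decode {N n k j : ℕ} {σ : RamMemory} (hN : n ≤ N) (hkN : k ≤ N) (hjN : j ≤ N)
    (hkn : 0 < k → 0 < n) (h0 : σ 0 0 = n) (h21 : σ 21 0 = k) (h32 : σ 32 0 = j) :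
    Wp N decode σ fun τ => Frame [9, 30, 33, 34, 35] σ τ ∧ (∀ u < n, τ 9 u ≤ 1) ∧
      ∀ u < n, (τ 9 u ≠ 0 ↔ ∃ i < k, u = j / n ^ i % n) := by
  refine Wp.seq ((Wp.tabulate h0 hN (by omega) (by omega) (by omega) (fun _ => 0)
    (fun _ _ _ _ _ => rfl)).mono ?_)
  rintro τ₁ ⟨hF₁, h9⟩
  refine Wp.seq (Wp.store ?_)
  simp only [RamExpr.eval]
  have h32₁ : τ₁ 32 0 = j := by rw [hF₁ 32 (by simp), h32]
  rw [h32₁]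
  have hF₂ : Frame [9, 30, 33, 34, 35] σ (upd τ₁ 33 0 j) := (hF₁.mono (by simp)).upd (by simp) _ _
  have h21₂ : upd τ₁ 33 0 j 21 0 = k := by rw [hF₂ 21 (by simp), h21]
  refine Wp.forLoop h21₂ hkN (by omega) (fun i τ => Frame [9, 30, 33, 34, 35] σ τ ∧
    τ 33 0 = j / n ^ i ∧ (∀ u < n, τ 9 u ≤ 1) ∧
    ∀ u < n, (τ 9 u ≠ 0 ↔ ∃ i' < i, u = j / n ^ i' % n)) ?_ ?_ ?_
  · refine ⟨hF₂.upd (by simp) _ _, ?_, ?_, ?_⟩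
    · rw [upd_ne (by omega)]
      simp
    · intro u hu
      rw [upd_ne (by omega), upd_ne (by omega), h9 u hu]
      omega
    · intro u hu
      rw [upd_ne (by omega), upd_ne (by omega), h9 u hu]
      simp
  · rintro i hi τ ⟨hF, h33, hle, hdig⟩ hxi hb
    have hn : 0 < n := hkn (by omega)
    refine Wp.seq (Wp.store (Wp.seq ?_))
    simp only [RamExpr.eval]
    have hF₃ : Frame [9, 30, 33, 34, 35] σ (upd τ 34 0 0) := hF.upd (by simp) _ _
    have e0 : upd τ 34 0 0 0 0 = n := by rw [hF₃ 0 (by simp), h0]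
    have e33 : upd τ 34 0 0 33 0 = j / n ^ i := by rw [upd_ne (by omega), h33]
    refine (wp_divMod hn e0 e33 ((Nat.div_le_self _ _).trans hjN) (upd_self _ _ _ _)).mono ?_
    rintro υ ⟨hFυ, h33υ, h34υ⟩
    have hF₄ : Frame [9, 30, 33, 34, 35] σ υ := hF₃.trans hFυ (by simp)
    have h9υ : υ 9 = τ 9 := by rw [hFυ 9 (by simp), upd_ne (by omega)]
    refine Wp.seq (Wp.store (Wp.store ?_))
    simp only [RamExpr.eval, h33υ]
    rw [upd_ne (show (34 : ℕ) ≠ 9 by omega), h34υ]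
    refine ⟨?_, ?_, ((hF₄.upd (by simp) _ _).upd (by simp) _ _).upd (by simp) _ _, ?_, ?_, ?_⟩
    · rw [upd_ne (by omega), upd_ne (by omega), hFυ 35 (by simp), upd_ne (by omega), hxi]
    · rw [upd_ne (by omega), upd_ne (by omega), hFυ 21 (by simp), upd_ne (by omega), hb]
    · rw [upd_ne (by omega), upd_self, Nat.div_div_eq_div_mul, pow_succ]
    · intro u hu
      rw [upd_ne (by omega), upd_ne (by omega), upd_apply]
      split_ifs
      · exact le_rfl
      · rw [h9υ]
        exact hle u hu
    · intro u hu
      rw [upd_ne (by omega), upd_ne (by omega), upd_apply, h9υ]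
      split_ifs with h
      · exact ⟨fun _ => ⟨i, by omega, h.2⟩, fun _ => by omega⟩
      · rw [hdig u hu]
        constructor
        · rintro ⟨i', hi', he⟩
          exact ⟨i', by omega, he⟩
        · rintro ⟨i', hi', he⟩
          have : i' ≠ i := by
            rintro rfl
            exact h ⟨rfl, he⟩
          exact ⟨i', by omega, he⟩
  · rintro τ ⟨hF, -, hle, hdig⟩
    exact ⟨hF, hle, hdig⟩

theorem exists_digits {n : ℕ} (k : ℕ) (f : ℕ → ℕ) (hf : ∀ i < k, f i < n) :
    ∃ j < n ^ k, ∀ i < k, j / n ^ i % n = f i := by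
  induction k generalizing f with
  | zero => exact ⟨0, by simp, by simp⟩
  | succ k ih =>
    obtain ⟨j, hj, hd⟩ := ih (fun i => f (i + 1)) fun i hi => hf (i + 1) (by omega)
    have h0 := hf 0 (by omega)
    refine ⟨f 0 + n * j, ?_, ?_⟩
    · rw [pow_succ]
      nlinarith [Nat.mul_le_mul_left n (Nat.succ_le_of_lt hj)]
    · intro i hi
      cases i with
      | zero => simp [Nat.add_mul_mod_self_left, Nat.mod_eq_of_lt h0]
      | succ i =>
        rw [pow_succ', ← Nat.div_div_eq_div_mul, Nat.add_mul_div_left _ _ (by omega),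
          Nat.div_eq_of_lt h0, zero_add]
        exact hd i (by omega)

/-- Every nonempty set of at most `k` numbers below `n` is the set of the digits of some number. -/
theorem exists_digits_finset {n k : ℕ} {Q : Finset ℕ} (hQ : Q ⊆ Finset.range n) (hne : Q.Nonempty)
    (hk : Q.card ≤ k) : ∃ j < n ^ k, ∀ u, u ∈ Q ↔ ∃ i < k, u = j / n ^ i % n := by
  obtain ⟨q₀, hq₀⟩ := hne
  -- Surplus digits repeat an element of `Q`; this is why `Q` has to be nonempty.
  let f : ℕ → ℕ := fun i => if h : i < Q.card then Q.equivFin.symm ⟨i, h⟩ else q₀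
  have hfQ : ∀ i, f i ∈ Q := by
    intro i
    simp only [f]
    split_ifs
    · exact (Q.equivFin.symm _).2
    · exact hq₀
  obtain ⟨j, hj, hd⟩ := exists_digits (n := n) k f fun i _ => Finset.mem_range.1 (hQ (hfQ i))
  refine ⟨j, hj, fun u => ⟨fun hu => ?_, ?_⟩⟩
  · refine ⟨Q.equivFin ⟨u, hu⟩, (Q.equivFin ⟨u, hu⟩).2.trans_le hk, ?_⟩
    rw [hd _ ((Q.equivFin ⟨u, hu⟩).2.trans_le hk)]
    simp [f]
  · rintro ⟨i, hi, rfl⟩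
    rw [hd i hi]
    exact hfQ i

/-- The colour classes with respect to `Q` have been tried, and no solution met is larger than
`B`. -/
def Tried (n : ℕ) (G : SimpleGraph ℕ) (F Q : Finset ℕ) (B : ℕ) : Prop :=
  Acyc G (Q : Set ℕ) → ∃ col R, CompleteColoring G F Q col R ∧
    ∀ c, c = 1 ∨ c = 2 → ∃ T : Finset ℕ, Acyc G (T : Set ℕ) ∧ Q ⊆ T ∧ (∀ v, col v = c → v ∈ T) ∧
      (Finset.range n \ T).card ≤ B

theorem Tried.mono {n : ℕ} {G : SimpleGraph ℕ} {F Q : Finset ℕ} {B B' : ℕ}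
    (h : Tried n G F Q B) (hB : B ≤ B') : Tried n G F Q B' := by
  intro hQ
  obtain ⟨col, R, hcol, hc⟩ := h hQ
  refine ⟨col, R, hcol, fun c hc' => ?_⟩
  obtain ⟨T, h1, h2, h3, h4⟩ := hc c hc'
  exact ⟨T, h1, h2, h3, h4.trans hB⟩

/-- Tries the colour class `c`. -/
def tryColour (c : ℕ) : RamProgram :=
  .seq (tabulate 13 30 (.sub (.const 1) (.add (.sub (.load 12 (sc 30)) (.const c))
    (.sub (.const c) (.load 12 (sc 30)))))) tryClass

/-- The sum of the two truncated differences vanishes exactly for colour `c`. By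
`CompleteColoring.acyc` the greedy passes then accept `Q` and the whole class. -/
theorem wp_tryColour {N n : ℕ} {G : SimpleGraph ℕ} {σ : RamMemory} {F : Finset ℕ} {c : ℕ}
    (hc : c = 1 ∨ c = 2) (hN : n ≤ N) (hC : Ctx n G σ) (hR : Recorded n G σ)
    (hF : Acyc G (F : Set ℕ)) (hFn : F ⊆ Finset.range n) {col : ℕ → ℕ} {R : Set ℕ}
    (hcol : CompleteColoring G F (supp n (σ 9)) col R) (h12 : ∀ u < n, σ 12 u = col u) :
    Wp N (tryColour c) σ fun τ => Frame [2, 5, 6, 7, 13, 23, 24, 25, 30, 31] σ τ ∧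
      Recorded n G τ ∧ σ 23 0 ≤ τ 23 0 ∧
      (Acyc G (supp n (σ 9) : Set ℕ) → ∃ T : Finset ℕ, Acyc G (T : Set ℕ) ∧ supp n (σ 9) ⊆ T ∧
        (∀ v, col v = c → v ∈ T) ∧ (Finset.range n \ T).card ≤ τ 23 0) := by
  refine Wp.seq ((Wp.tabulate hC.size hN (by omega) (by omega) (by omega)
    (fun u => 1 - (col u - c + (c - col u))) ?_).mono ?_)
  · intro u hu τ hFτ hτ
    simp [RamExpr.eval, hτ, hFτ 12 (by simp), h12 u hu]
  rintro τ ⟨hFτ, h13⟩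
  have e23 : τ 23 = σ 23 := hFτ 23 (by simp)
  have e2 : τ 2 = σ 2 := hFτ 2 (by simp)
  have e9 : τ 9 = σ 9 := hFτ 9 (by simp)
  have hRτ : Recorded n G τ := by
    unfold Recorded
    rw [e23, e2]
    exact hR
  refine (wp_tryClass hN (hC.frame hFτ (by simp)) hRτ).mono ?_
  rintro υ ⟨hFυ, h1, h2, h3⟩
  refine ⟨(hFτ.mono (by simp)).trans hFυ (by simp), h1, by rw [← e23]; exact h2, fun hQ => ?_⟩
  have hclass : ∀ v, v ∈ supp n (τ 13) ↔ col v = c := by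
    intro v
    rw [mem_supp]
    constructor
    · rintro ⟨hv, h⟩
      rw [h13 v hv] at h
      omega
    · intro h
      have hv : v ∈ lightPart G F (supp n (σ 9)) := hcol.coloring.mem v (by omega)
      have hvn := Finset.mem_range.1 (hFn (mem_lightPart.1 hv).1)
      refine ⟨hvn, ?_⟩
      rw [h13 v hvn]
      omega
  have hset : (supp n (τ 13) : Set ℕ) = {v | col v = c} := by
    ext v
    exact hclass v
  rw [e9, hset] at h3
  obtain ⟨T, a1, a2, a3, a4⟩ := h3 (hcol.acyc hF hQ (by omega))
  exact ⟨T, a1, a2, fun v hv => a3 ((hclass v).2 hv), a4⟩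

/-- Everything that is tried for the number in `32`. -/
def tryNumber : RamProgram :=
  .seq decode <| .seq computeWeights <| .seq computeLight <| .seq colourAll <|
    .seq (tryColour 1) (tryColour 2)

theorem wp_tryNumber {N n k j : ℕ} {G : SimpleGraph ℕ} {σ : RamMemory} (hN : n ≤ N) (hkN : k ≤ N)
    (hjN : j ≤ N) (hkn : 0 < k → 0 < n) (hC : Ctx n G σ) (h21 : σ 21 0 = k) (h32 : σ 32 0 = j)
    (h8 : ∀ u < n, σ 8 u ≤ 1) (hF : Acyc G (supp n (σ 8) : Set ℕ)) (hR : Recorded n G σ) :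
    Wp N tryNumber σ fun τ =>
      Frame [2, 5, 6, 7, 9, 10, 11, 12, 13, 23, 24, 25, 26, 30, 31, 33, 34, 35, 36, 37, 38, 39] σ τ ∧
      Recorded n G τ ∧ σ 23 0 ≤ τ 23 0 ∧
      ∀ Q : Finset ℕ, Q ⊆ Finset.range n → (∀ u, u ∈ Q ↔ ∃ i < k, u = j / n ^ i % n) →
        Tried n G (supp n (σ 8)) Q (τ 23 0) := by
  refine Wp.seq ((wp_decode hN hkN hjN hkn hC.size h21 h32).mono ?_)
  rintro τ₁ ⟨hF₁, hle₁, hdig⟩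
  have hC₁ := hC.frame hF₁ (by simp)
  refine Wp.seq ((wp_computeWeights hN hC₁ hle₁).mono ?_)
  rintro τ₂ ⟨hF₂, hw⟩
  have hC₂ := hC₁.frame hF₂ (by simp)
  have e92 : τ₂ 9 = τ₁ 9 := hF₂ 9 (by simp)
  have e82 : τ₂ 8 = σ 8 := by rw [hF₂ 8 (by simp), hF₁ 8 (by simp)]
  refine Wp.seq ((wp_computeLight hN hC₂ (by rw [e92]; exact hle₁) (by rw [e82]; exact h8)
    (by rw [e92]; exact hw)).mono ?_)
  rintro τ₃ ⟨hF₃, hl⟩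
  rw [e82, e92] at hl
  have hC₃ : ColCtx n G (lightPart G (supp n (σ 8)) (supp n (τ₁ 9)))
      (fun v => wt G (supp n (τ₁ 9)) v ≠ 0) τ₃ := by
    refine ⟨hC₂.frame hF₃ (by simp), hl, fun u hu => ?_⟩
    rw [hF₃ 10 (by simp), hw u hu]
  refine Wp.seq ((wp_colourAll hN hC₃).mono ?_)
  rintro τ₄ ⟨hF₄, ⟨col, R, hcol, hagree⟩, htok⟩
  have hC₄ := hC₃.ctx.frame hF₄ (by simp)
  have e9 : τ₄ 9 = τ₁ 9 := by rw [hF₄ 9 (by simp), hF₃ 9 (by simp), e92]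
  have hFn : supp n (σ 8) ⊆ Finset.range n := supp_subset _ _
  have hF₁₄ : Frame [9, 10, 11, 12, 26, 30, 33, 34, 35, 36, 37, 38, 39] σ τ₄ :=
    (((hF₁.mono (by simp)).trans hF₂ (by simp)).trans hF₃ (by simp)).trans hF₄ (by simp)
  have hCC : CompleteColoring G (supp n (σ 8)) (supp n (τ₁ 9)) col R := by
    refine ⟨hcol, fun v hv hwv => ?_⟩
    have := mem_supp.1 (htok v hv hwv)
    rw [← hagree v this.1]
    exact this.2
  have e23 : τ₄ 23 = σ 23 := hF₁₄ 23 (by simp)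
  have e2 : τ₄ 2 = σ 2 := hF₁₄ 2 (by simp)
  have hR₄ : Recorded n G τ₄ := by
    unfold Recorded
    rw [e23, e2]
    exact hR
  refine Wp.seq ((wp_tryColour (Or.inl rfl) hN hC₄ hR₄ hF hFn (e9 ▸ hCC) hagree).mono ?_)
  rintro τ₅ ⟨hF₅, hR₅, hm₅, ht₅⟩
  have e9' : τ₅ 9 = τ₁ 9 := by rw [hF₅ 9 (by simp), e9]
  have e12 : τ₅ 12 = τ₄ 12 := hF₅ 12 (by simp)
  refine (wp_tryColour (Or.inr rfl) hN (hC₄.frame hF₅ (by simp)) hR₅ hF hFn (e9' ▸ hCC)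
    (by rw [e12]; exact hagree)).mono ?_
  rintro τ₆ ⟨hF₆, hR₆, hm₆, ht₆⟩
  rw [e9] at ht₅
  rw [e9'] at ht₆
  refine ⟨((hF₁₄.mono (by simp)).trans hF₅ (by simp)).trans hF₆ (by simp), hR₆, ?_, ?_⟩
  · rw [← e23]
    exact hm₅.trans hm₆
  · intro Q hQn hQ hac
    have hQe : supp n (τ₁ 9) = Q := by
      ext u
      rw [mem_supp, hQ]
      constructor
      · rintro ⟨hu, h⟩
        exact (hdig u hu).1 h
      · intro h
        have hu := Finset.mem_range.1 (hQn ((hQ u).2 h))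
        exact ⟨hu, (hdig u hu).2 h⟩
    rw [hQe] at hCC ht₅ ht₆
    refine ⟨col, R, hCC, ?_⟩
    rintro c (rfl | rfl)
    · obtain ⟨T, a1, a2, a3, a4⟩ := ht₅ hac
      exact ⟨T, a1, a2, a3, a4.trans hm₆⟩
    · exact ht₆ hac

/-- The search over all numbers below the one in `22`. -/
def searchAll : RamProgram := forLoop 32 22 tryNumber

/-- The best size never decreases, so bounds obtained for earlier codes persist (`Tried.mono`), and
all hold with the final size. -/
theorem wp_searchAll {N n k : ℕ} {G : SimpleGraph ℕ} {σ : RamMemory} (hN : n ≤ N) (hkN : k ≤ N)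
    (hpN : n ^ k ≤ N) (hkn : 0 < k → 0 < n) (hC : Ctx n G σ) (h21 : σ 21 0 = k)
    (h22 : σ 22 0 = n ^ k) (h8 : ∀ u < n, σ 8 u ≤ 1) (hF : Acyc G (supp n (σ 8) : Set ℕ))
    (hR : Recorded n G σ) :
    Wp N searchAll σ fun τ => Recorded n G τ ∧ σ 23 0 ≤ τ 23 0 ∧
      SearchBound G (Finset.range n) (supp n (σ 8)) k (τ 23 0) := by
  refine Wp.forLoop h22 hpN (by omega) (fun i τ =>
    Frame [2, 5, 6, 7, 9, 10, 11, 12, 13, 23, 24, 25, 26, 30, 31, 32, 33, 34, 35, 36, 37, 38, 39] σ τ ∧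
      Recorded n G τ ∧ σ 23 0 ≤ τ 23 0 ∧
      ∀ j < i, ∀ Q : Finset ℕ, Q ⊆ Finset.range n → (∀ u, u ∈ Q ↔ ∃ i < k, u = j / n ^ i % n) →
        Tried n G (supp n (σ 8)) Q (τ 23 0)) ?_ ?_ ?_
  · refine ⟨(Frame.refl _ _).upd (by simp) _ _, ?_, ?_, fun j h => by omega⟩
    · unfold Recorded
      rw [upd_ne (by omega), upd_ne (by omega)]
      exact hR
    · rw [upd_ne (by omega)]
  · rintro i hi τ ⟨hFτ, hRτ, hm, ht⟩ hxi hb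
    have e8 : τ 8 = σ 8 := hFτ 8 (by simp)
    refine (wp_tryNumber (k := k) hN hkN (by omega) hkn (hC.frame hFτ (by simp))
      (by rw [hFτ 21 (by simp), h21]) hxi (by rw [e8]; exact h8) (by rw [e8]; exact hF) hRτ).mono ?_
    rintro υ ⟨hFυ, hRυ, hmυ, htυ⟩
    rw [e8] at htυ
    refine ⟨?_, ?_, (hFτ.trans hFυ (by simp)).upd (by simp) _ _, ?_, ?_, ?_⟩
    · rw [hFυ 32 (by simp), hxi]
    · rw [hFυ 22 (by simp), hb]
    · unfold Recorded
      rw [upd_ne (by omega), upd_ne (by omega)]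
      exact hRυ
    · rw [upd_ne (by omega)]
      exact hm.trans hmυ
    · intro j hj Q hQ hQd
      rw [upd_ne (by omega)]
      by_cases hji : j = i
      · subst hji
        exact htυ Q hQ hQd
      · exact (ht j (by omega) Q hQ hQd).mono hmυ
  · rintro τ ⟨-, hRτ, hm, ht⟩
    refine ⟨hRτ, hm, ?_⟩
    intro Q hQ hne hcard hac
    obtain ⟨j, hj, hd⟩ := exists_digits_finset hQ hne hcard
    exact ht j hj Q hQ hd hac

/-! ### Input, parameters and the whole algorithm -/

open Classical in
/-- The memory at the start: the graph and the ratio `p / q`. -/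
structure Input (n : ℕ) (G : SimpleGraph ℕ) (p q : ℕ) (σ : RamMemory) : Prop where
  size : σ 0 0 = n
  num : σ 0 1 = p
  den : σ 0 2 = q
  adj : ∀ u < n, ∀ v < n, σ 1 (u * n + v) = if G.Adj u v then 1 else 0
  zero : ∀ a, 2 ≤ a → ∀ i, σ a i = 0

/-- Computes the multiples of `n` and an array of ones. -/
def prepare : RamProgram :=
  .seq (forLoop 31 0 (.store 3 (.add (sc 31) (.const 1)) (.add (.load 3 (sc 31)) (sc 0))))
    (tabulate 4 31 (.const 1))

theorem wp_prepare {N n p q : ℕ} {G : SimpleGraph ℕ} {σ : RamMemory} (hN : n ≤ N)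
    (h : Input n G p q σ) : Wp N prepare σ fun τ => Frame [3, 4, 31] σ τ ∧ Ctx n G τ := by
  refine Wp.seq (Wp.forLoop h.size hN (by omega) (fun i τ => Frame [3, 31] σ τ ∧
    ∀ u ≤ i, τ 3 u = u * n) ?_ ?_ ?_)
  · refine ⟨(Frame.refl _ _).upd (by simp) _ _, fun u hu => ?_⟩
    rw [upd_ne (by omega), h.zero 3 (by omega)]
    have : u = 0 := by omega
    simp [this]
  · rintro i hi τ ⟨hF, h3⟩ hxi h0
    refine Wp.store ?_
    simp only [RamExpr.eval, hxi, h0]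
    refine ⟨?_, ?_, (hF.upd (by simp) _ _).upd (by simp) _ _, fun u hu => ?_⟩
    · rw [upd_ne (by omega), hxi]
    · rw [upd_ne (by omega), h0]
    · rw [upd_ne (by omega), upd_apply]
      split_ifs with hc
      · rw [hc.2, h3 i le_rfl]
        ring
      · exact h3 u (by omega)
  · rintro τ ⟨hF, h3⟩
    have h0 : τ 0 0 = n := by rw [hF 0 (by simp), h.size]
    refine (Wp.tabulate h0 hN (by omega) (by omega) (by omega) (fun _ => 1)
      (fun _ _ _ _ _ => rfl)).mono ?_
    rintro υ ⟨hFυ, h4⟩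
    have hF' : Frame [3, 4, 31] σ υ := (hF.mono (by simp)).trans hFυ (by simp)
    refine ⟨hF', ⟨by rw [hF' 0 (by simp), h.size], ?_, ?_, h4⟩⟩
    · rw [hF' 1 (by simp)]
      exact h.adj
    · intro u hu
      rw [hFυ 3 (by simp), h3 u hu.le]

/-- Twice an expression. -/
def dbl (e : RamExpr) : RamExpr := .add e e

/-- Chooses the parameters: `41` gets a power `8 ^ i`, `21` the largest number of vertices of the sets
to be tried, `22` the number of codes of such sets. -/
def chooseParams : RamProgram :=
  .seq (.store 40 (.const 0) (dbl (dbl (dbl (dbl (dbl (dbl (dbl (dbl (.load 0 (.const 2)))))))))))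
  <| .seq (.store 41 (.const 0) (.const 1))
  <| .seq (.while (.sub (.const 1) (.add (.sub (.const 1) (.sub (.add (.load 0 (.const 1)) (.const 1))
      (sc 40))) (.sub (.const 1) (.sub (sc 0) (sc 41)))))
    (.seq (.store 40 (.const 0) (dbl (dbl (sc 40)))) (.store 41 (.const 0) (dbl (dbl (dbl (sc 41)))))))
  <| .seq (.while (.sub (sc 0) (sc 42))
    (.seq (.store 42 (.const 0) (.add (sc 42) (sc 41)))
      (.store 21 (.const 0) (.add (sc 21) (.const 4)))))
  <| .seq (.store 22 (.const 0) (.const 1))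
  <| forLoop 43 21 <| .seq (.store 34 (.const 0) (.const 0)) <|
    .seq (accumulate 34 30 0 (sc 22)) (.store 22 (.const 0) (sc 34))

/-- The relation between the input and the parameters `i` and `k` chosen by the program. -/
structure Params (n p q i k : ℕ) : Prop where
  ratio : i = 0 ∨ 64 * 4 ^ i * q ≤ p
  atEnd : p < 256 * 4 ^ i * q ∨ n ≤ 8 ^ i
  enough : n ≤ k * 8 ^ i
  least : k = 0 ∨ (k - 1) * 8 ^ i < n

theorem Params.le {n p q i k : ℕ} (h : Params n p q i k) : k ≤ n := by
  rcases h.least with h | h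
  · omega
  · have : k - 1 ≤ (k - 1) * 8 ^ i := Nat.le_mul_of_pos_right _ (by positivity)
    omega

/-- The first loop runs while `256 * 4 ^ i * q ≤ p` and `8 ^ i < n`, a conjunction written with
truncated subtraction. The second computes `k` as the ceiling of `n / 8 ^ i` by repeated addition.
-/
theorem wp_chooseParams {N n p q : ℕ} {σ : RamMemory} (hN : 4 * n ≤ N)
    (h0 : σ 0 0 = n) (hp : σ 0 1 = p) (hq : σ 0 2 = q) (h21 : σ 21 0 = 0) (h42 : σ 42 0 = 0) :
    Wp N chooseParams σ fun τ => Frame [21, 22, 30, 34, 40, 41, 42, 43] σ τ ∧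
      ∃ i k, Params n p q i k ∧ τ 21 0 = 4 * k ∧ τ 22 0 = n ^ (4 * k) := by
  refine Wp.seq (Wp.store (Wp.seq (Wp.store (Wp.seq ?_))))
  set σ₁ := upd (upd σ 40 _ _) 41 _ _ with hσ₁
  have hF₁ : Frame [40, 41] σ σ₁ := ((Frame.refl _ _).upd (by simp) _ _).upd (by simp) _ _
  have h40 : σ₁ 40 0 = 256 * q := by
    rw [hσ₁, upd_ne (by omega)]
    simp only [RamExpr.eval, dbl, upd_self, hq]
    ring
  have h41 : σ₁ 41 0 = 1 := by simp [hσ₁, RamExpr.eval]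
  -- The threshold for entering the loop at `i` is `256 * 4 ^ i * q = 64 * 4 ^ (i + 1) * q`, so a
  -- step is made only if the ratio allows the next `i`.
  refine Wp.loop (fun i τ => Frame [40, 41] σ τ ∧ τ 40 0 = 256 * 4 ^ i * q ∧ τ 41 0 = 8 ^ i ∧
    (i = 0 ∨ 64 * 4 ^ i * q ≤ p)) ⟨hF₁, by simpa using h40, by simpa using h41, Or.inl rfl⟩ ?_ ?_
  · rintro i τ ⟨hF, e1, e2, -⟩ hc
    have f0 : τ 0 = σ 0 := hF 0 (by simp)
    simp only [RamExpr.eval, f0, h0, hp, e1, e2] at hc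
    have hi : i < 8 ^ i := Nat.lt_pow_self (by omega)
    refine ⟨by omega, Wp.seq (Wp.store (Wp.store ?_))⟩
    refine ⟨(hF.upd (by simp) _ _).upd (by simp) _ _, ?_, ?_, Or.inr ?_⟩
    · rw [upd_ne (by omega)]
      simp only [RamExpr.eval, dbl, upd_self, e1]
      ring
    · simp only [RamExpr.eval, dbl, upd_self]
      rw [upd_ne (by omega), e2]
      ring
    · have : 64 * 4 ^ (i + 1) * q = 256 * 4 ^ i * q := by ring
      omega
  rintro i τ ⟨hF, e1, e2, e3⟩ hc
  have hatEnd : p < 256 * 4 ^ i * q ∨ n ≤ 8 ^ i := by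
    have f0 : τ 0 = σ 0 := hF 0 (by simp)
    simp only [RamExpr.eval, f0, h0, hp, e1, e2] at hc
    omega
  refine Wp.seq (Wp.loop (fun k τ => Frame [21, 40, 41, 42] σ τ ∧ τ 41 0 = 8 ^ i ∧
    τ 42 0 = k * 8 ^ i ∧ τ 21 0 = 4 * k ∧ (k = 0 ∨ (k - 1) * 8 ^ i < n)) ?_ ?_ ?_)
  · refine ⟨hF.mono (by simp), e2, ?_, ?_, Or.inl rfl⟩
    · rw [hF 42 (by simp), h42, zero_mul]
    · rw [hF 21 (by simp), h21]
  · rintro k υ ⟨hFυ, a1, a2, a3, -⟩ hc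
    have f0 : υ 0 0 = n := by rw [hFυ 0 (by simp), h0]
    simp only [RamExpr.eval, f0, a2] at hc
    have hk : k ≤ k * 8 ^ i := Nat.le_mul_of_pos_right _ (by positivity)
    refine ⟨by omega, Wp.seq (Wp.store (Wp.store ?_))⟩
    refine ⟨(hFυ.upd (by simp) _ _).upd (by simp) _ _, ?_, ?_, ?_, Or.inr ?_⟩
    · rw [upd_ne (by omega), upd_ne (by omega), a1]
    · rw [upd_ne (by omega)]
      simp only [RamExpr.eval, upd_self, a1, a2]
      ring
    · simp only [RamExpr.eval, upd_self]
      rw [upd_ne (by omega), a3]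
      ring
    · simp only [Nat.add_sub_cancel]
      omega
  rintro k υ ⟨hFυ, a1, a2, a3, a4⟩ hc
  have f0 : υ 0 0 = n := by rw [hFυ 0 (by simp), h0]
  simp only [RamExpr.eval, f0, a2] at hc
  have hP : Params n p q i k := ⟨e3, hatEnd, by omega, a4⟩
  refine Wp.seq (Wp.store ?_)
  simp only [RamExpr.eval]
  have hF₂ : Frame [21, 22, 30, 34, 40, 41, 42, 43] σ (upd υ 22 0 1) :=
    (hFυ.mono (by simp)).upd (by simp) _ _
  have hk : upd υ 22 0 1 21 0 = 4 * k := by rw [upd_ne (by omega), a3]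
  -- Each power of `n` comes from the previous one by `n` additions. This loop has `4 * k ≤ 4 * n`
  -- iterations, which explains the bound on `N`.
  refine Wp.forLoop hk (by have := hP.le; omega) (by omega) (fun l τ =>
    Frame [21, 22, 30, 34, 40, 41, 42, 43] σ τ ∧ τ 22 0 = n ^ l ∧ τ 21 0 = 4 * k) ?_ ?_ ?_
  · refine ⟨hF₂.upd (by simp) _ _, ?_, ?_⟩
    · rw [upd_ne (by omega)]
      simp
    · rw [upd_ne (by omega), hk]
  · rintro l hl ω ⟨hFω, b1, -⟩ hxl hb
    refine Wp.seq (Wp.store (Wp.seq ?_))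
    simp only [RamExpr.eval]
    have h0ω : upd ω 34 0 0 0 0 = n := by rw [upd_ne (by omega), hFω 0 (by simp), h0]
    refine (Wp.accumulate h0ω (by omega) (by omega) (by omega) (by omega) (fun _ => n ^ l) ?_).mono ?_
    · intro u _ ξ hFξ _
      simp only [RamExpr.eval]
      rw [hFξ 22 (by simp), upd_ne (by omega), b1]
    · rintro ξ ⟨hFξ, hs⟩
      refine Wp.store ?_
      have hF₃ : Frame [21, 22, 30, 34, 40, 41, 42, 43] σ ξ :=
        (hFω.upd (by simp) _ _).trans hFξ (by simp)
      have g21 : ξ 21 0 = 4 * k := by rw [hFξ 21 (by simp), upd_ne (by omega), hb]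
      simp only [RamExpr.eval, hs, upd_self, Finset.sum_const, Finset.card_range, smul_eq_mul]
      refine ⟨?_, ?_, (hF₃.upd (by simp) _ _).upd (by simp) _ _, ?_, ?_⟩
      · rw [upd_ne (by omega), hFξ 43 (by simp), upd_ne (by omega), hxl]
      · rw [upd_ne (by omega), g21]
      · rw [upd_ne (by omega), upd_self]
        ring
      · rw [upd_ne (by omega), upd_ne (by omega), g21]
  · rintro ω ⟨hFω, b1, b2⟩
    exact ⟨hFω, i, k, hP, b2, b1⟩

/-- The approximation algorithm. -/
def algorithm : RamProgram :=
  .seq prepare <| .seq (.seq (greedyPass 4) record) <| .seq (tabulate 8 30 (.load 5 (sc 30))) <|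
    .seq chooseParams searchAll

/-- The first maximal forest is copied to array `8`, because array `5` is overwritten by every later
greedy construction. -/
theorem wp_algorithm {N n p q : ℕ} {G : SimpleGraph ℕ} {σ : RamMemory} (hN : 4 * n ≤ N)
    (hpow : ∀ i k, Params n p q i k → n ^ (4 * k) ≤ N) (h : Input n G p q σ) :
    Wp N algorithm σ fun τ => Recorded n G τ ∧ ∃ i k F, Params n p q i k ∧ MaxForest n G F ∧
      (Finset.range n \ F).card ≤ τ 23 0 ∧
      SearchBound G (Finset.range n) F (4 * k) (τ 23 0) := by
  have hnN : n ≤ N := by omega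
  refine Wp.seq ((wp_prepare hnN h).mono ?_)
  rintro τ₁ ⟨hF₁, hC₁⟩
  have z : ∀ a, a ∉ [3, 4, 31] → 2 ≤ a → ∀ i, τ₁ a i = 0 := fun a ha ha2 i => by
    rw [hF₁ a ha, h.zero a ha2]
  have hL := (lab_of_zero (n := n) (G := G) (σ := τ₁) fun u _ => z 5 (by simp) (by omega) u).1
  refine Wp.seq ((wp_fillAndRecord hnN hC₁ hL (Or.inl (z 23 (by simp) (by omega) 0))).mono ?_)
  rintro τ₂ ⟨hF₂, hR₂, -, hL₂, hM, -, hB⟩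
  have hC₂ := hC₁.frame hF₂ (by simp)
  refine Wp.seq ((Wp.tabulate hC₂.size hnN (by omega) (by omega) (by omega) (fun u => τ₂ 5 u) ?_).mono
    ?_)
  · intro u _ τ hF hτ
    simp [RamExpr.eval, hτ, hF 5 (by simp)]
  rintro τ₃ ⟨hF₃, h8⟩
  have hC₃ := hC₂.frame hF₃ (by simp)
  have i0 : τ₃ 0 = σ 0 := by rw [hF₃ 0 (by simp), hF₂ 0 (by simp), hF₁ 0 (by simp)]
  refine Wp.seq ((wp_chooseParams hN hC₃.size (by rw [i0, h.num]) (by rw [i0, h.den]) ?_ ?_).mono ?_)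
  · rw [hF₃ 21 (by simp), hF₂ 21 (by simp), z 21 (by simp) (by omega)]
  · rw [hF₃ 42 (by simp), hF₂ 42 (by simp), z 42 (by simp) (by omega)]
  rintro τ₄ ⟨hF₄, i, k, hP, h21, h22⟩
  have e8 : τ₄ 8 = τ₃ 8 := hF₄ 8 (by simp)
  have hF8 : supp n (τ₄ 8) = supp n (τ₂ 5) := by
    ext u
    rw [mem_supp, mem_supp, e8]
    constructor
    · rintro ⟨hu, h⟩
      exact ⟨hu, h8 u hu ▸ h⟩
    · rintro ⟨hu, h⟩
      exact ⟨hu, (h8 u hu).symm ▸ h⟩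
  have e23 : τ₄ 23 = τ₂ 23 := by rw [hF₄ 23 (by simp), hF₃ 23 (by simp)]
  have e2 : τ₄ 2 = τ₂ 2 := by rw [hF₄ 2 (by simp), hF₃ 2 (by simp)]
  have hR₄ : Recorded n G τ₄ := by
    unfold Recorded
    rw [e23, e2]
    exact hR₂
  have hkn := hP.le
  refine (wp_searchAll hnN (by omega) (hpow i k hP) (by omega) (hC₃.frame hF₄ (by simp)) h21 h22 ?_
    (by rw [hF8]; exact hM.acyc) hR₄).mono ?_
  · intro u hu
    rw [e8, h8 u hu]
    exact hL₂.le_one u hu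
  · rintro τ ⟨hR, hm, hS⟩
    rw [hF8] at hS
    rw [e23] at hm
    exact ⟨hR, i, k, _, hP, hM, hB.trans hm, hS⟩

/-! ### Translation between `Fin n` and the natural numbers -/

/-- A graph on `0, …, n - 1` as a graph on the natural numbers. -/
def toNatGraph {n : ℕ} (G : SimpleGraph (Fin n)) : SimpleGraph ℕ := G.map Fin.valEmbedding

theorem toNatGraph_adj {n : ℕ} {G : SimpleGraph (Fin n)} {u v : ℕ} :
    (toNatGraph G).Adj u v ↔ ∃ i j : Fin n, G.Adj i j ∧ (i : ℕ) = u ∧ (j : ℕ) = v := by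
  exact SimpleGraph.map_adj Fin.valEmbedding G u v

/-- The numbers of the vertices outside `S`. -/
def rest {n : ℕ} (S : Finset (Fin n)) : Finset ℕ := Finset.range n \ S.map Fin.valEmbedding

theorem mem_rest {n : ℕ} {S : Finset (Fin n)} {u : ℕ} :
    u ∈ rest S ↔ ∃ h : u < n, (⟨u, h⟩ : Fin n) ∉ S := by
  simp only [rest, Finset.mem_sdiff, Finset.mem_range, Finset.mem_map, Fin.valEmbedding_apply,
    not_exists, not_and]
  constructor
  · rintro ⟨hu, h⟩
    exact ⟨hu, fun hS => h ⟨u, hu⟩ hS rfl⟩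
  · rintro ⟨hu, h⟩
    refine ⟨hu, ?_⟩
    rintro x hx rfl
    exact h hx

theorem card_range_sdiff_rest {n : ℕ} (S : Finset (Fin n)) :
    (Finset.range n \ rest S).card = S.card := by
  have hs : S.map Fin.valEmbedding ⊆ Finset.range n := by
    intro u hu
    obtain ⟨x, -, rfl⟩ := Finset.mem_map.1 hu
    exact Finset.mem_range.2 x.2
  rw [rest, Finset.sdiff_sdiff_eq_self hs, Finset.card_map]

theorem isFVS_iff {n : ℕ} {G : SimpleGraph (Fin n)} {S : Finset (Fin n)} :
    IsFVS G S ↔ Acyc (toNatGraph G) (rest S : Set ℕ) := by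
  rw [acyc_iff_induce, IsFVS]
  constructor
  · intro h
    have hm : ∀ y : (rest S : Set ℕ), ∃ hy : y.1 < n, (⟨y.1, hy⟩ : Fin n) ∉ S :=
      fun y => mem_rest.1 y.2
    refine h.comap ⟨fun y => ⟨⟨y.1, (hm y).1⟩, (hm y).2⟩, ?_⟩ ?_
    · rintro ⟨a, ha⟩ ⟨b, hb⟩ e
      obtain ⟨i, j, hij, rfl, rfl⟩ := toNatGraph_adj.1 e
      exact hij
    · rintro ⟨a, ha⟩ ⟨b, hb⟩ e
      simpa using e
  · intro h
    refine h.comap ⟨fun x => ⟨x.1.1, mem_rest.2 ⟨x.1.2, x.2⟩⟩, ?_⟩ ?_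
    · rintro ⟨a, ha⟩ ⟨b, hb⟩ e
      exact toNatGraph_adj.2 ⟨a, b, e, rfl, rfl⟩
    · rintro ⟨a, ha⟩ ⟨b, hb⟩ e
      simpa [Fin.val_inj] using e

/-- Supersets of a feedback vertex set are feedback vertex sets, so minimality need only be tested
by returning a single vertex to the forest. -/
theorem isMinimalFVS_iff {n : ℕ} {G : SimpleGraph (Fin n)} {S : Finset (Fin n)} :
    IsMinimalFVS G S ↔ MaxForest n (toNatGraph G) (rest S) := by
  classical
  constructor
  · rintro ⟨h1, h2⟩
    refine ⟨Finset.sdiff_subset, isFVS_iff.1 h1, fun v hv hvT hac => ?_⟩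
    have hvS : (⟨v, hv⟩ : Fin n) ∈ S := by
      by_contra h
      exact hvT (mem_rest.2 ⟨hv, h⟩)
    have h3 : IsFVS G (S.erase ⟨v, hv⟩) := by
      refine isFVS_iff.2 (hac.mono ?_)
      intro u hu
      obtain ⟨hun, hu⟩ := mem_rest.1 hu
      by_cases huv : u = v
      · exact Or.inl huv
      · refine Or.inr (mem_rest.2 ⟨hun, fun h => hu (Finset.mem_erase.2 ⟨?_, h⟩)⟩)
        simpa using huv
    exact Finset.notMem_erase _ _ (h2 h3 (Finset.erase_subset _ _) hvS)
  · rintro ⟨-, h1, h2⟩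
    refine ⟨isFVS_iff.2 h1, fun S' hS' hle x hx => ?_⟩
    by_contra hx'
    refine h2 x x.2 (fun h => (mem_rest.1 h).2 hx) ((isFVS_iff.1 hS').mono ?_)
    intro u hu
    rcases hu with rfl | hu
    · exact mem_rest.2 ⟨x.2, hx'⟩
    · obtain ⟨hun, hu⟩ := mem_rest.1 hu
      exact mem_rest.2 ⟨hun, fun h => hu (hle h)⟩

theorem input_ramInput {n : ℕ} (G : SimpleGraph (Fin n)) (r : ℚ) :
    Input n (toNatGraph G) r.num.toNat r.den (ramInput G r) := by
  classical
  refine ⟨by simp [ramInput], by simp [ramInput], by simp [ramInput], fun u hu v hv => ?_,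
    fun a ha i => ?_⟩
  · have hiff : (∃ i j : Fin n, u * n + v = (i : ℕ) * n + (j : ℕ) ∧ G.Adj i j) ↔
        (toNatGraph G).Adj u v := by
      rw [toNatGraph_adj]
      constructor
      · rintro ⟨i, j, h, e⟩
        have hn : 0 < n := by omega
        have h1 : u = (i : ℕ) := by
          have := congrArg (· / n) h
          simpa [mul_comm _ n, Nat.mul_add_div hn, Nat.div_eq_of_lt hv, Nat.div_eq_of_lt j.2]
            using this
        have h2 : v = (j : ℕ) := by
          rw [h1] at h
          omega
        exact ⟨i, j, e, h1.symm, h2.symm⟩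
      · rintro ⟨i, j, e, rfl, rfl⟩
        exact ⟨i, j, rfl, e⟩
    simp [ramInput, hiff]
  · have h0 : a ≠ 0 := by omega
    have h1 : a ≠ 1 := by omega
    simp [ramInput, h0, h1]

theorem rest_ramOutput (n : ℕ) (σ : RamMemory) :
    rest (ramOutput n σ) = Finset.range n \ supp n (σ 2) := by
  ext u
  simp only [mem_rest, ramOutput, Finset.mem_filter, Finset.mem_univ, true_and, Finset.mem_sdiff,
    Finset.mem_range, mem_supp]
  constructor
  · rintro ⟨hu, h⟩
    exact ⟨hu, fun h' => h h'.2⟩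
  · rintro ⟨hu, h⟩
    exact ⟨hu, fun h' => h ⟨hu, h'⟩⟩

/-! ### Approximation ratio and running time -/

/-- The parameters chosen by the program make the search good enough for the ratio `p / q`. -/
theorem SearchBound.card_mul_le {n p q i k B : ℕ} {G : SimpleGraph ℕ} {F T : Finset ℕ}
    (hP : Params n p q i k) (hqp : q ≤ p) (hF : MaxForest n G F)
    (hFB : (Finset.range n \ F).card ≤ B) (hS : SearchBound G (Finset.range n) F (4 * k) B)
    (hT : MaxForest n G T) : (Finset.range n \ T).card * q ≤ p * B := by
  rcases hP.ratio with rfl | hr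
  -- For `i = 0` the search is exhaustive and tries `Q = T`. A forest containing the maximal forest
  -- `T` equals `T` on these vertices, so the answer is optimal.
  · have hk : n ≤ k := by simpa using hP.enough
    suffices h : (Finset.range n \ T).card ≤ B by
      calc (Finset.range n \ T).card * q ≤ B * p := Nat.mul_le_mul h hqp
        _ = p * B := mul_comm _ _
    rcases T.eq_empty_or_nonempty with rfl | hne
    -- The search covers only nonempty `Q`, but a single vertex is a forest, so an empty maximal
    -- forest forces `n = 0`.
    · have : n = 0 := by
        by_contra hn
        refine hT.maximal 0 (by omega) (by simp) ?_
        rw [acyc_insert (by simp)]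
        simp [acyc_empty]
      simp [this]
    · have hcard : T.card ≤ n := by
        have := Finset.card_le_card hT.subset
        rwa [Finset.card_range] at this
      obtain ⟨col, R, -, hc⟩ := hS T hT.subset hne (by omega) hT.acyc
      obtain ⟨T', h1, h2, -, h4⟩ := hc 1 (Or.inl rfl)
      refine (Finset.card_le_card ?_).trans h4
      intro v hv
      obtain ⟨hv1, hv2⟩ := Finset.mem_sdiff.1 hv
      refine Finset.mem_sdiff.2 ⟨hv1, fun h => ?_⟩
      refine hT.maximal v (Finset.mem_range.1 hv1) hv2 (h1.mono ?_)
      intro x hx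
      rcases hx with rfl | hx
      · exact h
      · exact h2 hx
  · have h8 : 8 ^ i = (2 ^ i) ^ 3 := by
      rw [← pow_mul, mul_comm, pow_mul]
      norm_num
    have h4 : 4 ^ i = (2 ^ i) ^ 2 := by
      rw [← pow_mul, mul_comm, pow_mul]
      norm_num
    -- The number of parts is `2 ^ i`; its square is `4 ^ i` and its cube `8 ^ i`, and `64 * 4 ^ i`
    -- is at most the ratio.
    have h := hS.card_le hF.subset hF.acyc hFB (Nat.one_le_two_pow (n := i))
      (by rw [Finset.card_range, ← h8]; exact hP.enough) hT.subset hT.acyc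
      (fun x hx => hT.maximal x (Finset.mem_range.1 hx))
    rw [← h4] at h
    calc (Finset.range n \ T).card * q ≤ 64 * 4 ^ i * B * q := Nat.mul_le_mul_right _ h
      _ = 64 * 4 ^ i * q * B := by ring
      _ ≤ p * B := Nat.mul_le_mul_right _ hr

/-- The exponent of the running time. -/
noncomputable def expo (n : ℕ) (r : ℚ) : ℝ := max 1 ((n : ℝ) / (r : ℝ) ^ (3 / 2 : ℝ))

theorem rpow_three_halves_le {x y : ℝ} (hx : 0 ≤ x) (hy : 0 ≤ y) (h : x ≤ y ^ 2) :
    x ^ (3 / 2 : ℝ) ≤ y ^ 3 := by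
  calc x ^ (3 / 2 : ℝ) ≤ (y ^ 2) ^ (3 / 2 : ℝ) := Real.rpow_le_rpow hx h (by norm_num)
    _ = y ^ 3 := by
      rw [← Real.rpow_natCast y 2, ← Real.rpow_mul hy, ← Real.rpow_natCast y 3]
      norm_num

theorem ratio_eq {r : ℚ} (hr : 1 ≤ r) : (r : ℝ) = (r.num.toNat : ℝ) / (r.den : ℝ) := by
  have h0 : 0 ≤ r.num := Rat.num_nonneg.2 (zero_le_one.trans hr)
  have h1 : ((r.num.toNat : ℤ) : ℝ) = (r.num : ℝ) := by rw [Int.toNat_of_nonneg h0]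
  rw [Rat.cast_def, ← h1, Int.cast_natCast]

theorem den_le_num {r : ℚ} (hr : 1 ≤ r) : r.den ≤ r.num.toNat := by
  have h : (1 : ℝ) ≤ (r : ℝ) := by exact_mod_cast hr
  have hd : (0 : ℝ) < (r.den : ℝ) := by exact_mod_cast r.den_pos
  rw [ratio_eq hr, le_div_iff₀ hd, one_mul] at h
  exact_mod_cast h

/-- Either `r < 256 * 4 ^ i = (16 * 2 ^ i) ^ 2`, so `r ^ (3/2) ≤ 4096 * 8 ^ i`, or `n / 8 ^ i ≤ 1`.
Rounding up gives `k ≤ 4097 * expo n r`, and `4 * 4097 = 16388`. -/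
theorem Params.four_mul_le {n i k : ℕ} {r : ℚ} (hr : 1 ≤ r)
    (h : Params n r.num.toNat r.den i k) : ((4 * k : ℕ) : ℝ) ≤ 16388 * expo n r := by
  have hE : 1 ≤ expo n r := le_max_left _ _
  have hE' : (n : ℝ) / (r : ℝ) ^ (3 / 2 : ℝ) ≤ expo n r := le_max_right _ _
  have hr1 : (1 : ℝ) ≤ (r : ℝ) := by exact_mod_cast hr
  have h8 : (0 : ℝ) < 8 ^ i := by positivity
  have hk : (k : ℝ) ≤ n / 8 ^ i + 1 := by
    rcases h.least with rfl | hl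
    · simp only [Nat.cast_zero]
      positivity
    · rcases Nat.eq_zero_or_pos k with rfl | hk
      · simp only [Nat.cast_zero]
        positivity
      · have h1 : (((k - 1) * 8 ^ i : ℕ) : ℝ) ≤ (n : ℝ) := by exact_mod_cast hl.le
        push_cast [Nat.cast_sub hk] at h1
        have := (le_div_iff₀ h8).2 h1
        linarith
  have hmain : (n : ℝ) / 8 ^ i ≤ 4096 * expo n r := by
    rcases h.atEnd with hs | hs
    · have hd : (0 : ℝ) < (r.den : ℝ) := by exact_mod_cast r.den_pos
      have hs' : (r.num.toNat : ℝ) < 256 * 4 ^ i * r.den := by exact_mod_cast hs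
      have h1 : (r : ℝ) ≤ (16 * 2 ^ i) ^ 2 := by
        rw [ratio_eq hr, div_le_iff₀ hd]
        have : ((16 * 2 ^ i) ^ 2 : ℝ) = 256 * 4 ^ i := by
          rw [mul_pow, ← pow_mul, mul_comm i 2, pow_mul]
          norm_num
        rw [this]
        exact hs'.le
      have h2 := rpow_three_halves_le (by linarith) (by positivity) h1
      have h3 : ((16 * 2 ^ i) ^ 3 : ℝ) = 4096 * 8 ^ i := by
        rw [mul_pow, ← pow_mul, mul_comm i 3, pow_mul]
        norm_num
      rw [h3] at h2
      have hpos : (0 : ℝ) < (r : ℝ) ^ (3 / 2 : ℝ) := Real.rpow_pos_of_pos (by linarith) _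
      calc (n : ℝ) / 8 ^ i = 4096 * (n / (4096 * 8 ^ i)) := by field_simp
        _ ≤ 4096 * (n / (r : ℝ) ^ (3 / 2 : ℝ)) := by gcongr
        _ ≤ 4096 * expo n r := by gcongr
    · have : (n : ℝ) / 8 ^ i ≤ 1 := by
        rw [div_le_one h8]
        exact_mod_cast hs
      linarith
  push_cast
  linarith

/-- The time bound of a program, with loops bounded by `4 * n + m ^ K`, as a power of `m`. -/
theorem time_le_pow {A d n m K t : ℕ} (hm : 2 ≤ m) (hnm : n ≤ m)
    (ht : t ≤ A * (4 * n + m ^ K + 1) ^ d) : t ≤ m ^ (A + d * (K + 5)) := by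
  -- As `m ≥ 2`, the constant factor is absorbed into the exponent.
  have hA : A ≤ m ^ A := (Nat.lt_pow_self (by omega)).le
  have h4 : 4 * n + 1 ≤ m ^ 4 := by
    have h1 : 4 ≤ m ^ 2 := by nlinarith
    have h2 : m ^ 4 = m ^ 2 * (m * m) := by ring
    nlinarith
  have hK : 1 ≤ m ^ K := Nat.one_le_pow _ _ (by omega)
  have hN : 4 * n + m ^ K + 1 ≤ m ^ (K + 5) := by
    have e : m ^ (K + 5) = m ^ K * (m ^ 4 * m) := by ring
    have h5 : m ^ 4 ≤ m ^ K * m ^ 4 := Nat.le_mul_of_pos_left _ hK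
    have h6 : m ^ K ≤ m ^ K * m ^ 4 := Nat.le_mul_of_pos_right _ (by positivity)
    have h7 : m ^ K * (m ^ 4 * m) = (m ^ K * m ^ 4) * m := by ring
    rw [e, h7]
    nlinarith
  calc t ≤ A * (4 * n + m ^ K + 1) ^ d := ht
    _ ≤ m ^ A * (m ^ (K + 5)) ^ d := Nat.mul_le_mul hA (Nat.pow_le_pow_left hN d)
    _ = m ^ (A + d * (K + 5)) := by
      rw [← pow_mul, ← pow_add, mul_comm (K + 5) d]

end MaxMinFVS

/-- One program and one constant `C` serve all graphs and all ratios.  The time bound is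
`n ^ O(n / r ^ (3/2))`; the exponent is read as at least a constant, and `n` as at least `2`. -/
theorem theorem4p2 :
    ∃ (P : RamProgram) (C : ℝ), ∀ (n : ℕ) (G : SimpleGraph (Fin n)) (r : ℚ), 1 ≤ r →
      ∃ (t : ℕ) (σ : RamMemory),
        RamRuns P (ramInput G r) t σ ∧
        IsApproxSolution G (r : ℝ) (ramOutput n σ) ∧
        (t : ℝ) ≤ (max (n : ℝ) 2) ^ (C * max 1 ((n : ℝ) / (r : ℝ) ^ (3 / 2 : ℝ))) := by
  classical
  open MaxMinFVS in
  obtain ⟨A, d, hAd⟩ := timeBound_poly algorithm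
  -- Here `16393 = 16388 + 5`: the exponent of the number of codes and the `5` lost in
  -- `time_le_pow`.
  refine ⟨algorithm, A + d * 16393, fun n G r hr => ?_⟩
  change ∃ (t : ℕ) (σ : RamMemory), _ ∧ _ ∧ (t : ℝ) ≤ (max (n : ℝ) 2) ^ (_ * expo n r)
  have hE : 1 ≤ expo n r := le_max_left _ _
  set m := max n 2 with hm
  -- A bound for `4 * k` that depends only on `n` and `r`; with it `4 * n + m ^ K` bounds all loops.
  set K := ⌊16388 * expo n r⌋₊ with hK
  have hm2 : 2 ≤ m := le_max_right _ _
  have hnm : n ≤ m := le_max_left _ _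
  have hpow : ∀ i k, Params n r.num.toNat r.den i k → n ^ (4 * k) ≤ 4 * n + m ^ K := by
    intro i k h
    have h1 : 4 * k ≤ K := Nat.le_floor (h.four_mul_le hr)
    calc n ^ (4 * k) ≤ m ^ (4 * k) := Nat.pow_le_pow_left hnm _
      _ ≤ m ^ K := Nat.pow_le_pow_right (by omega) h1
      _ ≤ 4 * n + m ^ K := Nat.le_add_left _ _
  obtain ⟨t, σ, hrun, ht, ⟨hB, hM⟩, i, k, F, hP, hF, hFB, hS⟩ :=
    wp_algorithm (N := 4 * n + m ^ K) (by omega) hpow (input_ramInput G r)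
  rw [← rest_ramOutput] at hM
  have hcard : σ 23 0 = (ramOutput n σ).card := by
    rw [hB, ← card_range_sdiff_rest, rest_ramOutput, Finset.sdiff_sdiff_eq_self (supp_subset _ _)]
  have hdpos : 0 < r.den := r.den_pos
  refine ⟨t, σ, hrun, ⟨isMinimalFVS_iff.2 hM, ?_⟩, ?_⟩
  -- Dividing by the denominator turns the bound `card * q ≤ p * B` for each minimal set into one
  -- for their supremum.
  · have hle : mmfvs G ≤ r.num.toNat * σ 23 0 / r.den := by
      refine Finset.sup_le fun S hS' => ?_
      rw [Nat.le_div_iff_mul_le hdpos, ← card_range_sdiff_rest]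
      exact hS.card_mul_le hP (den_le_num hr) hF hFB
        (isMinimalFVS_iff.1 (Finset.mem_filter.1 hS').2)
    rw [Nat.le_div_iff_mul_le hdpos] at hle
    have hle' : (mmfvs G : ℝ) * r.den ≤ r.num.toNat * σ 23 0 := by exact_mod_cast hle
    have hd : (0 : ℝ) < (r.den : ℝ) := by exact_mod_cast hdpos
    have hr0 : (0 : ℝ) < (r : ℝ) := by exact_mod_cast zero_lt_one.trans_le hr
    rw [← hcard, div_le_iff₀ hr0, ratio_eq hr, mul_div_assoc', le_div_iff₀ hd, mul_comm (σ 23 0 : ℝ)]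
    exact hle'
  · have ht' := time_le_pow hm2 hnm (ht.trans (hAd _))
    have hmr : (max (n : ℝ) 2) = (m : ℝ) := by
      rw [hm]
      push_cast
      rfl
    have hm1 : (1 : ℝ) ≤ (m : ℝ) := by exact_mod_cast (by omega : 1 ≤ m)
    have hKr : (K : ℝ) ≤ 16388 * expo n r := Nat.floor_le (by linarith)
    rw [hmr]
    calc (t : ℝ) ≤ ((m ^ (A + d * (K + 5)) : ℕ) : ℝ) := by exact_mod_cast ht'
      _ = (m : ℝ) ^ ((A + d * (K + 5) : ℕ) : ℝ) := by rw [Real.rpow_natCast, Nat.cast_pow]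
      _ ≤ (m : ℝ) ^ (((A : ℝ) + d * 16393) * expo n r) := by
        refine Real.rpow_le_rpow_of_exponent_le hm1 ?_
        push_cast
        have h1 : (A : ℝ) ≤ A * expo n r := le_mul_of_one_le_right (by positivity) hE
        have h2 : (d : ℝ) * (K + 5) ≤ d * (16393 * expo n r) := by
          gcongr
          linarith
        linarith
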